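/- Conventions. Alphabets are finite and nonempty. For a language $L\subseteq\Sigma^*$ and $w\in\Sigma^*$, the quotient of $L$ by $w$ is $w^{-1}L=\{x\mid wx\in L\}$, and the complexity $\kappa(L)$ is the number of distinct quotients of $L$ by words of $\Sigma^*$. A right ideal over $\Sigma$ is a language $L\subseteq\Sigma^*$ with $L=L\Sigma^*$. The syntactic semigroup of $L$ is $\Sigma^+/{\approx_L}$, where $x\approx_L y$ iff $wxz\in L\Leftrightarrow wyz\in L$ for all $w,z\in\Sigma^*$. For a set $S$ of quotients of $L$, let $A_S$ be the set of words of $\Sigma^*$ that lie in every quotient in $S$ and in no quotient outside $S$; the nonempty sets $A_S$ are the atoms of $L$. $L^R$ denotes the reverse of $L$. A dialect of $L\subseteq\Sigma^*$ is obtained from a partial map $\pi:\Sigma\rightharpoonup\Sigma'$ by replacing each letter $x$ by $\pi(x)$ in every word of $L$ and deleting the words that contain a letter at which $\pi$ is undefined; its alphabet is the set of values of $\pi$. The witnesses. For $n\ge4$ let $\mathcal D_n$ be the DFA with state set $Q_n=\{0,\dots,n-1\}$, alphabet $\Sigma=\{a,b,c,d\}$, initial state $0$ and set of final states $\{n-1\}$,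 where $a$ acts as the cycle $(0,1,\dots,n-2)$, $b$ as the transposition $(0,1)$, $c$ sends $1$ to $0$ and fixes all other states, and $d$ sends $q$ to $q+1$ for $0\le q\le n-2$ and fixes $n-1$. Let $L_n$ be the language of $\mathcal D_n$. Theorem (Most Complex Right Ideals). For every $n\ge4$ the DFA $\mathcal D_n$ is minimal and $L_n$ is a right ideal of complexity $n$. The stream $(L_n\mid n\ge4)$, together with some dialect streams, is most complex in the class of right ideals: each of the following values is an upper bound for all right ideals of complexity $n\ge4$ (for binary operations: for all pairs of right ideals of complexities $m,n\ge4$), over arbitrary alphabets; in 1–5 it is met by $L_n$ for every $n\ge4$. 1. The syntactic semigroup has $n^{n-1}$ elements. 2. $\Sigma^*$ is a quotient of every right ideal of complexity $n$, and $\kappa(\Sigma^*)=1$; every quotient has complexity at most $n$, and every quotient of $L_n$ other than $\Sigma^*$ has complexity exactly $n$. 3. $\kappa(L^R)=2^{n-1}$, and the number of atoms is $2^{n-1}$. 4. Every atom $A_S$ has $S\neq\emptyset$, and $\kappa(A_S)=2^{n-1}$ if $S$ is the set of all quotients, and otherwise $\kappa(A_S)=1+\sum_{x=1}^{|S|}\sum_{y=1}^{n-|S|}\binom{n-1}{x-1}\binom{n-x}{y}$.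 5. $\kappa(L^*)=n+1$. 6. Product $L'L$ of right ideals $L'$ of complexity $m$ and $L$ of complexity $n$: (a) restricted (both over the same alphabet): $m+2^{n-2}$; (b) unrestricted (alphabets $\Sigma'$ and $\Sigma$ possibly different, result over $\Sigma'\cup\Sigma$): $m+2^{n-1}+2^{n-2}+1$. 7. Boolean operations $L'\circ L$: (a) restricted: $mn$ for $\cap$ and $\oplus$, $mn-(m-1)$ for $\setminus$, $mn-(m+n-2)$ for $\cup$; (b) unrestricted: $(m+1)(n+1)$ for $\cup$ and $\oplus$ (result over $\Sigma'\cup\Sigma$), $mn+m$ for $L'\setminus L$ (result over $\Sigma'$), $mn$ for $\cap$ (result over $\Sigma'\cap\Sigma$). For each operation in 6 and 7, restricted or unrestricted, there are partial maps $\pi,\rho:\{a,b,c,d\}\rightharpoonup\{a,b,c,d\}$, independent of $m$ and $n$ (and with the same set of values in the restricted case), such that for all $m,n\ge4$ the dialect of $L_m$ given by $\pi$ and the dialect of $L_n$ given by $\rho$ are right ideals over their alphabets of complexities $m$ and $n$, and this pair meets the bound. At least four letters are required to meet all these bounds: for every $n\ge4$, a right ideal of complexity $n$ whose syntactic semigroup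 has $n^{n-1}$ elements has an alphabet of at least four letters. -/

import Mathlib

universe u

namespace StateComplexity

/-! ### Languages over an explicit alphabet

A letter type `α` is fixed, and an alphabet is a set `A` of letters of `α`; so two languages
over different alphabets live in the same type `Language α`. -/

section Languages

variable {α : Type u}

/-- `A*`: all words over the alphabet `A`, the empty word included. -/
def words (A : Set α) : Language α := {w | ∀ x ∈ w, x ∈ A}

/-- The set of (left) quotients `w⁻¹L`, for `w` a word over `A`. -/
def quotients (A : Set α) (L : Language α) : Set (Language α) :=
  {K | ∃ w ∈ words A, K = L.leftQuotient w}

/-- The quotient (= state) complexity `κ(L)` of `L` as a language over `A`. It is `⊤` exactly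
if there are infinitely many quotients. -/
noncomputable def complexity (A : Set α) (L : Language α) : ℕ∞ := (quotients A L).encard

/-- `L` is a right ideal over `A`: `L ⊆ A*` and `L = L A*`. -/
def IsRightIdeal (A : Set α) (L : Language α) : Prop :=
  L ≤ words A ∧ L = L * words A

/-- `L` is a right ideal of complexity `n` over the finite nonempty alphabet `A`. It is regular,
since it has finitely many quotients, and if it is nonempty then every letter of `A` occurs
in one of its words. -/
structure IsRightIdealOfComplexity (A : Set α) (n : ℕ) (L : Language α) : Prop where
  finite : A.Finite
  nonempty : A.Nonempty
  rightIdeal : IsRightIdeal A L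
  complexity_eq : complexity A L = n

/-- `A⁺`: the nonempty words over `A`. -/
def NonemptyWord (A : Set α) : Type u := {w : List α // w ≠ [] ∧ w ∈ words A}

/-- The Myhill (syntactic) congruence of `L` on `A⁺`. -/
def myhillCongruence (A : Set α) (L : Language α) : Setoid (NonemptyWord A) where
  r x y := ∀ w ∈ words A, ∀ z ∈ words A, (w ++ x.1 ++ z ∈ L ↔ w ++ y.1 ++ z ∈ L)
  iseqv :=
    { refl := fun _ _ _ _ _ => Iff.rfl
      symm := fun h w hw z hz => (h w hw z hz).symm
      trans := fun h k w hw z hz => (h w hw z hz).trans (k w hw z hz) }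

/-- The cardinality of the syntactic semigroup of `L`. -/
noncomputable def semigroupSize (A : Set α) (L : Language α) : ℕ∞ :=
  ENat.card (Quotient (myhillCongruence A L))

/-- The atomic intersection `A_S`, for a set `S` of quotients of `L`: the words over `A` that lie
in all quotients in `S` and in no quotient outside `S`. -/
def atomicIntersection (A : Set α) (L : Language α) (S : Set (Language α)) : Language α :=
  {w | w ∈ words A ∧ (∀ K ∈ S, w ∈ K) ∧ ∀ K ∈ quotients A L, K ∉ S → w ∉ K}

/-- The sets `S` of quotients of `L` for which `A_S` is an atom, that is, is nonempty. Distinct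
sets give disjoint atomic intersections, so these sets are in bijection with the atoms. -/
def atomSets (A : Set α) (L : Language α) : Set (Set (Language α)) :=
  {S | S ⊆ quotients A L ∧ ∃ w, w ∈ atomicIntersection A L S}

/-- The set of atoms of `L`. -/
def atoms (A : Set α) (L : Language α) : Set (Language α) :=
  atomicIntersection A L '' atomSets A L

end Languages

/-- The complexity bound for an atom `A_S` of a right ideal with `n` quotients, where
`s = |S| ≥ 1`. -/
def atomBound (n s : ℕ) : ℕ :=
  if s = n then 2 ^ (n - 1)
  else 1 + ∑ x ∈ Finset.Icc 1 s, ∑ y ∈ Finset.Icc 1 (n - s),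
    (n - 1).choose (x - 1) * (n - x).choose y

/-! ### The witness stream -/

/-- A DFA is minimal: all states are reachable and no two distinct states are equivalent. -/
def IsMinimalDFA {α : Type*} {σ : Type*} (M : DFA α σ) : Prop :=
  (∀ q, ∃ w, M.evalFrom M.start w = q) ∧ ∀ p q, M.acceptsFrom p = M.acceptsFrom q → p = q

/-- The four-letter alphabet `{a, b, c, d}`. -/
inductive Letter : Type
  | a | b | c | d

/-- The transformations of `{0, …, n-1}` induced by the letters: `a : (0, …, n-2)`, `b : (0, 1)`,
`c : (1 → 0)`, and `d` sends `q` to `q + 1` for `0 ≤ q ≤ n - 2` and fixes `n - 1`. -/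
def transformation (n : ℕ) : Letter → ℕ → ℕ
  | .a, q => if q < n - 2 then q + 1 else if q = n - 2 then 0 else q
  | .b, q => if q = 0 then 1 else if q = 1 then 0 else q
  | .c, q => if q = 1 then 0 else q
  | .d, q => if q ≤ n - 2 then q + 1 else q

theorem transformation_lt {n : ℕ} (hn : 4 ≤ n) (x : Letter) {q : ℕ} (hq : q < n) :
    transformation n x q < n := by
  cases x <;> simp only [transformation] <;> split_ifs <;> omega

/-- The DFA `D_n(a, b, c, d)`, with initial state `0` and the single final state `n - 1`. -/
def witnessDFA (n : ℕ) (hn : 4 ≤ n) : DFA Letter (Fin n) where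
  step q x := ⟨transformation n x q, transformation_lt hn x q.2⟩
  start := ⟨0, by omega⟩
  accept := {q | (q : ℕ) = n - 1}

/-- The language `L_n(a, b, c, d)`. -/
def witness (n : ℕ) (hn : 4 ≤ n) : Language Letter := (witnessDFA n hn).accepts

/-! ### Dialects and binary operations -/

/-- The dialect of `L` given by a partial map `π`: each letter `x` is replaced by `π x` in
every word of `L`, and words with a letter where `π` is undefined are deleted. -/
def dialect {α β : Type*} (π : α → Option β) (L : Language α) : Language β :=
  {v | ∃ w ∈ L, w.map π = v.map some}

/-- The alphabet of a dialect: the set of values of `π`. -/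
def dialectAlphabet {α β : Type*} (π : α → Option β) : Set β := {y | ∃ x, π x = some y}

/-- Product and the boolean operations `∪`, `⊕`, `\`, `∩`. -/
inductive BinOp : Type
  | product | union | symmDiff | diff | inter

/-- The result of the operation. -/
def BinOp.apply {α : Type u} : BinOp → Language α → Language α → Language α
  | .product, K, L => K * L
  | .union, K, L => K ⊔ L
  | .symmDiff, K, L => _root_.symmDiff K L
  | .diff, K, L => K \ L
  | .inter, K, L => K ⊓ L

/-- The alphabet of the result, for operands over the alphabets `A` and `B`. -/
def BinOp.alphabet {α : Type u} : BinOp → Set α → Set α → Set α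
  | .product, A, B => A ∪ B
  | .union, A, B => A ∪ B
  | .symmDiff, A, B => A ∪ B
  | .diff, A, _ => A
  | .inter, A, B => A ∩ B

/-- `f m n` is an upper bound for the complexity of `K ∘ L` for all right ideals `K`, `L` of
complexities `m, n ≥ 4` over the same alphabet, and it is met for all `m, n ≥ 4` by a dialect
stream of `(L_m)` and a dialect stream of `(L_n)` over the same alphabet, both of which
consist of right ideals of complexities `m` and `n`. The partial maps that define the dialects
do not depend on `m` and `n`. -/
def IsRestrictedComplexity (op : BinOp) (f : ℕ → ℕ → ℕ) : Prop :=
  (∀ (α : Type u) (A : Set α) (K L : Language α) (m n : ℕ), 4 ≤ m → 4 ≤ n →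
    IsRightIdealOfComplexity A m K → IsRightIdealOfComplexity A n L →
    complexity A (op.apply K L) ≤ f m n) ∧
  ∃ π ρ : Letter → Option Letter, dialectAlphabet π = dialectAlphabet ρ ∧
    ∀ (m n : ℕ) (hm : 4 ≤ m) (hn : 4 ≤ n),
      IsRightIdealOfComplexity (dialectAlphabet π) m (dialect π (witness m hm)) ∧
      IsRightIdealOfComplexity (dialectAlphabet ρ) n (dialect ρ (witness n hn)) ∧
      complexity (dialectAlphabet π)
        (op.apply (dialect π (witness m hm)) (dialect ρ (witness n hn))) = f m n

/-- The same for operands over possibly different alphabets `A` and `B`; the complexity of the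
result is taken over its own alphabet. -/
def IsUnrestrictedComplexity (op : BinOp) (f : ℕ → ℕ → ℕ) : Prop :=
  (∀ (α : Type u) (A B : Set α) (K L : Language α) (m n : ℕ), 4 ≤ m → 4 ≤ n →
    IsRightIdealOfComplexity A m K → IsRightIdealOfComplexity B n L →
    complexity (op.alphabet A B) (op.apply K L) ≤ f m n) ∧
  ∃ π ρ : Letter → Option Letter,
    ∀ (m n : ℕ) (hm : 4 ≤ m) (hn : 4 ≤ n),
      IsRightIdealOfComplexity (dialectAlphabet π) m (dialect π (witness m hm)) ∧
      IsRightIdealOfComplexity (dialectAlphabet ρ) n (dialect ρ (witness n hn)) ∧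
      complexity (op.alphabet (dialectAlphabet π) (dialectAlphabet ρ))
        (op.apply (dialect π (witness m hm)) (dialect ρ (witness n hn))) = f m n

end StateComplexity

open StateComplexity
open scoped Computability

namespace StateComplexity

section General

open Classical

variable {α : Type u} {A B : Set α} {K L M : Language α} {n : ℕ} {u v w : List α}

/-! ### Words, quotients and complexity -/

/-! A right ideal with at least two quotients has `A*` among them, and every word over `A` fixes
`A*`. Words therefore act on the `n` quotients as transformations with one prescribed fixed point,
which leaves `n ^ (n - 1)` possibilities. The bounds for reversal and atoms have the same source.
The set of quotients that contain a given word always contains `A*`, so it takes at most `2 ^ (n -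
1)` values. A quotient of an atom is described by the quotients that must contain a word and those
that must not, and reading a letter moves both sets by the action; counting the disjoint pairs with
`A*` on the positive side gives the binomial sum. The star only adds the empty word to the language.

Conversely, suppose that every transformation fixing `A*` is induced by a nonempty word (`IsFull`).
Then `exists_word_mem_iff` gives, for any set of quotients containing `A*`, a word lying in exactly
these quotients, and the bounds for quotients, reversal, atoms and the semigroup are all attained.
The witness is full (`isFull_witness`): `a` and `b` generate all permutations of `0, …, n-2`,
conjugates of `c` and of `d` followed by the inverse of `a` give every map moving a single point,
and a non-injective map factors through such a map and a map of larger rank.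

Fullness also forces four letters. Two non-commuting transpositions need two distinct permutation
letters. A map merging two quotients other than `A*` needs a non-permutation letter that sends no
other quotient to `A*`, and a map sending a quotient into `A*` needs a non-permutation letter that
does so (`four_le_encard`).

For boolean operations the quotients of the result come from pairs of quotients, some of which
coincide because of `A*`. A quotient of a product `KL` is a proper quotient of `K` times `L`, or
`A*L` together with a union of quotients of `L`, where `L` itself is absorbed. With different
alphabets a letter foreign to one operand empties the quotient of that operand, which acts as one
additional state. The lower bounds reach all these configurations with a few letters and separate
them by explicit words: powers of `d` locate a state on a line, and rotations by `a` followed by `d`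
single out one state of a set. -/

theorem mem_words : w ∈ words A ↔ ∀ x ∈ w, x ∈ A := Iff.rfl

@[simp]
theorem nil_mem_words : ([] : List α) ∈ words A := by simp [mem_words]

@[simp]
theorem append_mem_words : u ++ v ∈ words A ↔ u ∈ words A ∧ v ∈ words A := by
  simp only [mem_words, List.mem_append]
  exact ⟨fun h => ⟨fun x hx => h x (.inl hx), fun x hx => h x (.inr hx)⟩,
    fun h x hx => hx.elim (h.1 x) (h.2 x)⟩

@[simp]
theorem cons_mem_words {x : α} : x :: w ∈ words A ↔ x ∈ A ∧ w ∈ words A := by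
  simp [mem_words]

@[simp]
theorem reverse_mem_words : w.reverse ∈ words A ↔ w ∈ words A := by simp [mem_words]

theorem replicate_mem_words {x : α} (hx : x ∈ A) (k : ℕ) : List.replicate k x ∈ words A :=
  fun _ hy => List.eq_of_mem_replicate hy ▸ hx

theorem words_mono (h : A ⊆ B) : words A ≤ words B := fun _ hw x hx => h (hw x hx)

theorem leftQuotient_words (hw : w ∈ words A) : (words A).leftQuotient w = words A :=
  Language.ext fun x => by simp [hw]

theorem leftQuotient_le (h : L ≤ words A) : L.leftQuotient w ≤ words A := fun x hx =>
  (append_mem_words.1 (h hx : w ++ x ∈ words A)).2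

theorem leftQuotient_eq_bot (h : L ≤ words A) (hw : w ∉ words A) : L.leftQuotient w = ⊥ :=
  Language.ext fun x => by
    simp only [Language.mem_leftQuotient]
    exact ⟨fun hx => hw (append_mem_words.1 (h hx : w ++ x ∈ words A)).1, fun hx => hx.elim⟩

theorem mem_quotients_self : L ∈ quotients A L := ⟨[], nil_mem_words, rfl⟩

theorem leftQuotient_mem_quotients (hM : M ∈ quotients A L) (hw : w ∈ words A) :
    M.leftQuotient w ∈ quotients A L := by
  obtain ⟨u, hu, rfl⟩ := hM
  exact ⟨u ++ w, by simp [hu, hw], (Language.leftQuotient_append _ _ _).symm⟩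

theorem quotients_subset (hM : M ∈ quotients A L) : quotients A M ⊆ quotients A L := by
  rintro _ ⟨w, hw, rfl⟩
  exact leftQuotient_mem_quotients hM hw

/-- All upper bounds take this form: a finite set that contains every quotient is exhibited and
counted. -/
theorem complexity_le_of_mem {F : Finset (Language α)} {N : ℕ}
    (h : ∀ w ∈ words A, L.leftQuotient w ∈ F) (hF : F.card ≤ N) : complexity A L ≤ N := by
  calc (quotients A L).encard ≤ (F : Set (Language α)).encard :=
        Set.encard_le_encard (by rintro _ ⟨w, hw, rfl⟩; exact h w hw)
    _ = F.card := Set.encard_coe_eq_coe_finsetCard F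
    _ ≤ N := by exact_mod_cast hF

theorem card_le_complexity {γ : Type*} {T : Finset γ} {g : γ → Language α}
    (h : ∀ t ∈ T, g t ∈ quotients A L) (hg : Set.InjOn g T) : (T.card : ℕ∞) ≤ complexity A L := by
  rw [← Set.encard_coe_eq_coe_finsetCard T, ← hg.encard_image]
  exact Set.encard_le_encard (by rintro _ ⟨t, ht, rfl⟩; exact h t ht)

theorem complexity_words : complexity A (words A) = 1 := by
  have : quotients A (words A) = {words A} := by
    ext M
    constructor
    · rintro ⟨w, hw, rfl⟩
      exact leftQuotient_words hw
    · rintro rfl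
      exact mem_quotients_self
  rw [complexity, this, Set.encard_singleton]

/-! ### Right ideals -/

namespace IsRightIdeal

variable (h : IsRightIdeal A L)
include h

theorem append_mem (hu : u ∈ L) (hv : v ∈ words A) : u ++ v ∈ L := by
  rw [h.2]
  exact Language.append_mem_mul hu hv

theorem leftQuotient_of_mem (hu : u ∈ L) : L.leftQuotient u = words A :=
  le_antisymm (leftQuotient_le h.1) fun _ hv => h.append_mem hu hv

theorem leftQuotient_eq_words_iff : L.leftQuotient u = words A ↔ u ∈ L := by
  refine ⟨fun hu => ?_, h.leftQuotient_of_mem⟩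
  have : [] ∈ L.leftQuotient u := hu ▸ nil_mem_words
  simpa using this

/-- The finality test: once a quotient of a right ideal contains the empty word it contains every
extension of it. -/
theorem eq_words_iff (hM : M ∈ quotients A L) : M = words A ↔ [] ∈ M := by
  obtain ⟨u, -, rfl⟩ := hM
  rw [h.leftQuotient_eq_words_iff]
  simp

end IsRightIdeal

namespace IsRightIdealOfComplexity

theorem finite_quotients (h : IsRightIdealOfComplexity A n L) : (quotients A L).Finite :=
  Set.finite_of_encard_eq_coe h.complexity_eq

/-- The finite set of quotients. -/
noncomputable def quot (h : IsRightIdealOfComplexity A n L) : Finset (Language α) :=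
  h.finite_quotients.toFinset

theorem mem_quot (h : IsRightIdealOfComplexity A n L) : M ∈ h.quot ↔ M ∈ quotients A L :=
  h.finite_quotients.mem_toFinset

theorem card_quot (h : IsRightIdealOfComplexity A n L) : h.quot.card = n := by
  have := h.complexity_eq
  rw [complexity, h.finite_quotients.encard_eq_coe_toFinset_card] at this
  exact_mod_cast this

theorem exists_mem (h : IsRightIdealOfComplexity A n L) (hn : 2 ≤ n) : ∃ u, u ∈ L := by
  by_contra! hL
  have : complexity A L ≤ (1 : ℕ) := complexity_le_of_mem (F := {L}) (fun w _ => by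
    rw [Finset.mem_singleton]
    exact Language.ext fun x => by simp [hL]) (by simp)
  rw [h.complexity_eq] at this
  have : n ≤ 1 := by exact_mod_cast this
  omega

theorem words_mem_quotients (h : IsRightIdealOfComplexity A n L) (hn : 2 ≤ n) :
    words A ∈ quotients A L := by
  obtain ⟨u, hu⟩ := h.exists_mem hn
  exact ⟨u, h.rightIdeal.1 hu, (h.rightIdeal.leftQuotient_of_mem hu).symm⟩

theorem words_mem_quot (h : IsRightIdealOfComplexity A n L) (hn : 2 ≤ n) : words A ∈ h.quot :=
  h.mem_quot.2 (h.words_mem_quotients hn)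

theorem card_erase (h : IsRightIdealOfComplexity A n L) (hn : 2 ≤ n) :
    (h.quot.erase (words A)).card = n - 1 := by
  rw [Finset.card_erase_of_mem (h.words_mem_quot hn), h.card_quot]

theorem ne_words (h : IsRightIdealOfComplexity A n L) (hn : 2 ≤ n) : L ≠ words A := by
  intro hL
  have := h.complexity_eq
  rw [hL, complexity_words] at this
  have : n = 1 := by exact_mod_cast this.symm
  omega

theorem nil_notMem (h : IsRightIdealOfComplexity A n L) (hn : 2 ≤ n) : [] ∉ L := fun hL =>
  h.ne_words hn ((h.rightIdeal.eq_words_iff mem_quotients_self).2 hL)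

theorem complexity_quotient_le (h : IsRightIdealOfComplexity A n L) (hM : M ∈ quotients A L) :
    complexity A M ≤ n :=
  (Set.encard_le_encard (quotients_subset hM)).trans h.complexity_eq.le

/-! ### Star -/

/-- A concatenation of words of a right ideal already lies in it because of its first factor, so the
star only adds the empty word. -/
theorem mem_kstar (h : IsRightIdealOfComplexity A n L) : w ∈ KStar.kstar L ↔ w = [] ∨ w ∈ L := by
  rw [Language.mem_kstar]
  constructor
  · rintro ⟨S, rfl, hS⟩
    cases S with
    | nil => exact .inl rfl
    | cons x S =>
      refine .inr (h.rightIdeal.append_mem (hS x (by simp)) ?_)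
      intro y hy
      obtain ⟨l, hl, hy⟩ := List.mem_flatten.1 hy
      exact h.rightIdeal.1 (hS l (by simp [hl])) y hy
  · rintro (rfl | hw)
    · exact ⟨[], rfl, by simp⟩
    · exact ⟨[w], by simp, by simpa⟩

theorem leftQuotient_kstar (h : IsRightIdealOfComplexity A n L) (hw : w ≠ []) :
    (KStar.kstar L).leftQuotient w = L.leftQuotient w :=
  Language.ext fun x => by simp [h.mem_kstar, hw]

theorem complexity_kstar_le (h : IsRightIdealOfComplexity A n L) :
    complexity A (KStar.kstar L) ≤ (n + 1 : ℕ) := by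
  refine complexity_le_of_mem (F := insert (KStar.kstar L) h.quot) (fun w hw => ?_)
    ((Finset.card_insert_le _ _).trans (by rw [h.card_quot]))
  rcases eq_or_ne w [] with rfl | hw'
  · simp
  · rw [h.leftQuotient_kstar hw', Finset.mem_insert, h.mem_quot]
    exact .inr ⟨w, hw, rfl⟩

/-! ### Reverse -/

/-- The language of words whose reverse leads from `L` to a quotient in `T`. -/
def _root_.StateComplexity.reverseQuotient (A : Set α) (L : Language α) (T : Finset (Language α)) :
    Language α :=
  {x | x ∈ words A ∧ L.leftQuotient x.reverse ∈ T}

/-- The reverse of `wx` is the reverse of `x` followed by that of `w`, so the quotient by `w`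
depends only on the set of quotients of `L` that contain the reverse of `w`. -/
theorem leftQuotient_reverse (h : IsRightIdealOfComplexity A n L) {T : Finset (Language α)}
    (hT : ∀ M ∈ quotients A L, w.reverse ∈ M ↔ M ∈ T) :
    L.reverse.leftQuotient w = reverseQuotient A L T := by
  refine Language.ext fun x => ?_
  change (w ++ x).reverse ∈ L ↔ x ∈ words A ∧ L.leftQuotient x.reverse ∈ T
  rw [List.reverse_append]
  constructor
  · intro hx
    have := (append_mem_words.1 (h.rightIdeal.1 hx)).1
    exact ⟨by simpa using this, (hT _ ⟨_, this, rfl⟩).1 hx⟩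
  · rintro ⟨hx, hx'⟩
    exact (hT _ ⟨_, by simpa using hx, rfl⟩).2 hx'

/-- Every word over `A` lies in `A*`, so only sets of quotients that contain `A*` arise. -/
theorem complexity_reverse_le (h : IsRightIdealOfComplexity A n L) (hn : 2 ≤ n) :
    complexity A L.reverse ≤ (2 ^ (n - 1) : ℕ) := by
  refine complexity_le_of_mem (F := (h.quot.erase (words A)).powerset.image
    fun T => reverseQuotient A L (insert (words A) T)) (fun w hw => ?_)
    (Finset.card_image_le.trans (by rw [Finset.card_powerset, h.card_erase hn]))
  refine Finset.mem_image.2 ⟨(h.quot.erase (words A)).filter (w.reverse ∈ ·),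
    Finset.mem_powerset.2 (Finset.filter_subset _ _), (h.leftQuotient_reverse fun M hM => ?_).symm⟩
  simp only [Finset.mem_insert, Finset.mem_filter, Finset.mem_erase, h.mem_quot, hM]
  by_cases hM' : M = words A
  · simp [hM', hw]
  · simp [hM']

/-! ### Atoms -/

theorem words_mem_of_mem_atomSets (h : IsRightIdealOfComplexity A n L) (hn : 2 ≤ n)
    {S : Set (Language α)} (hS : S ∈ atomSets A L) : words A ∈ S := by
  obtain ⟨-, w, hw, -, hw'⟩ := hS
  by_contra hS
  exact hw' _ (h.words_mem_quotients hn) hS hw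

/-- Any single word of an atom recovers its index set, as the set of quotients that contain the
word. -/
theorem _root_.StateComplexity.injOn_atomicIntersection (A : Set α) (L : Language α) :
    Set.InjOn (atomicIntersection A L) (atomSets A L) := by
  have key : ∀ S ∈ atomSets A L, ∀ w ∈ atomicIntersection A L S, ∀ M,
      M ∈ S ↔ M ∈ quotients A L ∧ w ∈ M := fun S hS w hw M =>
    ⟨fun hM => ⟨hS.1 hM, hw.2.1 M hM⟩, fun hM => by
      by_contra hM'
      exact hw.2.2 M hM.1 hM' hM.2⟩
  intro S hS S' hS' hSS'
  obtain ⟨w, hw⟩ := hS.2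
  ext M
  rw [key S hS w hw, key S' hS' w (hSS' ▸ hw)]

theorem atomSets_subset (h : IsRightIdealOfComplexity A n L) (hn : 2 ≤ n) :
    atomSets A L ⊆ (fun T : Finset (Language α) => (↑(insert (words A) T) : Set (Language α))) ''
      (h.quot.erase (words A)).powerset := by
  intro S hS
  refine ⟨(h.quot.erase (words A)).filter (· ∈ S),
    Finset.mem_coe.2 (Finset.mem_powerset.2 (Finset.filter_subset _ _)), ?_⟩
  ext M
  simp only [Finset.coe_insert, Set.mem_insert_iff, Finset.mem_coe, Finset.mem_filter,
    Finset.mem_erase, h.mem_quot]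
  constructor
  · rintro (rfl | hM)
    · exact h.words_mem_of_mem_atomSets hn hS
    · exact hM.2
  · intro hM
    by_cases hM' : M = words A
    · exact .inl hM'
    · exact .inr ⟨⟨hM', hS.1 hM⟩, hM⟩

theorem encard_powerset_erase (h : IsRightIdealOfComplexity A n L) (hn : 2 ≤ n) :
    ((h.quot.erase (words A)).powerset : Set (Finset (Language α))).encard
      = (2 ^ (n - 1) : ℕ) := by
  rw [Set.encard_coe_eq_coe_finsetCard, Finset.card_powerset, h.card_erase hn]

theorem encard_atoms_le (h : IsRightIdealOfComplexity A n L) (hn : 2 ≤ n) :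
    (atoms A L).encard ≤ (2 ^ (n - 1) : ℕ) :=
  calc (atoms A L).encard ≤ (atomSets A L).encard := Set.encard_image_le _ _
    _ ≤ _ := Set.encard_le_encard (h.atomSets_subset hn)
    _ ≤ _ := Set.encard_image_le _ _
    _ = _ := h.encard_powerset_erase hn

end IsRightIdealOfComplexity

end General

section General

open Classical

variable {α : Type u} {A B : Set α} {K L M : Language α} {n : ℕ} {u v w : List α}

/-! ### Atom complexity: upper bound -/

/-- The words over `A` that lie in all members of `X` and in no member of `Y`. -/
def separated (A : Set α) (X Y : Finset (Language α)) : Language α :=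
  {x | x ∈ words A ∧ (∀ M ∈ X, x ∈ M) ∧ ∀ M ∈ Y, x ∉ M}

theorem mem_separated {X Y : Finset (Language α)} :
    w ∈ separated A X Y ↔ w ∈ words A ∧ (∀ M ∈ X, w ∈ M) ∧ ∀ M ∈ Y, w ∉ M := Iff.rfl

/-- Reading a word moves each positive and negative constraint by the action on quotients. Hence all
quotients of an atom have the same shape as the atom. -/
theorem leftQuotient_separated {X Y : Finset (Language α)} (hw : w ∈ words A) :
    (separated A X Y).leftQuotient w =
      separated A (X.image (·.leftQuotient w)) (Y.image (·.leftQuotient w)) :=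
  Language.ext fun x => by
    simp [mem_separated, hw]

theorem separated_eq_bot {X Y : Finset (Language α)} (h : words A ∈ Y ∨ ¬ Disjoint X Y) :
    separated A X Y = ⊥ := by
  refine Language.ext fun x => ⟨fun hx => ?_, fun hx => hx.elim⟩
  rcases h with h | h
  · exact absurd hx.1 (hx.2.2 _ h)
  · obtain ⟨M, hX, hY⟩ := Finset.not_disjoint_iff.1 h
    exact absurd (hx.2.1 M hX) (hx.2.2 M hY)

namespace IsRightIdealOfComplexity

variable (h : IsRightIdealOfComplexity A n L)
include h

/-- The index set for the nonempty quotients of an atom `A_S` with `|S| = s`. -/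
noncomputable def atomIndex (s : ℕ) :
    Finset (Σ _ : ℕ, Σ _ : ℕ, Σ _ : Finset (Language α), Finset (Language α)) :=
  (Finset.Icc 1 s).sigma fun x => (Finset.Icc 1 (n - s)).sigma fun y =>
    -- The positive set always contains `A*`, so only its other `x - 1` members are chosen.
    (Finset.powersetCard (x - 1) (h.quot.erase (words A))).sigma fun X =>
      Finset.powersetCard y (h.quot \ insert (words A) X)

theorem card_atomIndex (hn : 2 ≤ n) (s : ℕ) : (h.atomIndex s).card =
    ∑ x ∈ Finset.Icc 1 s, ∑ y ∈ Finset.Icc 1 (n - s), (n - 1).choose (x - 1) * (n - x).choose y := by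
  simp only [atomIndex, Finset.card_sigma]
  refine Finset.sum_congr rfl fun x hx => Finset.sum_congr rfl fun y _ => ?_
  rw [Finset.sum_const_nat (m := (n - x).choose y), Finset.card_powersetCard, h.card_erase hn]
  intro X hX
  obtain ⟨hX, hc⟩ := Finset.mem_powersetCard.1 hX
  have hX' : words A ∉ X := fun hh => by simpa using hX hh
  rw [Finset.card_powersetCard, Finset.card_sdiff_of_subset, Finset.card_insert_of_notMem hX', hc,
    h.card_quot]
  · congr 1
    have := (Finset.mem_Icc.1 hx).1
    omega
  · exact Finset.insert_subset (h.words_mem_quot hn) (hX.trans (Finset.erase_subset _ _))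

theorem mem_atomIndex {s x y : ℕ} {X Y : Finset (Language α)} :
    (⟨x, y, X, Y⟩ : Σ _ : ℕ, Σ _ : ℕ, Σ _ : Finset (Language α), Finset (Language α))
      ∈ h.atomIndex s ↔ (1 ≤ x ∧ x ≤ s) ∧ (1 ≤ y ∧ y ≤ n - s) ∧
        (X ⊆ h.quot.erase (words A) ∧ X.card = x - 1) ∧
        Y ⊆ h.quot \ insert (words A) X ∧ Y.card = y := by
  simp only [atomIndex, Finset.mem_sigma, Finset.mem_Icc, Finset.mem_powersetCard]

theorem exists_finset {S : Set (Language α)} (hS : S ⊆ quotients A L) :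
    ∃ T : Finset (Language α), (T : Set (Language α)) = S ∧ T ⊆ h.quot := by
  refine ⟨h.quot.filter (· ∈ S), ?_, Finset.filter_subset _ _⟩
  ext M
  simp only [Finset.mem_coe, Finset.mem_filter, h.mem_quot]
  exact ⟨fun hM => hM.2, fun hM => ⟨hS hM, hM⟩⟩

theorem atomicIntersection_eq (T : Finset (Language α)) :
    atomicIntersection A L T = separated A T (h.quot \ T) :=
  Language.ext fun x => by
    rw [mem_separated]
    change _ ∧ _ ∧ _ ↔ _
    simp [h.mem_quot]

theorem image_subset {T : Finset (Language α)} (hT : T ⊆ h.quot) (hw : w ∈ words A) :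
    T.image (·.leftQuotient w) ⊆ h.quot := by
  intro M hM
  obtain ⟨M, hM', rfl⟩ := Finset.mem_image.1 hM
  exact h.mem_quot.2 (leftQuotient_mem_quotients (h.mem_quot.1 (hT hM')) hw)

omit h in
theorem words_mem_image {T : Finset (Language α)} (hT : words A ∈ T) (hw : w ∈ words A) :
    words A ∈ T.image (·.leftQuotient w) :=
  Finset.mem_image.2 ⟨_, hT, leftQuotient_words hw⟩

/-- The images `X` and `Y` of `S` and its complement have at most `s` and `n - s` members, and `X`
contains `A*`. Either `X` and `Y` conflict and the quotient is empty, which accounts for the summand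
1, or they are disjoint and counted by the double sum. If `S` contains all quotients, then `Y` is
empty and only `X` varies. -/
theorem complexity_atom_le (hn : 2 ≤ n) {S : Set (Language α)} (hS : S ∈ atomSets A L) {s : ℕ}
    (hs : S.encard = s) : complexity A (atomicIntersection A L S) ≤ atomBound n s := by
  have heS := h.words_mem_of_mem_atomSets hn hS
  obtain ⟨T, rfl, hT⟩ := h.exists_finset hS.1
  have hTs : T.card = s := by
    rw [Set.encard_coe_eq_coe_finsetCard] at hs
    exact_mod_cast hs
  have heT : words A ∈ T := heS
  rw [h.atomicIntersection_eq, atomBound]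
  split_ifs with hsn
  · have hTQ : T = h.quot := Finset.eq_of_subset_of_card_le hT (by rw [hTs, hsn, h.card_quot])
    subst hTQ
    rw [Finset.sdiff_self]
    refine complexity_le_of_mem (F := (h.quot.erase (words A)).powerset.image
      fun X => separated A (insert (words A) X) ∅) (fun w hw => ?_)
      (Finset.card_image_le.trans (by rw [Finset.card_powerset, h.card_erase hn]))
    rw [leftQuotient_separated hw, Finset.image_empty]
    refine Finset.mem_image.2 ⟨(h.quot.image (·.leftQuotient w)).erase (words A),
      Finset.mem_powerset.2 (Finset.erase_subset_erase _ (h.image_subset hT hw)), ?_⟩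
    rw [Finset.insert_erase (words_mem_image heT hw)]
  · have hsn' : s < n := lt_of_le_of_ne (hTs ▸ h.card_quot ▸ Finset.card_le_card hT) hsn
    refine complexity_le_of_mem (F := insert ⊥ ((h.atomIndex s).image
      fun i => separated A (insert (words A) i.2.2.1) i.2.2.2)) (fun w hw => ?_) ?_
    · rw [leftQuotient_separated hw, Finset.mem_insert]
      set X := T.image (·.leftQuotient w) with hX
      set Y := (h.quot \ T).image (·.leftQuotient w) with hY
      have heX : words A ∈ X := words_mem_image heT hw
      by_cases hXY : words A ∈ Y ∨ ¬ Disjoint X Y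
      · exact .inl (separated_eq_bot hXY)
      · push Not at hXY
        have hXs : X.card ≤ s := hTs ▸ Finset.card_image_le
        have hYs : Y.card ≤ n - s := by
          refine Finset.card_image_le.trans ?_
          rw [Finset.card_sdiff_of_subset hT, h.card_quot, hTs]
        have hY0 : 0 < Y.card := by
          rw [Finset.card_pos, hY, Finset.image_nonempty, ← Finset.card_pos,
            Finset.card_sdiff_of_subset hT, h.card_quot, hTs]
          omega
        have hX0 : 0 < X.card := Finset.card_pos.2 ⟨_, heX⟩
        refine .inr (Finset.mem_image.2 ⟨⟨X.card, Y.card, X.erase (words A), Y⟩,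
          h.mem_atomIndex.2 ⟨⟨hX0, hXs⟩, ⟨hY0, hYs⟩,
            ⟨Finset.erase_subset_erase _ (h.image_subset hT hw), Finset.card_erase_of_mem heX⟩,
            ?_, rfl⟩, ?_⟩)
        · rw [Finset.insert_erase heX]
          exact Finset.subset_sdiff.2 ⟨h.image_subset Finset.sdiff_subset hw, hXY.2.symm⟩
        · simp only [Finset.insert_erase heX]
    · refine (Finset.card_insert_le _ _).trans ?_
      rw [add_comm, ← h.card_atomIndex hn]
      exact Nat.add_le_add_left Finset.card_image_le 1

/-! ### The action of words on quotients -/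

/-- The map on quotients induced by a word, restricted to the quotients other than `A*`. -/
noncomputable def action (x : NonemptyWord A) :
    ↥(h.quot.erase (words A)) → ↥h.quot := fun M =>
  ⟨M.1.leftQuotient x.1, h.mem_quot.2 (leftQuotient_mem_quotients
    (h.mem_quot.1 (Finset.mem_of_mem_erase M.2)) x.2.2)⟩

/-- Contexts leading to `A*` accept everything and carry no information, so the action on the
remaining quotients determines the class. -/
theorem myhillCongruence_iff (x y : NonemptyWord A) :
    (myhillCongruence A L).r x y ↔ h.action x = h.action y := by
  constructor
  · intro hxy
    funext ⟨M, hM⟩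
    obtain ⟨w, hw, rfl⟩ := h.mem_quot.1 (Finset.mem_of_mem_erase hM)
    refine Subtype.ext (Language.ext fun z => ?_)
    by_cases hz : z ∈ words A
    · simpa [action] using hxy w hw z hz
    · have : ∀ u, u ++ z ∉ L := fun u hu => hz (append_mem_words.1 (h.rightIdeal.1 hu)).2
      simp only [action, Language.mem_leftQuotient, ← List.append_assoc, this]
  · intro hxy w hw z hz
    by_cases hM : L.leftQuotient w = words A
    · have hwL := (h.rightIdeal.leftQuotient_eq_words_iff).1 hM
      simp only [List.append_assoc]
      exact iff_of_true (h.rightIdeal.append_mem hwL (by simp [x.2.2, hz]))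
        (h.rightIdeal.append_mem hwL (by simp [y.2.2, hz]))
    · have := congrArg Subtype.val
        (congrFun hxy ⟨_, Finset.mem_erase.2 ⟨hM, h.mem_quot.2 ⟨w, hw, rfl⟩⟩⟩)
      have : z ∈ (L.leftQuotient w).leftQuotient x.1 ↔ z ∈ (L.leftQuotient w).leftQuotient y.1 := by
        rw [show (L.leftQuotient w).leftQuotient x.1 = (L.leftQuotient w).leftQuotient y.1 from this]
      simpa using this

/-- The action of the syntactic semigroup on the quotients other than `A*`. -/
noncomputable def semigroupAction :
    Quotient (myhillCongruence A L) → (↥(h.quot.erase (words A)) → ↥h.quot) :=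
  Quotient.lift h.action fun x y hxy => (h.myhillCongruence_iff x y).1 hxy

theorem injective_semigroupAction : Function.Injective h.semigroupAction := by
  rintro ⟨x⟩ ⟨y⟩ hxy
  exact Quotient.sound ((h.myhillCongruence_iff x y).2 hxy)

theorem card_fun (hn : 2 ≤ n) :
    Nat.card (↥(h.quot.erase (words A)) → ↥h.quot) = n ^ (n - 1) := by
  rw [Nat.card_fun, Nat.card_eq_fintype_card, Nat.card_eq_fintype_card, Fintype.card_coe,
    Fintype.card_coe, h.card_erase hn, h.card_quot]

theorem semigroupSize_le (hn : 2 ≤ n) : semigroupSize A L ≤ (n ^ (n - 1) : ℕ) := by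
  rw [← h.card_fun hn, ← ENat.card_eq_coe_natCard]
  exact ENat.card_le_card_of_injective h.injective_semigroupAction

end IsRightIdealOfComplexity

/-- Every map of the quotients of `L` into themselves that fixes `A*` is induced by a nonempty
word. -/
def IsFull (A : Set α) (L : Language α) : Prop :=
  ∀ f : Language α → Language α, (∀ M ∈ quotients A L, f M ∈ quotients A L) →
    f (words A) = words A →
    ∃ w ∈ words A, w ≠ [] ∧ ∀ M ∈ quotients A L, M.leftQuotient w = f M

/-! ### Consequences of fullness: the unary bounds are attained -/

namespace IsRightIdealOfComplexity

variable (h : IsRightIdealOfComplexity A n L)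
include h

/-- An injection between finite sets of the same size is onto, so a semigroup of maximal size
induces every admissible map. -/
theorem isFull_of_semigroupSize (hn : 2 ≤ n) (hs : semigroupSize A L = (n ^ (n - 1) : ℕ)) :
    IsFull A L := by
  have hbij : Function.Bijective h.semigroupAction := by
    refine Function.Injective.bijective_of_nat_card_le h.injective_semigroupAction ?_
    rw [h.card_fun hn]
    have : Finite (Quotient (myhillCongruence A L)) :=
      Finite.of_injective _ h.injective_semigroupAction
    rw [semigroupSize, ENat.card_eq_coe_natCard] at hs
    exact le_of_eq (by exact_mod_cast hs.symm)
  intro f hf hfe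
  obtain ⟨⟨x⟩, hx⟩ := hbij.2 fun M =>
    ⟨f M.1, h.mem_quot.2 (hf _ (h.mem_quot.1 (Finset.mem_of_mem_erase M.2)))⟩
  refine ⟨x.1, x.2.2, x.2.1, fun M hM => ?_⟩
  by_cases hMe : M = words A
  · rw [hMe, hfe, leftQuotient_words x.2.2]
  · exact congrArg Subtype.val (congrFun hx ⟨M, Finset.mem_erase.2 ⟨hMe, h.mem_quot.2 hM⟩⟩)

variable (hF : IsFull A L)
include hF

theorem semigroupSize_eq (hn : 2 ≤ n) : semigroupSize A L = (n ^ (n - 1) : ℕ) := by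
  rw [← h.card_fun hn, ← ENat.card_eq_coe_natCard]
  refine ENat.card_congr (Equiv.ofBijective h.semigroupAction
    ⟨h.injective_semigroupAction, fun g => ?_⟩)
  obtain ⟨w, hw, hw0, hg⟩ := hF (fun M => if hM : M ∈ h.quot.erase (words A) then (g ⟨M, hM⟩).1
    else words A) (fun M _ => by
      split_ifs
      · exact h.mem_quot.1 (g _).2
      · exact h.words_mem_quotients hn) (by simp)
  refine ⟨Quotient.mk _ ⟨w, hw0, hw⟩, funext fun M => Subtype.ext ?_⟩
  have := hg M.1 (h.mem_quot.1 (Finset.mem_of_mem_erase M.2))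
  rw [dif_pos M.2] at this
  exact this

/-- A word inducing the map that sends `T` to `A*` and everything else to `L` has the required
property, because `A*` contains the empty word and `L` does not. -/
theorem exists_word_mem_iff (hn : 2 ≤ n) {T : Finset (Language α)} (hT : words A ∈ T) :
    ∃ w ∈ words A, ∀ M ∈ quotients A L, w ∈ M ↔ M ∈ T := by
  obtain ⟨w, hw, -, hf⟩ := hF (fun M => if M ∈ T then words A else L) (fun M _ => by
    split_ifs
    · exact h.words_mem_quotients hn
    · exact mem_quotients_self) (by simp [hT])
  refine ⟨w, hw, fun M hM => ?_⟩
  have h1 : w ∈ M ↔ [] ∈ M.leftQuotient w := by simp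
  rw [h1, hf M hM]
  split_ifs with hMT <;> simp [hMT, h.nil_notMem hn]

/-- From a quotient `M` other than `A*`, a map sending `M` to any prescribed quotient is admissible,
so `M` reaches all quotients of `L`. -/
theorem complexity_quotient_eq (hn : 2 ≤ n) (hM : M ∈ quotients A L) (hMe : M ≠ words A) :
    complexity A M = n := by
  refine le_antisymm (h.complexity_quotient_le hM) ?_
  rw [← h.complexity_eq]
  refine Set.encard_le_encard fun K hK => ?_
  obtain ⟨w, hw, -, hf⟩ := hF (fun N => if N = M then K else words A) (fun N _ => by
    split_ifs
    · exact hK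
    · exact h.words_mem_quotients hn) (by simp [Ne.symm hMe])
  exact ⟨w, hw, by rw [hf M hM, if_pos rfl]⟩

theorem complexity_reverse_eq (hn : 2 ≤ n) : complexity A L.reverse = (2 ^ (n - 1) : ℕ) := by
  refine le_antisymm (h.complexity_reverse_le hn) ?_
  rw [← h.card_erase hn, ← Finset.card_powerset]
  refine card_le_complexity (g := fun T => reverseQuotient A L (insert (words A) T))
    (fun T _ => ?_) fun T hT T' hT' hTT' => ?_
  · obtain ⟨w, hw, hwT⟩ := h.exists_word_mem_iff hF hn (Finset.mem_insert_self (words A) T)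
    exact ⟨w.reverse, by simpa, (h.leftQuotient_reverse (by simpa using hwT)).symm⟩
  -- The set `T` can be read off the language: a quotient by `u` other than `A*` belongs to `T`
  -- exactly when the language contains the reverse of `u`.
  · have key : ∀ T ⊆ h.quot.erase (words A), ∀ M, M ∈ T ↔
        M ≠ words A ∧ ∃ u ∈ words A, M = L.leftQuotient u ∧
          u.reverse ∈ reverseQuotient A L (insert (words A) T) := by
      intro T hT M
      constructor
      · intro hM
        have := Finset.mem_erase.1 (hT hM)
        obtain ⟨u, hu, rfl⟩ := h.mem_quot.1 this.2
        refine ⟨this.1, u, hu, rfl, by simpa, ?_⟩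
        simp [hM]
      · rintro ⟨hMe, u, hu, rfl, -, hu'⟩
        simpa [hMe] using hu'
    ext M
    rw [key T (Finset.mem_powerset.1 hT), key T' (Finset.mem_powerset.1 hT')]
    simp only at hTT'
    rw [hTT']

theorem mem_atomSets (hn : 2 ≤ n) {T : Finset (Language α)} (hT : words A ∈ T) (hTQ : T ⊆ h.quot) :
    (T : Set (Language α)) ∈ atomSets A L := by
  refine ⟨fun M hM => h.mem_quot.1 (hTQ hM), ?_⟩
  obtain ⟨w, hw, hwT⟩ := h.exists_word_mem_iff hF hn hT
  exact ⟨w, hw, fun M hM => (hwT M (h.mem_quot.1 (hTQ hM))).2 hM,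
    fun M hM hMT => by rwa [hwT M hM]⟩

theorem encard_atoms_eq (hn : 2 ≤ n) : (atoms A L).encard = (2 ^ (n - 1) : ℕ) := by
  rw [atoms, (injOn_atomicIntersection A L).encard_image]
  refine le_antisymm ((Set.encard_le_encard (h.atomSets_subset hn)).trans
    ((Set.encard_image_le _ _).trans (h.encard_powerset_erase hn).le)) ?_
  have hinj : Set.InjOn (fun T : Finset (Language α) =>
      (↑(insert (words A) T) : Set (Language α))) (h.quot.erase (words A)).powerset := by
    intro T hT T' hT' hTT'
    have hTT' := Finset.coe_injective hTT'
    have key : ∀ T ∈ (↑(h.quot.erase (words A)).powerset : Set (Finset (Language α))),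
        words A ∉ T := fun T hT hh => by
      have := Finset.mem_powerset.1 (Finset.mem_coe.1 hT) hh
      simp at this
    rw [← Finset.erase_insert (key T hT), hTT', Finset.erase_insert (key T' hT')]
  rw [← h.encard_powerset_erase hn, ← hinj.encard_image]
  refine Set.encard_le_encard ?_
  rintro _ ⟨T, hT, rfl⟩
  exact h.mem_atomSets hF hn (Finset.mem_insert_self _ _) (Finset.insert_subset
    (h.words_mem_quot hn) ((Finset.mem_powerset.1 hT).trans (Finset.erase_subset _ _)))

omit h hF in
-- The map inverts an embedding of `U` into `T` and takes the default value `d` outside its image.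
theorem _root_.StateComplexity.exists_map_onto {γ : Type*} {T U : Finset γ} (d : γ)
    (hTU : U.card ≤ T.card) :
    ∃ f : γ → γ, (∀ t, f t = d ∨ f t ∈ U) ∧ ∀ x ∈ U, ∃ t ∈ T, f t = x := by
  obtain ⟨g⟩ : Nonempty (↥U ↪ ↥T) :=
    Function.Embedding.nonempty_of_card_le (by simpa using hTU)
  refine ⟨fun t => if ht : ∃ x : ↥U, (g x : γ) = t then (ht.choose : γ) else d, fun t => ?_,
    fun x hx => ⟨g ⟨x, hx⟩, (g ⟨x, hx⟩).2, ?_⟩⟩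
  · dsimp only
    split_ifs with ht
    · exact .inr ht.choose.2
    · exact .inl rfl
  · have ht : ∃ y : ↥U, (g y : γ) = g ⟨x, hx⟩ := ⟨_, rfl⟩
    dsimp only
    rw [dif_pos ht]
    exact congrArg Subtype.val (g.injective (Subtype.ext ht.choose_spec))

/-- Two extreme words of the language on the left are tested. One lies in exactly the members of
`X`, which bounds `X'`; the other lies in every quotient outside `Y`, which bounds `Y'`. -/
theorem subset_of_separated_eq (hn : 2 ≤ n) {X Y X' Y' : Finset (Language α)} (hX : words A ∈ X)
    (hY : Y ⊆ h.quot \ X) (hX' : X' ⊆ h.quot) (hXQ : X ⊆ h.quot) (hY' : Y' ⊆ h.quot)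
    (heq : separated A X Y = separated A X' Y') : X' ⊆ X ∧ Y' ⊆ Y := by
  have hYX := fun M hM => Finset.mem_sdiff.1 (@hY M hM)
  constructor
  · obtain ⟨w, hw, hwX⟩ := h.exists_word_mem_iff hF hn hX
    have : w ∈ separated A X Y := ⟨hw, fun M hM => (hwX M (h.mem_quot.1 (hXQ hM))).2 hM,
      fun M hM => by
        rw [hwX M (h.mem_quot.1 (hYX M hM).1)]
        exact (hYX M hM).2⟩
    rw [heq] at this
    exact fun M hM => (hwX M (h.mem_quot.1 (hX' hM))).1 (this.2.1 M hM)
  · have heY : words A ∈ h.quot \ Y :=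
      Finset.mem_sdiff.2 ⟨h.words_mem_quot hn, fun hh => (hYX _ hh).2 hX⟩
    obtain ⟨w, hw, hwX⟩ := h.exists_word_mem_iff hF hn heY
    have : w ∈ separated A X Y := ⟨hw, fun M hM => (hwX M (h.mem_quot.1 (hXQ hM))).2
        (Finset.mem_sdiff.2 ⟨hXQ hM, fun hh => (hYX _ hh).2 hM⟩), fun M hM => by
        rw [hwX M (h.mem_quot.1 (hYX M hM).1)]
        simp [hM]⟩
    rw [heq] at this
    intro M hM
    have h1 := this.2.2 M hM
    rw [hwX M (h.mem_quot.1 (hY' hM))] at h1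
    by_contra h2
    exact h1 (Finset.mem_sdiff.2 ⟨hY' hM, h2⟩)

/-- By fullness it suffices to find one map fixing `A*` that carries `T` onto `X` and the complement
of `T` onto `Y`; the size conditions provide it. -/
theorem separated_mem_quotients {T X Y : Finset (Language α)} {d : Language α}
    (hT : words A ∈ T) (hTQ : T ⊆ h.quot) (hX : X ⊆ h.quot) (hY : Y ⊆ h.quot)
    (heX : words A ∈ X) (hXc : X.card ≤ T.card)
    (hYc : Y.card ≤ (h.quot \ T).card) (hd : d ∈ Y ∨ h.quot \ T = ∅) :
    separated A X Y ∈ quotients A (separated A T (h.quot \ T)) := by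
  have he : words A ∈ quotients A L := h.mem_quot.1 (hX heX)
  -- On `T` the surplus quotients are sent to `A*`, which lies in `X`; on the complement they are
  -- sent to `d`, which lies in `Y`. The point `A*` is removed from both sides because it must be
  -- fixed.
  obtain ⟨f, hf, hf'⟩ := exists_map_onto (T := T.erase (words A)) (U := X.erase (words A))
    (words A) (by rw [Finset.card_erase_of_mem hT, Finset.card_erase_of_mem heX]; omega)
  obtain ⟨g, hg, hg'⟩ := exists_map_onto d hYc
  have hfX : ∀ M, f M ∈ X := fun M => (hf M).elim (fun hh => hh ▸ heX) Finset.mem_of_mem_erase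
  have hgY : ∀ M ∈ h.quot \ T, g M ∈ Y := fun M hM => (hg M).elim
    (fun hh => hd.elim (fun hd => hh ▸ hd) fun hd => by simp [hd] at hM) id
  obtain ⟨w, hw, -, hwf⟩ := hF
    (fun M => if M = words A then words A else if M ∈ T then f M else if M ∈ h.quot then g M else L)
    (fun M hM => by
      split_ifs with h1 h2 h3
      · exact he
      · exact h.mem_quot.1 (hX (hfX M))
      · exact h.mem_quot.1 (hY (hgY M (Finset.mem_sdiff.2 ⟨h3, h2⟩)))
      · exact mem_quotients_self) (by simp)
  have hTX : T.image (·.leftQuotient w) = X := by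
    ext K
    rw [Finset.mem_image]
    constructor
    · rintro ⟨M, hM, rfl⟩
      rw [hwf M (h.mem_quot.1 (hTQ hM))]
      split_ifs
      · exact heX
      · exact hfX M
    · intro hK
      by_cases hKe : K = words A
      · exact ⟨_, hT, by rw [hwf _ he, if_pos rfl, hKe]⟩
      · obtain ⟨M, hM, hMK⟩ := hf' K (Finset.mem_erase.2 ⟨hKe, hK⟩)
        have hM' := Finset.mem_erase.1 hM
        exact ⟨M, hM'.2, by rw [hwf M (h.mem_quot.1 (hTQ hM'.2)), if_neg hM'.1, if_pos hM'.2, hMK]⟩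
  have hTY : (h.quot \ T).image (·.leftQuotient w) = Y := by
    have hval : ∀ M ∈ h.quot \ T, M.leftQuotient w = g M := fun M hM => by
      have hM' := Finset.mem_sdiff.1 hM
      rw [hwf M (h.mem_quot.1 hM'.1), if_neg (fun hh : M = words A => hM'.2 (by rwa [hh])), if_neg hM'.2,
        if_pos hM'.1]
    ext K
    rw [Finset.mem_image]
    constructor
    · rintro ⟨M, hM, rfl⟩
      rw [hval M hM]
      exact hgY M hM
    · intro hK
      obtain ⟨M, hM, hMK⟩ := hg' K hK
      exact ⟨M, hM, by rw [hval M hM, hMK]⟩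
  exact ⟨w, hw, by rw [leftQuotient_separated hw, hTX, hTY]⟩

theorem complexity_atom_eq (hn : 2 ≤ n) {S : Set (Language α)} (hS : S ∈ atomSets A L) {s : ℕ}
    (hs : S.encard = s) : complexity A (atomicIntersection A L S) = atomBound n s := by
  refine le_antisymm (h.complexity_atom_le hn hS hs) ?_
  have heS := h.words_mem_of_mem_atomSets hn hS
  obtain ⟨T, rfl, hT⟩ := h.exists_finset hS.1
  have hTs : T.card = s := by
    rw [Set.encard_coe_eq_coe_finsetCard] at hs
    exact_mod_cast hs
  have heT : words A ∈ T := heS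
  have he := h.words_mem_quot hn
  rw [h.atomicIntersection_eq, atomBound]
  split_ifs with hsn
  · have hTQ : T = h.quot := Finset.eq_of_subset_of_card_le hT (by rw [hTs, hsn, h.card_quot])
    rw [← h.card_erase hn, ← Finset.card_powerset]
    have hX : ∀ X ∈ (h.quot.erase (words A)).powerset,
        insert (words A) X ⊆ h.quot ∧ words A ∉ X := fun X hX => by
      have hX := Finset.mem_powerset.1 hX
      exact ⟨Finset.insert_subset he (hX.trans (Finset.erase_subset _ _)),
        fun hh => by simpa using hX hh⟩
    refine card_le_complexity (g := fun X => separated A (insert (words A) X) ∅)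
      (fun X hXm => ?_) fun X hXm X' hXm' hXX' => ?_
    · exact h.separated_mem_quotients hF (d := ⊥) heT hT (hX X hXm).1 (Finset.empty_subset _)
        (Finset.mem_insert_self _ _) (hTQ ▸ Finset.card_le_card (hX X hXm).1) (by simp)
        (.inr (by simp [hTQ]))
    · have h1 := (h.subset_of_separated_eq hF hn (Finset.mem_insert_self _ _)
        (Finset.empty_subset _) (hX X' hXm').1 (hX X hXm).1 (Finset.empty_subset _) hXX').1
      have h2 := (h.subset_of_separated_eq hF hn (Finset.mem_insert_self _ _)
        (Finset.empty_subset _) (hX X hXm).1 (hX X' hXm').1 (Finset.empty_subset _) hXX'.symm).1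
      rw [← Finset.erase_insert (hX X hXm).2, ← Finset.erase_insert (hX X' hXm').2,
        Finset.Subset.antisymm h1 h2]
  · have hc : (h.quot \ T).card = n - s := by
      rw [Finset.card_sdiff_of_subset hT, h.card_quot, hTs]
    have hsn' : s < n := lt_of_le_of_ne (hTs ▸ h.card_quot ▸ Finset.card_le_card hT) hsn
    -- The index `none` stands for the empty quotient and accounts for the summand 1.
    rw [add_comm, ← h.card_atomIndex hn, ← Finset.card_insertNone]
    have key : ∀ i ∈ h.atomIndex s, insert (words A) i.2.2.1 ⊆ h.quot ∧ words A ∉ i.2.2.1 ∧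
        i.2.2.2 ⊆ h.quot \ insert (words A) i.2.2.1 ∧ i.1 = i.2.2.1.card + 1 ∧ i.1 ≤ s ∧
        i.2.1 = i.2.2.2.card ∧ 1 ≤ i.2.1 ∧ i.2.1 ≤ n - s := by
      rintro ⟨x, y, X, Y⟩ hi
      obtain ⟨⟨hx, hxs⟩, ⟨hy, hys⟩, ⟨hX, hXc⟩, hY, hYc⟩ := h.mem_atomIndex.1 hi
      exact ⟨Finset.insert_subset he (hX.trans (Finset.erase_subset _ _)),
        fun hh => by simpa using hX hh, hY, by dsimp only; omega, hxs, hYc.symm, hy, hys⟩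
    have hne : ∀ i ∈ h.atomIndex s,
        separated A (insert (words A) i.2.2.1) i.2.2.2 ≠ ⊥ := by
      intro i hi hbot
      obtain ⟨hX, -, hY, -⟩ := key i hi
      obtain ⟨w, hw, hwX⟩ := h.exists_word_mem_iff hF hn (Finset.mem_insert_self (words A) i.2.2.1)
      have : w ∈ separated A (insert (words A) i.2.2.1) i.2.2.2 :=
        ⟨hw, fun M hM => (hwX M (h.mem_quot.1 (hX hM))).2 hM, fun M hM => by
          have := Finset.mem_sdiff.1 (hY hM)
          rw [hwX M (h.mem_quot.1 this.1)]
          exact this.2⟩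
      rw [hbot] at this
      exact this.elim
    refine card_le_complexity
      (g := fun o => o.elim ⊥ fun i => separated A (insert (words A) i.2.2.1) i.2.2.2)
      (fun o ho => ?_) fun o ho o' ho' hoo' => ?_
    · cases o with
      | none =>
        obtain ⟨M, hM⟩ : (h.quot \ T).Nonempty := Finset.card_pos.1 (by omega)
        -- The empty quotient is reached by collapsing all quotients to `A*`, which puts `A*` on
        -- both sides.
        have := h.separated_mem_quotients hF (X := {words A}) (Y := {words A}) (d := words A)
          heT hT (by simpa) (by simpa) (by simp) (by simpa using Finset.card_pos.2 ⟨_, heT⟩)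
          (by rw [Finset.card_singleton]; exact Finset.card_pos.2 ⟨_, hM⟩) (by simp)
        rwa [separated_eq_bot (X := {words A}) (.inl (Finset.mem_singleton_self _))] at this
      | some i =>
        obtain ⟨hX, heX, hY, hx, hxs, hy, hy1, hys⟩ := key i (Finset.some_mem_insertNone.1 ho)
        obtain ⟨d, hd⟩ : i.2.2.2.Nonempty := Finset.card_pos.1 (by omega)
        exact h.separated_mem_quotients hF heT hT hX (hY.trans Finset.sdiff_subset)
          (Finset.mem_insert_self _ _) (by rw [Finset.card_insert_of_notMem heX]; omega)
          (by omega) (.inl hd)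
    · cases o with
      | none =>
        cases o' with
        | none => rfl
        | some i => exact absurd hoo'.symm (hne i (Finset.some_mem_insertNone.1 ho'))
      | some i =>
        cases o' with
        | none => exact absurd hoo' (hne i (Finset.some_mem_insertNone.1 ho))
        | some j =>
          obtain ⟨hX, heX, hY, hx, -, hy, -⟩ := key i (Finset.some_mem_insertNone.1 ho)
          obtain ⟨hX', heX', hY', hx', -, hy', -⟩ := key j (Finset.some_mem_insertNone.1 ho')
          have h1 := h.subset_of_separated_eq hF hn (Finset.mem_insert_self _ _) hY hX' hX
            (hY'.trans Finset.sdiff_subset) hoo'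
          have h2 := h.subset_of_separated_eq hF hn (Finset.mem_insert_self _ _) hY' hX hX'
            (hY.trans Finset.sdiff_subset) hoo'.symm
          obtain ⟨x, y, X, Y⟩ := i
          obtain ⟨x', y', X', Y'⟩ := j
          dsimp only at heX heX' h1 h2
          have hXX : X = X' := by
            rw [← Finset.erase_insert heX, ← Finset.erase_insert heX',
              Finset.Subset.antisymm h1.1 h2.1]
          have hYY : Y = Y' := Finset.Subset.antisymm h2.2 h1.2
          subst hXX hYY
          simp only at hx hx' hy hy'
          subst hx hx' hy hy'
          rfl

end IsRightIdealOfComplexity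

end General

section General

open Classical

variable {α : Type u} {A B : Set α} {K L M : Language α} {m n : ℕ} {u v w : List α}

/-! ### Four letters are needed for the largest syntactic semigroup -/

/-- The letters of `A` that act injectively on the quotients of `L`. -/
def permLetters (A : Set α) (L : Language α) : Set α :=
  {x | x ∈ A ∧ Set.InjOn (·.leftQuotient [x]) (quotients A L)}

theorem leftQuotient_cons (x : α) :
    L.leftQuotient (x :: w) = (L.leftQuotient [x]).leftQuotient w :=
  Language.leftQuotient_append L [x] w

theorem words_permLetters_le : words (permLetters A L) ≤ words A := words_mono fun _ hx => hx.1

/-- The word is cut at its first letter that does not permute the quotients. -/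
theorem mem_words_permLetters_or (hw : w ∈ words A) : w ∈ words (permLetters A L) ∨
    ∃ u x v, w = u ++ x :: v ∧ u ∈ words (permLetters A L) ∧ x ∈ A ∧ x ∉ permLetters A L ∧
      v ∈ words A := by
  induction w with
  | nil => exact .inl nil_mem_words
  | cons x w ih =>
    obtain ⟨hx, hw⟩ := cons_mem_words.1 hw
    by_cases hxP : x ∈ permLetters A L
    · rcases ih hw with h | ⟨u, y, v, rfl, hu, hy⟩
      · exact .inl (cons_mem_words.2 ⟨hxP, h⟩)
      · exact .inr ⟨x :: u, y, v, rfl, cons_mem_words.2 ⟨hxP, hu⟩, hy⟩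
    · exact .inr ⟨[], x, w, rfl, nil_mem_words, hx, hxP, hw⟩

namespace IsRightIdealOfComplexity

variable (h : IsRightIdealOfComplexity A n L)
include h

theorem exists_leftQuotient_eq (hw : w ∈ words (permLetters A L)) (hM : M ∈ quotients A L) :
    ∃ M' ∈ quotients A L, M'.leftQuotient w = M := by
  induction w generalizing M with
  | nil => exact ⟨M, hM, rfl⟩
  | cons x w ih =>
    obtain ⟨hx, hw⟩ := cons_mem_words.1 hw
    obtain ⟨M', hM', rfl⟩ := ih hw hM
    have hinj : Set.InjOn (·.leftQuotient [x]) (h.quot : Set (Language α)) := fun K hK N hN =>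
      hx.2 (h.mem_quot.1 hK) (h.mem_quot.1 hN)
    have hmaps : Set.MapsTo (·.leftQuotient [x]) (h.quot : Set (Language α)) h.quot :=
      fun K hK => h.mem_quot.2
        (leftQuotient_mem_quotients (h.mem_quot.1 hK) (cons_mem_words.2 ⟨hx.1, nil_mem_words⟩))
    obtain ⟨N, hN, hNM⟩ := Finset.surjOn_of_injOn_of_card_le _ hmaps hinj le_rfl
      (h.mem_quot.2 hM')
    exact ⟨N, h.mem_quot.1 hN, by rw [leftQuotient_cons]; exact congrArg (·.leftQuotient w) hNM⟩

/-- The prefix `u` acts as a permutation, so the two quotients merged by `x` can be pulled back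
through it. -/
theorem exists_collision {x : α} (hu : u ∈ words (permLetters A L)) (hx : x ∈ A)
    (hxP : x ∉ permLetters A L) : ∃ M ∈ quotients A L, ∃ N ∈ quotients A L, M ≠ N ∧
      (M.leftQuotient u).leftQuotient [x] = (N.leftQuotient u).leftQuotient [x] := by
  have : ¬ Set.InjOn (·.leftQuotient [x]) (quotients A L) := fun hh => hxP ⟨hx, hh⟩
  simp only [Set.InjOn] at this
  push Not at this
  obtain ⟨M, hM, N, hN, hMN, hne⟩ := this
  obtain ⟨M', hM', rfl⟩ := h.exists_leftQuotient_eq hu hM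
  obtain ⟨N', hN', rfl⟩ := h.exists_leftQuotient_eq hu hN
  exact ⟨M', hM', N', hN', fun hh => hne (by rw [hh]), hMN⟩

theorem mem_words_permLetters (hw : w ∈ words A)
    (hinj : Set.InjOn (·.leftQuotient w) (quotients A L)) : w ∈ words (permLetters A L) := by
  rcases mem_words_permLetters_or (L := L) hw with h' | ⟨u, x, v, rfl, hu, hx, hxP, hv⟩
  · exact h'
  · obtain ⟨M, hM, N, hN, hne, hMN⟩ := h.exists_collision hu hx hxP
    exact absurd (hinj hM hN (by
      simp only [Language.leftQuotient_append, leftQuotient_cons (w := v), hMN])) hne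

omit h in
theorem injOn_of_mem_words_permLetters (hw : w ∈ words (permLetters A L)) :
    Set.InjOn (·.leftQuotient w) (quotients A L) := by
  induction w with
  | nil => exact fun M _ N _ hMN => hMN
  | cons x w ih =>
    obtain ⟨hx, hw⟩ := cons_mem_words.1 hw
    intro M hM N hN hMN
    simp only [leftQuotient_cons (w := w)] at hMN
    have hx' : [x] ∈ words A := cons_mem_words.2 ⟨hx.1, nil_mem_words⟩
    exact hx.2 hM hN (ih hw (leftQuotient_mem_quotients hM hx')
      (leftQuotient_mem_quotients hN hx') hMN)

variable (hF : IsFull A L)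
include hF

/-- Words over at most one letter commute. The transpositions `(p q)` and `(q r)` do not, and words
inducing them consist of permutation letters. Three quotients other than `A*` are needed here,
whence `4 ≤ n`. -/
theorem exists_permLetters_ne (hn : 4 ≤ n) :
    ∃ x ∈ permLetters A L, ∃ y ∈ permLetters A L, x ≠ y := by
  by_contra! hP
  have hcard : 2 < (h.quot.erase (words A)).card := by rw [h.card_erase (by omega)]; omega
  obtain ⟨p, q, r, hp, hq, hr, hpq, hpr, hqr⟩ := Finset.two_lt_card_iff.1 hcard
  simp only [Finset.mem_erase, h.mem_quot] at hp hq hr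
  have key : ∀ a b, a ≠ words A → a ∈ quotients A L → b ≠ words A → b ∈ quotients A L →
      ∃ w ∈ words (permLetters A L), ∀ M ∈ quotients A L,
        M.leftQuotient w = Equiv.swap a b M := by
    intro a b ha ha' hb hb'
    obtain ⟨w, hw, -, hwf⟩ := hF (Equiv.swap a b) (fun M hM => by
      rw [Equiv.swap_apply_def]
      split_ifs <;> assumption) (Equiv.swap_apply_of_ne_of_ne ha.symm hb.symm)
    refine ⟨w, h.mem_words_permLetters hw fun M hM N hN hMN => ?_, hwf⟩
    simp only [hwf M hM, hwf N hN] at hMN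
    exact (Equiv.swap a b).injective hMN
  obtain ⟨f, hf, hf'⟩ := key p q hp.1 hp.2 hq.1 hq.2
  obtain ⟨g, hg, hg'⟩ := key q r hq.1 hq.2 hr.1 hr.2
  have hcomm : f ++ g = g ++ f := by
    rcases f with _ | ⟨x, f⟩
    · simp
    · have hx := (cons_mem_words.1 hf).1
      have hrep : ∀ w ∈ words (permLetters A L), w = List.replicate w.length x := fun w hw =>
        List.eq_replicate_of_mem fun y hy => hP y (hw y hy) x hx
      rw [hrep _ hf, hrep g hg, List.replicate_append_replicate, List.replicate_append_replicate,
        add_comm]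
  -- Applied to `p`, the word `f ++ g` leads to `r` and the word `g ++ f` leads to `q`.
  have := congrArg p.leftQuotient hcomm
  rw [Language.leftQuotient_append, Language.leftQuotient_append, hf' p hp.2, hg' p hp.2,
    Equiv.swap_apply_left, Equiv.swap_apply_of_ne_of_ne hpq hpr, hg' q hq.2, hf' p hp.2,
    Equiv.swap_apply_left, Equiv.swap_apply_left] at this
  exact hqr this.symm

omit h in
-- The map that moves only `p`, onto `q`, is not injective, so a word inducing it contains a first
-- letter outside `permLetters`.
theorem exists_letter_of_map {p q : Language α} (hp : p ∈ quotients A L)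
    (hq : q ∈ quotients A L) (hpe : p ≠ words A) (hpq : p ≠ q) :
    ∃ u x v, u ∈ words (permLetters A L) ∧ x ∈ A ∧ x ∉ permLetters A L ∧ v ∈ words A ∧
      ∀ M ∈ quotients A L, ((M.leftQuotient u).leftQuotient [x]).leftQuotient v =
        if M = p then q else M := by
  obtain ⟨w, hw, -, hwf⟩ := hF (fun M => if M = p then q else M) (fun M hM => by
    split_ifs <;> assumption) (if_neg hpe.symm)
  rcases mem_words_permLetters_or (L := L) hw with h' | ⟨u, x, v, rfl, hu, hx, hxP, hv⟩
  · refine absurd (injOn_of_mem_words_permLetters h' hp hq ?_) hpq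
    simp only [hwf p hp, hwf q hq, if_pos, hpq.symm, ite_self]
  · exact ⟨u, x, v, hu, hx, hxP, hv, fun M hM => by
      rw [← leftQuotient_cons, ← Language.leftQuotient_append, hwf M hM]⟩

theorem four_le_encard (hn : 4 ≤ n) : 4 ≤ A.encard := by
  obtain ⟨a, ha, b, hb, hab⟩ := h.exists_permLetters_ne hF hn
  have he := h.words_mem_quotients (by omega)
  have hcard : 2 < (h.quot.erase (words A)).card := by rw [h.card_erase (by omega)]; omega
  obtain ⟨p, q, r, hp, hq, hr, hpq, hpr, hqr⟩ := Finset.two_lt_card_iff.1 hcard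
  simp only [Finset.mem_erase, h.mem_quot] at hp hq hr
  -- The map `p ↦ q` with `q ≠ A*` sends nothing but `A*` to `A*`, and `A*` can never be left. Hence
  -- the first non-permutation letter sends no other quotient there.
  obtain ⟨c, hc, hcP, hce⟩ : ∃ c ∈ A, c ∉ permLetters A L ∧
      ∀ M ∈ quotients A L, M.leftQuotient [c] = words A → M = words A := by
    obtain ⟨u, c, v, hu, hc, hcP, hv, hf⟩ := exists_letter_of_map hF hp.2 hq.2 hp.1 hpq
    refine ⟨c, hc, hcP, fun M hM hMc => ?_⟩
    obtain ⟨N, hN, rfl⟩ := h.exists_leftQuotient_eq hu hM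
    have := hf N hN
    rw [hMc, leftQuotient_words hv] at this
    split_ifs at this
    · exact absurd this.symm hq.1
    · rw [← this, leftQuotient_words (words_permLetters_le hu)]
  -- The map `p ↦ A*` merges only `p` with `A*`. So the first non-permutation letter already merges
  -- the images of these two, that is, it sends some other quotient to `A*`.
  obtain ⟨d, hd, hdP, hde⟩ : ∃ d ∈ A, d ∉ permLetters A L ∧
      ∃ M ∈ quotients A L, M.leftQuotient [d] = words A ∧ M ≠ words A := by
    obtain ⟨u, d, v, hu, hd, hdP, hv, hf⟩ := exists_letter_of_map hF hp.2 he hp.1 hp.1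
    refine ⟨d, hd, hdP, ?_⟩
    have hu' := words_permLetters_le hu
    have hd' : [d] ∈ words A := cons_mem_words.2 ⟨hd, nil_mem_words⟩
    have key : ∀ M ∈ quotients A L, M ≠ words A →
        (M.leftQuotient u).leftQuotient [d] = words A → ∃ M ∈ quotients A L,
          M.leftQuotient [d] = words A ∧ M ≠ words A := fun M hM hMe hMd =>
      ⟨_, leftQuotient_mem_quotients hM hu', hMd, fun hh => hMe
        (injOn_of_mem_words_permLetters hu hM he (by simp only [hh, leftQuotient_words hu']))⟩
    obtain ⟨M, hM, N, hN, hne, hMN⟩ := h.exists_collision hu hd hdP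
    have hfMN : (if M = p then words A else M) = if N = p then words A else N := by
      rw [← hf M hM, ← hf N hN, hMN]
    have hee : ((words A).leftQuotient u).leftQuotient [d] = words A := by
      rw [leftQuotient_words hu', leftQuotient_words hd']
    by_cases hMe : M = words A
    · subst hMe
      exact key N hN hne.symm (by rw [← hMN, hee])
    · by_cases hNe : N = words A
      · subst hNe
        exact key M hM hne (by rw [hMN, hee])
      · split_ifs at hfMN with h1 h2 h2
        · exact absurd (h1.trans h2.symm) hne
        · exact absurd hfMN.symm hNe
        · exact absurd hfMN hMe
        · exact absurd hfMN hne
  have hcd : c ≠ d := by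
    rintro rfl
    obtain ⟨M, hM, hM1, hM2⟩ := hde
    exact hM2 (hce M hM hM1)
  have hac : a ≠ c := fun hh => hcP (hh ▸ ha)
  have had : a ≠ d := fun hh => hdP (hh ▸ ha)
  have hbc : b ≠ c := fun hh => hcP (hh ▸ hb)
  have hbd : b ≠ d := fun hh => hdP (hh ▸ hb)
  calc (4 : ℕ∞) = (({a, b, c, d} : Finset α) : Set α).encard := by
        rw [Set.encard_coe_eq_coe_finsetCard,
          Finset.card_insert_of_notMem (by simp [hab, hac, had]),
          Finset.card_insert_of_notMem (by simp [hbc, hbd]), Finset.card_pair hcd]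
        rfl
    _ ≤ A.encard := Set.encard_le_encard (by
        intro x hx
        simp only [Finset.coe_insert, Finset.coe_singleton, Set.mem_insert_iff,
          Set.mem_singleton_iff] at hx
        rcases hx with rfl | rfl | rfl | rfl
        exacts [ha.1, hb.1, hc, hd])

end IsRightIdealOfComplexity

/-! ### Upper bounds for boolean operations -/

theorem leftQuotient_apply {op : BinOp} (hop : op ≠ .product) :
    (op.apply K L).leftQuotient w = op.apply (K.leftQuotient w) (L.leftQuotient w) := by
  cases op
  · exact absurd rfl hop
  all_goals rfl

namespace IsRightIdealOfComplexity

theorem complexity_apply_le (hK : IsRightIdealOfComplexity A m K)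
    (hL : IsRightIdealOfComplexity A n L) {op : BinOp} (hop : op ≠ .product) :
    complexity A (op.apply K L) ≤ (m * n : ℕ) := by
  refine complexity_le_of_mem (F := Finset.image₂ op.apply hK.quot hL.quot) (fun w hw => ?_)
    (Finset.card_image₂_le _ _ _ |>.trans (by rw [hK.card_quot, hL.card_quot]))
  rw [leftQuotient_apply hop]
  exact Finset.mem_image₂_of_mem (hK.mem_quot.2 ⟨w, hw, rfl⟩) (hL.mem_quot.2 ⟨w, hw, rfl⟩)

/-- A word with a letter foreign to `A` empties the quotient; this is the one additional state in
the unrestricted bounds. -/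
theorem leftQuotient_mem_insert_bot (h : IsRightIdealOfComplexity A n L) (w : List α) :
    L.leftQuotient w ∈ insert ⊥ h.quot := by
  by_cases hw : w ∈ words A
  · exact Finset.mem_insert_of_mem (h.mem_quot.2 ⟨w, hw, rfl⟩)
  · rw [leftQuotient_eq_bot h.rightIdeal.1 hw]
    exact Finset.mem_insert_self _ _

theorem card_insert_bot_le (h : IsRightIdealOfComplexity A n L) :
    (insert ⊥ h.quot).card ≤ n + 1 :=
  (Finset.card_insert_le _ _).trans (by rw [h.card_quot])

theorem complexity_apply_le_succ (hK : IsRightIdealOfComplexity A m K)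
    (hL : IsRightIdealOfComplexity B n L) {op : BinOp} (hop : op ≠ .product) (C : Set α) :
    complexity C (op.apply K L) ≤ ((m + 1) * (n + 1) : ℕ) := by
  refine complexity_le_of_mem (F := Finset.image₂ op.apply (insert ⊥ hK.quot) (insert ⊥ hL.quot))
    (fun w _ => ?_) (Finset.card_image₂_le _ _ _ |>.trans
      (Nat.mul_le_mul hK.card_insert_bot_le hL.card_insert_bot_le))
  rw [leftQuotient_apply hop]
  exact Finset.mem_image₂_of_mem (hK.leftQuotient_mem_insert_bot w)
    (hL.leftQuotient_mem_insert_bot w)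

/-- The result is taken over the alphabet of the first operand, so only the second operand acquires
the empty quotient: `m * (n + 1)` pairs. -/
theorem complexity_diff_le_unrestricted (hK : IsRightIdealOfComplexity A m K)
    (hL : IsRightIdealOfComplexity B n L) :
    complexity A (BinOp.diff.apply K L) ≤ (m * n + m : ℕ) := by
  refine complexity_le_of_mem (F := Finset.image₂ BinOp.diff.apply hK.quot (insert ⊥ hL.quot))
    (fun w hw => ?_) (Finset.card_image₂_le _ _ _ |>.trans ?_)
  · rw [leftQuotient_apply (by simp)]
    exact Finset.mem_image₂_of_mem (hK.mem_quot.2 ⟨w, hw, rfl⟩) (hL.leftQuotient_mem_insert_bot w)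
  · rw [hK.card_quot, ← Nat.mul_succ]
    exact Nat.mul_le_mul_left m hL.card_insert_bot_le

theorem complexity_inter_le_unrestricted (hK : IsRightIdealOfComplexity A m K)
    (hL : IsRightIdealOfComplexity B n L) :
    complexity (A ∩ B) (BinOp.inter.apply K L) ≤ (m * n : ℕ) := by
  refine complexity_le_of_mem (F := Finset.image₂ BinOp.inter.apply hK.quot hL.quot)
    (fun w hw => ?_) (Finset.card_image₂_le _ _ _ |>.trans (by rw [hK.card_quot, hL.card_quot]))
  rw [leftQuotient_apply (by simp)]
  exact Finset.mem_image₂_of_mem (hK.mem_quot.2 ⟨w, fun x hx => (hw x hx).1, rfl⟩)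
    (hL.mem_quot.2 ⟨w, fun x hx => (hw x hx).2, rfl⟩)

/-- The `m` pairs whose second component is `A*` all give the empty language, so `m * (n - 1) + 1`
values remain. -/
theorem complexity_diff_le (hK : IsRightIdealOfComplexity A m K)
    (hL : IsRightIdealOfComplexity A n L) (hm : 2 ≤ m) (hn : 2 ≤ n) :
    complexity A (BinOp.diff.apply K L) ≤ (m * n - (m - 1) : ℕ) := by
  refine complexity_le_of_mem
    (F := insert ⊥ (Finset.image₂ BinOp.diff.apply hK.quot (hL.quot.erase (words A))))
    (fun w hw => ?_) ((Finset.card_insert_le _ _).trans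
      ((Nat.add_le_add_right (Finset.card_image₂_le _ _ _) 1).trans ?_))
  · rw [leftQuotient_apply (by simp)]
    by_cases hL' : L.leftQuotient w = words A
    · refine Finset.mem_insert.2 (.inl (Language.ext fun x => ⟨fun hx => ?_, fun hx => hx.elim⟩))
      have hx' : x ∈ K.leftQuotient w ∧ x ∉ L.leftQuotient w := hx
      exact hx'.2 (hL' ▸ leftQuotient_le hK.rightIdeal.1 hx'.1)
    · exact Finset.mem_insert_of_mem (Finset.mem_image₂_of_mem (hK.mem_quot.2 ⟨w, hw, rfl⟩)
        (Finset.mem_erase.2 ⟨hL', hL.mem_quot.2 ⟨w, hw, rfl⟩⟩))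
  · rw [hK.card_quot, hL.card_erase hn]
    obtain ⟨m, rfl⟩ := Nat.exists_eq_add_of_le hm
    obtain ⟨n, rfl⟩ := Nat.exists_eq_add_of_le hn
    have h1 : 2 + n - 1 = n + 1 := by omega
    have h2 : (2 + m) * (2 + n) = (2 + m) * (n + 1) + (2 + m) := by ring
    rw [h1, h2]
    omega

/-- The pairs with a component `A*` all give `A*`, so `(m - 1) * (n - 1) + 1` values remain. -/
theorem complexity_union_le (hK : IsRightIdealOfComplexity A m K)
    (hL : IsRightIdealOfComplexity A n L) (hm : 2 ≤ m) (hn : 2 ≤ n) :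
    complexity A (BinOp.union.apply K L) ≤ (m * n - (m + n - 2) : ℕ) := by
  refine complexity_le_of_mem (F := insert (words A) (Finset.image₂ BinOp.union.apply
      (hK.quot.erase (words A)) (hL.quot.erase (words A))))
    (fun w hw => ?_) ((Finset.card_insert_le _ _).trans
      ((Nat.add_le_add_right (Finset.card_image₂_le _ _ _) 1).trans ?_))
  · rw [leftQuotient_apply (by simp)]
    by_cases hK' : K.leftQuotient w = words A
    · rw [hK']
      exact Finset.mem_insert.2 (.inl (sup_eq_left.2 (leftQuotient_le hL.rightIdeal.1)))
    by_cases hL' : L.leftQuotient w = words A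
    · rw [hL']
      exact Finset.mem_insert.2 (.inl (sup_eq_right.2 (leftQuotient_le hK.rightIdeal.1)))
    · exact Finset.mem_insert_of_mem (Finset.mem_image₂_of_mem
        (Finset.mem_erase.2 ⟨hK', hK.mem_quot.2 ⟨w, hw, rfl⟩⟩)
        (Finset.mem_erase.2 ⟨hL', hL.mem_quot.2 ⟨w, hw, rfl⟩⟩))
  · rw [hK.card_erase hm, hL.card_erase hn]
    obtain ⟨m, rfl⟩ := Nat.exists_eq_add_of_le hm
    obtain ⟨n, rfl⟩ := Nat.exists_eq_add_of_le hn
    have h1 : 2 + n - 1 = n + 1 := by omega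
    have h3 : 2 + m - 1 = m + 1 := by omega
    have h2 : (2 + m) * (2 + n) = (m + 1) * (n + 1) + (m + n + 3) := by ring
    rw [h1, h2, h3]
    omega

end IsRightIdealOfComplexity

/-! ### Upper bounds for products -/

/-- The union of the members of a finite set of languages. -/
def unionOf (T : Finset (Language α)) : Language α := {x | ∃ M ∈ T, x ∈ M}

/-- The contribution to the quotient of `KL` by `w` of the factorizations of words in which the
factor in `K` is a prefix of `w`. -/
def suffixPart (K L : Language α) (w : List α) : Language α :=
  {x | ∃ u v, w = u ++ v ∧ u ∈ K ∧ v ++ x ∈ L}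

/-- The cut in a factorization of `wx` falls either inside `x` or inside `w`. -/
theorem leftQuotient_mul :
    (K * L).leftQuotient w = K.leftQuotient w * L ⊔ suffixPart K L w := by
  refine Language.ext fun x => ?_
  change w ++ x ∈ K * L ↔ x ∈ K.leftQuotient w * L ∨ x ∈ suffixPart K L w
  rw [Language.mem_mul, Language.mem_mul]
  constructor
  · rintro ⟨u, hu, v, hv, huv⟩
    rcases List.append_eq_append_iff.1 huv with ⟨t, rfl, rfl⟩ | ⟨t, rfl, rfl⟩
    · exact .inr ⟨u, t, rfl, hu, hv⟩
    · exact .inl ⟨t, hu, v, hv, rfl⟩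
  · rintro (⟨u, hu, v, hv, rfl⟩ | ⟨u, v, rfl, hu, hv⟩)
    · exact ⟨w ++ u, hu, v, hv, by simp⟩
    · exact ⟨u, hu, v ++ x, hv, by simp⟩

/-- If `w` is not in the right ideal `K`, then no prefix of `w` is, so `suffixPart` contributes
nothing. -/
theorem IsRightIdeal.leftQuotient_mul_of_notMem (h : IsRightIdeal A K) (hw : w ∈ words A)
    (hwK : w ∉ K) : (K * L).leftQuotient w = K.leftQuotient w * L := by
  rw [leftQuotient_mul, sup_eq_left]
  rintro x ⟨u, v, rfl, hu, -⟩
  exact absurd (h.append_mem hu (append_mem_words.1 hw).2) hwK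

namespace IsRightIdealOfComplexity

variable (hK : IsRightIdealOfComplexity A m K) (hL : IsRightIdealOfComplexity B n L)
include hL

theorem suffixPart_of_mem (hw : w ∈ K * L) : suffixPart K L w = words B := by
  refine Language.ext fun x => ⟨?_, fun hx => ?_⟩
  · rintro ⟨u, v, -, -, hv⟩
    exact (append_mem_words.1 (hL.rightIdeal.1 hv)).2
  · obtain ⟨u, hu, v, hv, rfl⟩ := Language.mem_mul.1 hw
    exact ⟨u, v, rfl, hu, hL.rightIdeal.append_mem hv hx⟩

/-- The contributions are the quotients of `L` by the suffixes left after a prefix in `K`. None of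
them is `B*`, since that would put `w` in `KL`. -/
theorem suffixPart_of_notMem (hw : w ∉ K * L) :
    ∃ T ⊆ hL.quot.erase (words B), suffixPart K L w = unionOf T := by
  refine ⟨(hL.quot.erase (words B)).filter fun M => ∃ u v, w = u ++ v ∧ u ∈ K ∧
    M = L.leftQuotient v, Finset.filter_subset _ _, Language.ext fun x => ?_⟩
  constructor
  · rintro ⟨u, v, rfl, hu, hv⟩
    refine ⟨L.leftQuotient v, Finset.mem_filter.2 ⟨Finset.mem_erase.2 ⟨fun hh => hw ?_,
      hL.mem_quot.2 ⟨v, (append_mem_words.1 (hL.rightIdeal.1 hv)).1, rfl⟩⟩, u, v, rfl, hu, rfl⟩, hv⟩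
    exact Language.append_mem_mul hu (hL.rightIdeal.leftQuotient_eq_words_iff.1 hh)
  · rintro ⟨M, hM, hx⟩
    obtain ⟨u, v, rfl, hu, rfl⟩ := (Finset.mem_filter.1 hM).2
    exact ⟨u, v, rfl, hu, hx⟩

include hK

/-- The possible quotients of `KL` by words over the alphabet of `K`. -/
noncomputable def productQuotients : Finset (Language α) :=
  (hK.quot.erase (words A)).image (· * L) ∪
    (((hL.quot.erase (words B)).erase L).powerset.image (fun T => words A * L ⊔ unionOf T) ∪
      {words A * L ⊔ words B})

theorem card_productQuotients_le (hm : 2 ≤ m) (hn : 2 ≤ n) :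
    (productQuotients hK hL).card ≤ m + 2 ^ (n - 2) := by
  have hc : ((hL.quot.erase (words B)).erase L).card = n - 2 := by
    rw [Finset.card_erase_of_mem (Finset.mem_erase.2
      ⟨hL.ne_words hn, hL.mem_quot.2 mem_quotients_self⟩), hL.card_erase hn]
    omega
  have h1 := Finset.card_union_le ((hK.quot.erase (words A)).image (· * L))
    (((hL.quot.erase (words B)).erase L).powerset.image (fun T => words A * L ⊔ unionOf T) ∪
      {words A * L ⊔ words B})
  have h2 := Finset.card_union_le (((hL.quot.erase (words B)).erase L).powerset.image
    (fun T => words A * L ⊔ unionOf T)) {words A * L ⊔ words B}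
  have h3 : ((hK.quot.erase (words A)).image (· * L)).card ≤ m - 1 :=
    Finset.card_image_le.trans (hK.card_erase hm).le
  have h4 : (((hL.quot.erase (words B)).erase L).powerset.image
      (fun T => words A * L ⊔ unionOf T)).card ≤ 2 ^ (n - 2) :=
    Finset.card_image_le.trans (by rw [Finset.card_powerset, hc])
  rw [Finset.card_singleton] at h2
  unfold productQuotients
  omega

theorem leftQuotient_mul_mem (hw : w ∈ words A) :
    (K * L).leftQuotient w ∈ productQuotients hK hL := by
  rw [productQuotients, Finset.mem_union, Finset.mem_union]
  by_cases hwK : w ∈ K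
  · right
    rw [leftQuotient_mul, hK.rightIdeal.leftQuotient_of_mem hwK]
    by_cases hw' : w ∈ K * L
    · right
      rw [suffixPart_of_mem hL hw', Finset.mem_singleton]
    · left
      obtain ⟨T, hT, hT'⟩ := suffixPart_of_notMem hL hw'
      -- Since `L ⊆ A*L`, membership of `L` in `T` is irrelevant; this halves the number of subsets
      -- to `2 ^ (n - 2)`.
      refine Finset.mem_image.2 ⟨T.erase L, Finset.mem_powerset.2 (Finset.erase_subset_erase _ hT),
        Language.ext fun x => ?_⟩
      rw [hT']
      change x ∈ words A * L ∨ (∃ M ∈ T.erase L, x ∈ M) ↔ x ∈ words A * L ∨ ∃ M ∈ T, x ∈ M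
      refine or_congr_right' fun hx => exists_congr fun M => ?_
      rw [Finset.mem_erase]
      have : x ∈ M → M ≠ L := by
        rintro hxM rfl
        exact hx (Language.append_mem_mul nil_mem_words hxM)
      tauto
  · left
    rw [hK.rightIdeal.leftQuotient_mul_of_notMem hw hwK]
    exact Finset.mem_image_of_mem _ (Finset.mem_erase.2
      ⟨fun hh => hwK (hK.rightIdeal.leftQuotient_eq_words_iff.1 hh), hK.mem_quot.2 ⟨w, hw, rfl⟩⟩)

/-- After a letter outside `A` the factor from `K` must be finished, so `A*L` disappears and a bare
union of quotients of `L` remains: `2 ^ (n - 1)` unions of quotients other than `B*`, and `B*`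
itself. -/
theorem complexity_mul_le_unrestricted (hm : 2 ≤ m) (hn : 2 ≤ n) (C : Set α) :
    complexity C (BinOp.product.apply K L) ≤ (m + 2 ^ (n - 1) + 2 ^ (n - 2) + 1 : ℕ) := by
  refine complexity_le_of_mem (F := productQuotients hK hL ∪
    ((hL.quot.erase (words B)).powerset.image unionOf ∪ {words B})) (fun w _ => ?_) ?_
  · by_cases hwA : w ∈ words A
    · exact Finset.mem_union_left _ (leftQuotient_mul_mem hK hL hwA)
    · refine Finset.mem_union_right _ ?_
      have : (BinOp.product.apply K L).leftQuotient w = suffixPart K L w := by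
        change (K * L).leftQuotient w = _
        rw [leftQuotient_mul, leftQuotient_eq_bot hK.rightIdeal.1 hwA, sup_eq_right]
        intro x hx
        obtain ⟨u, hu, -⟩ := Language.mem_mul.1 hx
        exact hu.elim
      rw [this, Finset.mem_union]
      by_cases hw' : w ∈ K * L
      · right
        rw [suffixPart_of_mem hL hw', Finset.mem_singleton]
      · left
        obtain ⟨T, hT, hT'⟩ := suffixPart_of_notMem hL hw'
        exact Finset.mem_image.2 ⟨T, Finset.mem_powerset.2 hT, hT'.symm⟩
  · have h1 := Finset.card_union_le (productQuotients hK hL)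
      ((hL.quot.erase (words B)).powerset.image unionOf ∪ {words B})
    have h2 := Finset.card_union_le ((hL.quot.erase (words B)).powerset.image unionOf) {words B}
    have h3 := card_productQuotients_le hK hL hm hn
    have h4 : ((hL.quot.erase (words B)).powerset.image unionOf).card ≤ 2 ^ (n - 1) :=
      Finset.card_image_le.trans (by rw [Finset.card_powerset, hL.card_erase hn])
    rw [Finset.card_singleton] at h2
    omega

theorem complexity_mul_le (hm : 2 ≤ m) (hn : 2 ≤ n) :
    complexity A (BinOp.product.apply K L) ≤ (m + 2 ^ (n - 2) : ℕ) :=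
  complexity_le_of_mem (fun _ hw => leftQuotient_mul_mem hK hL hw)
    (card_productQuotients_le hK hL hm hn)

end IsRightIdealOfComplexity

end General

/-! ### Dialects of the witnesses under injective partial maps -/

section Dialect

variable {π : Letter → Option Letter} {n q : ℕ} {x y : Letter} {v w : List Letter}

/-- A partial map of letters that is injective where it is defined. -/
def IsPartialInj (π : Letter → Option Letter) : Prop :=
  ∀ x y z, π x = some z → π y = some z → x = y

open Classical in
/-- The action on states of a letter of the dialect given by `π`. -/
noncomputable def letterStep (π : Letter → Option Letter) (n q : ℕ) (y : Letter) : ℕ :=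
  if h : ∃ x, π x = some y then transformation n h.choose q else q

/-- Injectivity of `π` makes the chosen preimage the only one. -/
theorem letterStep_eq (hπ : IsPartialInj π) (hx : π x = some y) :
    letterStep π n q y = transformation n x q := by
  have h : ∃ x, π x = some y := ⟨x, hx⟩
  rw [letterStep, dif_pos h, hπ _ _ _ h.choose_spec hx]

/-- The action on states of a word of the dialect given by `π`. -/
noncomputable def run (π : Letter → Option Letter) (n q : ℕ) (w : List Letter) : ℕ :=
  w.foldl (letterStep π n) q

@[simp]
theorem run_nil : run π n q [] = q := rfl

@[simp]
theorem run_cons : run π n q (x :: w) = run π n (letterStep π n q x) w := rfl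

@[simp]
theorem run_append : run π n q (v ++ w) = run π n (run π n q v) w := List.foldl_append

theorem letterStep_lt (hn : 4 ≤ n) (hq : q < n) (y : Letter) : letterStep π n q y < n := by
  unfold letterStep
  split_ifs with h
  · exact transformation_lt hn _ hq
  · exact hq

theorem run_lt (hn : 4 ≤ n) (hq : q < n) (w : List Letter) : run π n q w < n := by
  induction w generalizing q with
  | nil => exact hq
  | cons x w ih => exact ih (letterStep_lt hn hq x)

theorem transformation_last (hn : 4 ≤ n) (x : Letter) : transformation n x (n - 1) = n - 1 := by
  cases x <;> simp only [transformation] <;> split_ifs <;> omega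

theorem run_last (hn : 4 ≤ n) (w : List Letter) : run π n (n - 1) w = n - 1 := by
  induction w with
  | nil => rfl
  | cons x w ih =>
    have : letterStep π n (n - 1) x = n - 1 := by
      unfold letterStep
      split_ifs
      · exact transformation_last hn _
      · rfl
    rw [run_cons, this, ih]

/-- The image of `d` counts upwards and saturates at `n - 1`. This letter alone reaches and
separates all states, so every injective dialect that keeps `d` has complexity `n`. -/
theorem run_replicate (hπ : IsPartialInj π) (hd : π .d = some y) (hn : 4 ≤ n) (hq : q < n)
    (k : ℕ) : run π n q (List.replicate k y) = min (q + k) (n - 1) := by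
  induction k generalizing q with
  | zero => simp; omega
  | succ k ih =>
    rw [List.replicate_succ, run_cons, ih (letterStep_lt hn hq y), letterStep_eq hπ hd]
    simp only [transformation]
    split_ifs <;> omega

/-- The language of the state `q` of the DFA for the dialect given by `π`. -/
def stateLang (π : Letter → Option Letter) (n q : ℕ) : Language Letter :=
  {v | v ∈ words (dialectAlphabet π) ∧ run π n q v = n - 1}

theorem mem_stateLang :
    v ∈ stateLang π n q ↔ v ∈ words (dialectAlphabet π) ∧ run π n q v = n - 1 := Iff.rfl

theorem evalFrom_val (hπ : IsPartialInj π) (hn : 4 ≤ n) (q : Fin n)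
    (h : w.map π = v.map some) : ((witnessDFA n hn).evalFrom q w : ℕ) = run π n q v := by
  induction w generalizing v q with
  | nil =>
    obtain rfl : v = [] := by simpa using h.symm
    rfl
  | cons x w ih =>
    cases v with
    | nil => simp at h
    | cons y v =>
      simp only [List.map_cons, List.cons.injEq] at h
      rw [DFA.evalFrom_cons, ih _ h.2, run_cons, letterStep_eq hπ h.1]
      rfl

theorem exists_map_eq (hv : v ∈ words (dialectAlphabet π)) :
    ∃ w : List Letter, w.map π = v.map some := by
  induction v with
  | nil => exact ⟨[], rfl⟩
  | cons y v ih =>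
    obtain ⟨⟨x, hx⟩, hv⟩ := cons_mem_words.1 hv
    obtain ⟨w, hw⟩ := ih hv
    exact ⟨x :: w, by simp [hx, hw]⟩

theorem mem_words_of_map_eq (h : w.map π = v.map some) : v ∈ words (dialectAlphabet π) := by
  intro y hy
  have : some y ∈ w.map π := h ▸ List.mem_map_of_mem hy
  obtain ⟨x, -, hx⟩ := List.mem_map.1 this
  exact ⟨x, hx⟩

theorem dialect_witness (hπ : IsPartialInj π) (hn : 4 ≤ n) :
    dialect π (witness n hn) = stateLang π n 0 := by
  refine Language.ext fun v => ?_
  rw [mem_stateLang]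
  constructor
  · rintro ⟨w, hw, hwv⟩
    exact ⟨mem_words_of_map_eq hwv, (evalFrom_val hπ hn _ hwv).symm.trans hw⟩
  · rintro ⟨hv, hrun⟩
    obtain ⟨w, hwv⟩ := exists_map_eq hv
    exact ⟨w, (evalFrom_val hπ hn ⟨0, by omega⟩ hwv).trans hrun, hwv⟩

theorem stateLang_le : stateLang π n q ≤ words (dialectAlphabet π) := fun _ h => h.1

theorem leftQuotient_stateLang (hw : w ∈ words (dialectAlphabet π)) :
    (stateLang π n q).leftQuotient w = stateLang π n (run π n q w) :=
  Language.ext fun x => by simp [mem_stateLang, hw]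

theorem stateLang_last (hn : 4 ≤ n) : stateLang π n (n - 1) = words (dialectAlphabet π) :=
  Language.ext fun x => by simp [mem_stateLang, run_last hn]

theorem isRightIdeal_stateLang (hn : 4 ≤ n) :
    IsRightIdeal (dialectAlphabet π) (stateLang π n q) := by
  refine ⟨stateLang_le, Language.ext fun x => ?_⟩
  rw [Language.mem_mul]
  constructor
  · exact fun hx => ⟨x, hx, [], nil_mem_words, by simp⟩
  · rintro ⟨u, hu, v, hv, rfl⟩
    exact ⟨append_mem_words.2 ⟨hu.1, hv⟩, by rw [run_append, hu.2, run_last hn]⟩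

theorem exists_separating_power (hπ : IsPartialInj π) (hd : π .d = some y) (hn : 4 ≤ n)
    {q q' : ℕ} (hq : q < n) (hq' : q' < n) (hne : q ≠ q') :
    ∃ k, ¬ (run π n q (List.replicate k y) = n - 1 ↔ run π n q' (List.replicate k y) = n - 1) := by
  -- This power brings the larger state exactly to `n - 1` and leaves the smaller one short of it.
  refine ⟨n - 1 - max q q', ?_⟩
  rw [run_replicate hπ hd hn hq, run_replicate hπ hd hn hq']
  omega

theorem stateLang_injOn (hπ : IsPartialInj π) (hd : π .d = some y) (hn : 4 ≤ n) :
    Set.InjOn (stateLang π n) (Finset.range n) := by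
  intro q hq q' hq' hqq'
  by_contra hne
  obtain ⟨k, hk⟩ := exists_separating_power hπ hd hn (by simpa using hq) (by simpa using hq') hne
  have hw : List.replicate k y ∈ words (dialectAlphabet π) :=
    replicate_mem_words (show y ∈ dialectAlphabet π from ⟨_, hd⟩) k
  have h1 : List.replicate k y ∈ stateLang π n q ↔ List.replicate k y ∈ stateLang π n q' := by
    rw [hqq']
  simp only [mem_stateLang, hw, true_and] at h1
  exact hk h1

theorem isRightIdealOfComplexity_stateLang (hπ : IsPartialInj π) (hd : π .d = some y)
    (hn : 4 ≤ n) : IsRightIdealOfComplexity (dialectAlphabet π) n (stateLang π n 0) where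
  finite := by
    refine Set.Finite.subset (s := {.a, .b, .c, .d}) (Set.toFinite _) fun x _ => ?_
    cases x <;> simp
  nonempty := ⟨y, .d, hd⟩
  rightIdeal := isRightIdeal_stateLang hn
  complexity_eq := by
    classical
    refine le_antisymm (complexity_le_of_mem (F := (Finset.range n).image (stateLang π n))
      (fun w hw => ?_) (Finset.card_image_le.trans (Finset.card_range n).le)) ?_
    · rw [leftQuotient_stateLang hw]
      exact Finset.mem_image_of_mem _ (Finset.mem_range.2 (run_lt hn (by omega) w))
    · have := card_le_complexity (A := dialectAlphabet π) (L := stateLang π n 0)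
        (fun q hq => ?_) (stateLang_injOn hπ hd hn)
      · rwa [Finset.card_range] at this
      · have hw := replicate_mem_words (show y ∈ dialectAlphabet π from ⟨_, hd⟩) q
        refine ⟨_, hw, ?_⟩
        have hq' := Finset.mem_range.1 hq
        rw [leftQuotient_stateLang hw, run_replicate hπ hd hn (by omega)]
        congr 1
        omega

theorem isRightIdealOfComplexity_dialect (hπ : IsPartialInj π) (hd : π .d = some y)
    (hn : 4 ≤ n) : IsRightIdealOfComplexity (dialectAlphabet π) n (dialect π (witness n hn)) := by
  rw [dialect_witness hπ hn]
  exact isRightIdealOfComplexity_stateLang hπ hd hn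

theorem isPartialInj_some : IsPartialInj some := fun _ _ _ hx hy =>
  Option.some_injective _ (hx.trans hy.symm)

theorem dialectAlphabet_some : dialectAlphabet (some : Letter → Option Letter) = Set.univ :=
  Set.eq_univ_of_forall fun x => ⟨x, rfl⟩

theorem acceptsFrom_witnessDFA (hn : 4 ≤ n) (q : Fin n) :
    (witnessDFA n hn).acceptsFrom q = stateLang some n q := by
  refine Language.ext fun w => ?_
  rw [mem_stateLang, dialectAlphabet_some]
  change ((witnessDFA n hn).evalFrom q w : ℕ) = n - 1 ↔ _
  rw [evalFrom_val isPartialInj_some hn q rfl]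
  simp [mem_words]

theorem isRightIdealOfComplexity_witness (hn : 4 ≤ n) :
    IsRightIdealOfComplexity Set.univ n (witness n hn) := by
  have := isRightIdealOfComplexity_stateLang isPartialInj_some (y := .d) rfl hn
  rwa [dialectAlphabet_some, ← acceptsFrom_witnessDFA hn ⟨0, by omega⟩] at this

theorem acceptsFrom_witnessDFA_injective (hn : 4 ≤ n) :
    Function.Injective (witnessDFA n hn).acceptsFrom := fun p q hpq => by
  rw [acceptsFrom_witnessDFA, acceptsFrom_witnessDFA] at hpq
  exact Fin.ext (stateLang_injOn isPartialInj_some (y := .d) rfl hn (by simp) (by simp) hpq)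

theorem isMinimalDFA_witnessDFA (hn : 4 ≤ n) : IsMinimalDFA (witnessDFA n hn) := by
  refine ⟨fun q => ⟨List.replicate q .d, Fin.ext ?_⟩, fun p q h =>
    acceptsFrom_witnessDFA_injective hn h⟩
  rw [evalFrom_val isPartialInj_some hn _ rfl, run_replicate isPartialInj_some rfl hn (by simp)]
  simp [witnessDFA]
  omega

theorem leftQuotient_acceptsFrom {α σ : Type*} (M : DFA α σ) (s : σ) (w : List α) :
    (M.acceptsFrom s).leftQuotient w = M.acceptsFrom (M.evalFrom s w) :=
  Language.ext fun x => by
    rw [Language.mem_leftQuotient, DFA.mem_acceptsFrom, DFA.mem_acceptsFrom, DFA.evalFrom_of_append]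

end Dialect

/-! ### The transition semigroup of the witness -/

section Transitions

variable {n : ℕ} {hn : 4 ≤ n}

/-- The transformation `f` of the states of the witness is induced by a word. -/
def IsInduced (hn : 4 ≤ n) (f : Fin n → Fin n) : Prop :=
  ∃ w, ∀ q, (witnessDFA n hn).evalFrom q w = f q

theorem isInduced_id : IsInduced hn id := ⟨[], fun _ => rfl⟩

theorem IsInduced.comp {f g : Fin n → Fin n} (hg : IsInduced hn g) (hf : IsInduced hn f) :
    IsInduced hn (g ∘ f) := by
  obtain ⟨v, hv⟩ := hf
  obtain ⟨w, hw⟩ := hg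
  exact ⟨v ++ w, fun q => by rw [DFA.evalFrom_of_append, hv, hw, Function.comp_apply]⟩

theorem isInduced_step (x : Letter) : IsInduced hn ((witnessDFA n hn).step · x) :=
  ⟨[x], fun _ => rfl⟩

theorem IsInduced.mul {σ τ : Equiv.Perm (Fin n)} (hσ : IsInduced hn σ) (hτ : IsInduced hn τ) :
    IsInduced hn (σ * τ : Equiv.Perm (Fin n)) := by
  rw [Equiv.Perm.coe_mul]
  exact hσ.comp hτ

/-- A permutation of a finite set has finite order, so its inverse is one of its natural powers. -/
theorem IsInduced.inv {σ : Equiv.Perm (Fin n)} (hσ : IsInduced hn σ) :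
    IsInduced hn (σ⁻¹ : Equiv.Perm (Fin n)) := by
  have hpow : ∀ k : ℕ, IsInduced hn (σ ^ k : Equiv.Perm (Fin n)) := by
    intro k
    induction k with
    | zero => exact isInduced_id
    | succ k ih =>
      rw [pow_succ]
      exact ih.mul hσ
  have : σ⁻¹ = σ ^ (orderOf σ - 1) := by
    rw [inv_eq_iff_mul_eq_one, ← pow_succ', Nat.sub_add_cancel (orderOf_pos σ), pow_orderOf_eq_one]
  rw [this]
  exact hpow _

theorem IsInduced.conj_swap {σ : Equiv.Perm (Fin n)} (hσ : IsInduced hn σ) {i j : Fin n}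
    (h : IsInduced hn (Equiv.swap i j)) : IsInduced hn (Equiv.swap (σ i) (σ j)) := by
  rw [Equiv.swap_apply_apply]
  exact (hσ.mul h).mul hσ.inv

theorem IsInduced.conj_update {σ : Equiv.Perm (Fin n)} (hσ : IsInduced hn σ) {i j : Fin n}
    (h : IsInduced hn (Function.update id i j)) :
    IsInduced hn (Function.update id (σ i) (σ j)) := by
  convert (hσ.comp h).comp hσ.inv using 1
  funext q
  simp only [Function.comp_apply, Function.update_apply, id, Equiv.Perm.inv_eq_iff_eq]
  split_ifs <;> simp

/-- The cyclic permutation induced by `a`. -/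
noncomputable def cyclePerm (hn : 4 ≤ n) : Equiv.Perm (Fin n) :=
  Equiv.ofBijective ((witnessDFA n hn).step · .a) <| Finite.injective_iff_bijective.1 <| by
    rintro ⟨p, hp⟩ ⟨q, hq⟩ h
    simp only [witnessDFA, transformation, Fin.mk.injEq] at h ⊢
    split_ifs at h <;> omega

theorem cyclePerm_apply (q : Fin n) : cyclePerm hn q = (witnessDFA n hn).step q .a := rfl

theorem isInduced_cyclePerm : IsInduced hn (cyclePerm hn) := isInduced_step .a

/-- The transposition `b = (0, 1)` is moved along by conjugation with the cycle `a`. -/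
theorem isInduced_swap_succ (k : ℕ) (hk : k + 1 < n - 1) :
    IsInduced hn (Equiv.swap (⟨k, by omega⟩ : Fin n) ⟨k + 1, by omega⟩) := by
  induction k with
  | zero =>
    convert isInduced_step (hn := hn) .b using 1
    funext ⟨q, hq⟩
    simp only [Equiv.swap_apply_def, witnessDFA, transformation, Fin.ext_iff]
    split_ifs <;> simp_all
  | succ k ih =>
    convert isInduced_cyclePerm.conj_swap (ih (by omega)) using 3 <;>
    · refine Fin.ext ?_
      simp only [cyclePerm_apply, witnessDFA, transformation]
      split_ifs <;> omega

theorem isInduced_swap_of_lt (i j : ℕ) (hij : i < j) (hj : j < n - 1) :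
    IsInduced hn (Equiv.swap (⟨i, by omega⟩ : Fin n) ⟨j, by omega⟩) := by
  induction j with
  | zero => omega
  | succ j ih =>
    rcases eq_or_ne i j with rfl | hne
    · exact isInduced_swap_succ i hj
    · have := (isInduced_swap_succ (hn := hn) j hj).conj_swap (ih (by omega) (by omega))
      rwa [Equiv.swap_apply_left, Equiv.swap_apply_of_ne_of_ne] at this
      · simpa [Fin.ext_iff] using hne
      · simp only [ne_eq, Fin.ext_iff]
        omega

theorem isInduced_swap {i j : Fin n} (hi : (i : ℕ) ≠ n - 1) (hj : (j : ℕ) ≠ n - 1) :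
    IsInduced hn (Equiv.swap i j) := by
  rcases lt_trichotomy i j with h | rfl | h
  · exact isInduced_swap_of_lt i j h (by omega)
  · rw [Equiv.swap_self]
    exact isInduced_id
  · rw [Equiv.swap_comm]
    exact isInduced_swap_of_lt j i h (by omega)

/-- Induction on the size of the support: multiplying by `swap x (σ x)` fixes one more point and
involves only states other than the last. -/
theorem isInduced_perm {l : Fin n} (hl : (l : ℕ) = n - 1) (σ : Equiv.Perm (Fin n))
    (hσ : σ l = l) : IsInduced hn σ := by
  induction hk : σ.support.card using Nat.strong_induction_on generalizing σ with
  | _ k ih =>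
    by_cases h1 : ∃ x, σ x ≠ x
    · obtain ⟨x, hx⟩ := h1
      have hxl : x ≠ l := fun h => hx (h ▸ hσ)
      have hxl' : σ x ≠ l := fun h => hxl (σ.injective (h.trans hσ.symm))
      have hτ := ih _ (hk ▸ Equiv.Perm.card_support_swap_mul hx) (Equiv.swap x (σ x) * σ)
        (by rw [Equiv.Perm.mul_apply, hσ, Equiv.swap_apply_of_ne_of_ne hxl.symm hxl'.symm]) rfl
      have := (isInduced_swap (hn := hn) (i := x) (j := σ x)
        (fun h => hxl (Fin.ext (h.trans hl.symm)))
        (fun h => hxl' (Fin.ext (h.trans hl.symm)))).mul hτ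
      rwa [← mul_assoc, Equiv.swap_mul_self, one_mul] at this
    · push Not at h1
      convert isInduced_id (hn := hn) using 1
      exact funext h1

/-- Up to conjugation there are two cases. The letter `c` is the map `1 ↦ 0`, with a target that is
not final; `d` followed by the inverse of `a` moves only `n - 2`, to the final state. -/
theorem isInduced_update {i j : Fin n} (hi : (i : ℕ) ≠ n - 1) (hij : i ≠ j) :
    IsInduced hn (Function.update id i j) := by
  have hi' := i.2
  have hj' := j.2
  by_cases hj : (j : ℕ) = n - 1
  · have h0 : IsInduced hn (Function.update id ⟨n - 2, by omega⟩ j) := by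
      convert isInduced_cyclePerm.inv.comp (isInduced_step (hn := hn) .d) using 1
      funext q
      rw [Function.comp_apply, Equiv.Perm.eq_inv_iff_eq]
      have hq := q.2
      simp only [cyclePerm_apply, witnessDFA, transformation, Fin.ext_iff, Function.update_apply,
        id, apply_ite Fin.val, hj]
      split_ifs <;> omega
    have := (isInduced_swap (hn := hn) (i := ⟨n - 2, by omega⟩) (j := i)
      (by simp only; omega) hi).conj_update h0
    rwa [Equiv.swap_apply_left, Equiv.swap_apply_of_ne_of_ne _ hij.symm] at this
    simp only [ne_eq, Fin.ext_iff]
    omega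
  · have h0 : IsInduced hn (Function.update id ⟨1, by omega⟩ ⟨0, by omega⟩) := by
      convert isInduced_step (hn := hn) .c using 1
      funext q
      simp only [witnessDFA, transformation, Fin.ext_iff, Function.update_apply, id]
      split_ifs <;> rfl
    -- Two conjugations are needed: the first carries the source 1 to `i`, the second carries the
    -- image of 0 to `j`.
    set τ := Equiv.swap (⟨1, by omega⟩ : Fin n) i with hτ
    have h1 := (isInduced_swap (hn := hn) (i := ⟨1, by omega⟩) (j := i)
      (by simp only; omega) hi).conj_update h0
    rw [Equiv.swap_apply_left] at h1
    have hz : (τ ⟨0, by omega⟩ : ℕ) ≠ n - 1 := by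
      rw [hτ, Equiv.swap_apply_def]
      split_ifs <;> first | omega | (simp only; omega)
    have hz' : i ≠ τ ⟨0, by omega⟩ := by
      intro h
      have h1 : τ ⟨1, by omega⟩ = i := Equiv.swap_apply_left _ _
      exact absurd (congrArg Fin.val (τ.injective (h1.trans h))) one_ne_zero
    have := (isInduced_swap (hn := hn) hz hj).conj_update h1
    rwa [Equiv.swap_apply_left, Equiv.swap_apply_of_ne_of_ne hz' hij] at this

/-- Induction on the corank. If `f i = f j` and `c` is not a value of `f`, then `f` is the map `i ↦
j` followed by `f` changed at `i` to the value `c`, and the latter has larger image. -/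
theorem isInduced_of_last {l : Fin n} (hl : (l : ℕ) = n - 1) (f : Fin n → Fin n)
    (hf : f l = l) : IsInduced hn f := by
  induction hk : n - (Finset.univ.image f).card using Nat.strong_induction_on generalizing f with
  | _ k ih =>
    by_cases hinj : Function.Injective f
    · exact isInduced_perm hl (Equiv.ofBijective f (Finite.injective_iff_bijective.1 hinj)) hf
    · obtain ⟨i, j, hij, hne, hil⟩ : ∃ i j, f i = f j ∧ i ≠ j ∧ i ≠ l := by
        simp only [Function.Injective] at hinj
        push Not at hinj
        obtain ⟨i, j, hij, hne⟩ := hinj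
        by_cases hil : i = l
        · exact ⟨j, i, hij.symm, hne.symm, fun h => hne (hil.trans h.symm)⟩
        · exact ⟨i, j, hij, hne, hil⟩
      obtain ⟨c, hc⟩ : ∃ c, ∀ q, f q ≠ c := by
        have : ¬ Function.Surjective f := fun h => hinj (Finite.injective_iff_surjective.2 h)
        simpa [Function.Surjective] using this
      have hfg : f = Function.update f i c ∘ Function.update id i j := by
        funext q
        by_cases hq : q = i
        · subst hq
          simp [hne.symm, hij]
        · simp [hq]
      have hsub : insert c (Finset.univ.image f) ⊆ Finset.univ.image (Function.update f i c) := by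
        intro p hp
        rw [Finset.mem_insert, Finset.mem_image] at hp
        rw [Finset.mem_image]
        rcases hp with rfl | ⟨q, -, rfl⟩
        · exact ⟨i, Finset.mem_univ _, by simp⟩
        · by_cases hq : q = i
          · exact ⟨j, Finset.mem_univ _, by simp [hne.symm, hq, hij]⟩
          · exact ⟨q, Finset.mem_univ _, by simp [hq]⟩
      have hcard := Finset.card_le_card hsub
      rw [Finset.card_insert_of_notMem (by simpa using hc)] at hcard
      have hle := Finset.card_le_univ (Finset.univ.image (Function.update f i c))
      rw [Fintype.card_fin] at hle
      rw [hfg]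
      refine (ih _ (by omega) (Function.update f i c) ?_ rfl).comp (isInduced_update ?_ hne)
      · rw [Function.update_of_ne hil.symm, hf]
      · exact fun h => hil (Fin.ext (h.trans hl.symm))

theorem isFull_witness (hn : 4 ≤ n) : IsFull Set.univ (witness n hn) := by
  have hquot : ∀ q, (witnessDFA n hn).acceptsFrom q ∈ quotients Set.univ (witness n hn) := by
    intro q
    obtain ⟨w, hw⟩ := (isMinimalDFA_witnessDFA hn).1 q
    exact ⟨w, by simp [mem_words], by rw [witness, DFA.accepts, leftQuotient_acceptsFrom, hw]⟩
  have hquot' : ∀ M ∈ quotients Set.univ (witness n hn),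
      ∃ q, M = (witnessDFA n hn).acceptsFrom q := by
    rintro _ ⟨w, -, rfl⟩
    exact ⟨_, by rw [witness, DFA.accepts, leftQuotient_acceptsFrom]⟩
  intro f hf hfe
  choose! g hg using fun q => hquot' _ (hf _ (hquot q))
  have hlast : (witnessDFA n hn).acceptsFrom ⟨n - 1, by omega⟩ = words Set.univ := by
    rw [acceptsFrom_witnessDFA, stateLang_last hn, dialectAlphabet_some]
  obtain ⟨w, hw⟩ := isInduced_of_last (hn := hn) (l := ⟨n - 1, by omega⟩) rfl g
    (acceptsFrom_witnessDFA_injective hn (by rw [← hg, hlast, hfe]))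
  -- The word `bb` acts as the identity and makes the word nonempty.
  refine ⟨w ++ [.b, .b], by simp [mem_words], by simp, fun M hM => ?_⟩
  obtain ⟨q, rfl⟩ := hquot' M hM
  rw [leftQuotient_acceptsFrom, DFA.evalFrom_of_append, hw, hg]
  congr 1
  refine Fin.ext ?_
  simp only [DFA.evalFrom_cons, DFA.evalFrom_nil, witnessDFA, transformation]
  by_cases h0 : (g q : ℕ) = 0
  · simp [h0]
  · by_cases h1 : (g q : ℕ) = 1 <;> simp [h0, h1]

/-- The star contains the empty word but not the word `d`, so it is not a quotient of `L`. By
fullness every quotient of `L`, including `L` itself, is reached by a nonempty word, where the star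
and `L` have the same quotients. -/
theorem complexity_kstar_witness (hn : 4 ≤ n) :
    complexity Set.univ (KStar.kstar (witness n hn)) = (n + 1 : ℕ) := by
  classical
  have h := isRightIdealOfComplexity_witness hn
  have hd : [Letter.d] ∉ witness n hn := by
    change ¬ (transformation n .d 0 = n - 1)
    simp only [transformation]
    split_ifs <;> omega
  refine le_antisymm h.complexity_kstar_le ?_
  have hnot : KStar.kstar (witness n hn) ∉ h.quot := fun hmem => by
    have := (h.rightIdeal.eq_words_iff (h.mem_quot.1 hmem)).2 (h.mem_kstar.2 (.inl rfl))
    have hd' : [Letter.d] ∈ KStar.kstar (witness n hn) := this ▸ (by simp [mem_words])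
    exact (h.mem_kstar.1 hd').elim (by simp) hd
  have := card_le_complexity (A := Set.univ) (L := KStar.kstar (witness n hn))
    (T := insert (KStar.kstar (witness n hn)) h.quot) (g := id) (fun M hM => ?_)
    Function.injective_id.injOn
  · rwa [Finset.card_insert_of_notMem hnot, h.card_quot] at this
  · rcases Finset.mem_insert.1 hM with rfl | hM
    · exact mem_quotients_self
    · obtain ⟨w, hw, hw0, hwf⟩ := isFull_witness hn (fun K => if K = witness n hn then M else K)
        (fun K hK => by
          split_ifs
          · exact h.mem_quot.1 hM
          · exact hK) (if_neg (h.ne_words (by omega)).symm)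
      exact ⟨w, hw, by rw [h.leftQuotient_kstar hw0, hwf _ mem_quotients_self, if_pos rfl, id]⟩

end Transitions

/-! ### Boolean operations on dialects of the witnesses -/

section Boolean

variable {π ρ : Letter → Option Letter} {m n p p' q q' : ℕ} {v w : List Letter}
  {D : Set Letter} {op : BinOp}

theorem card_range_product (m n : ℕ) : (Finset.range m ×ˢ Finset.range n).card = m * n := by
  rw [Finset.card_product, Finset.card_range, Finset.card_range]

theorem mem_union_apply {α : Type*} {K L : Language α} {w : List α} :
    w ∈ BinOp.union.apply K L ↔ w ∈ K ∨ w ∈ L := Iff.rfl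

theorem mem_inter_apply {α : Type*} {K L : Language α} {w : List α} :
    w ∈ BinOp.inter.apply K L ↔ w ∈ K ∧ w ∈ L := Iff.rfl

theorem mem_diff_apply {α : Type*} {K L : Language α} {w : List α} :
    w ∈ BinOp.diff.apply K L ↔ w ∈ K ∧ w ∉ L := Iff.rfl

theorem mem_symmDiff_apply {α : Type*} {K L : Language α} {w : List α} :
    w ∈ BinOp.symmDiff.apply K L ↔ (w ∈ K ∧ w ∉ L) ∨ (w ∈ L ∧ w ∉ K) := Iff.rfl

/-- The partial maps `π` and `ρ` are injective, the letter `c` of the dialects acts as `c` under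
`π` and as `d` under `ρ`, and the letter `d` acts as `d` under `π` and as `b` under `ρ`. -/
structure IsBooleanPair (π ρ : Letter → Option Letter) : Prop where
  inj_left : IsPartialInj π
  inj_right : IsPartialInj ρ
  left_c : π .c = some .c
  left_d : π .d = some .d
  right_b : ρ .b = some .d
  right_d : ρ .d = some .c

/-- The two shared letters. -/
abbrev sharedLetters : Set Letter := {.c, .d}

theorem c_mem_shared : Letter.c ∈ sharedLetters := by simp
theorem d_mem_shared : Letter.d ∈ sharedLetters := by simp

/-! ### Restricted boolean operations: reachable and separable pairs of states -/

namespace IsBooleanPair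

variable (h : IsBooleanPair π ρ)
include h

theorem shared_subset_left : sharedLetters ⊆ dialectAlphabet π := by
  rintro x (rfl | rfl)
  exacts [⟨_, h.left_c⟩, ⟨_, h.left_d⟩]

theorem shared_subset_right : sharedLetters ⊆ dialectAlphabet ρ := by
  rintro x (rfl | rfl)
  exacts [⟨_, h.right_d⟩, ⟨_, h.right_b⟩]

theorem words_shared_left (hw : w ∈ words sharedLetters) : w ∈ words (dialectAlphabet π) :=
  words_mono h.shared_subset_left hw

theorem words_shared_right (hw : w ∈ words sharedLetters) : w ∈ words (dialectAlphabet ρ) :=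
  words_mono h.shared_subset_right hw

theorem step_left_c : letterStep π m p .c = transformation m .c p :=
  letterStep_eq h.inj_left h.left_c

theorem step_left_d : letterStep π m p .d = transformation m .d p :=
  letterStep_eq h.inj_left h.left_d

theorem step_right_d : letterStep ρ n q .d = transformation n .b q :=
  letterStep_eq h.inj_right h.right_b

/-- The word `c^q` leads to `(0, q)`, because `c` fixes 0 on the left and counts up on the right.
Each `d` then raises the first coordinate and permutes the second. -/
theorem exists_run_eq (hm : 4 ≤ m) (hn : 4 ≤ n) (hp : p < m) (hq : q < n) :
    ∃ w ∈ words sharedLetters, run π m 0 w = p ∧ run ρ n 0 w = q := by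
  induction p generalizing q with
  | zero =>
    refine ⟨_, replicate_mem_words c_mem_shared q, ?_, ?_⟩
    · clear hq
      induction q with
      | zero => rfl
      | succ q ih => rw [List.replicate_succ, run_cons, h.step_left_c]; exact ih
    · rw [run_replicate h.inj_right h.right_d hn (by omega)]
      omega
  | succ p ih =>
    -- The appended `d` acts as the involution `b` on the right, so the image of `q` under `b` is
    -- aimed at first.
    obtain ⟨w, hw, hwp, hwq⟩ := ih (by omega) (transformation_lt hn .b hq)
    refine ⟨w ++ [.d], by simp [hw], ?_, ?_⟩
    · rw [run_append, hwp, run_cons, h.step_left_d]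
      simp only [run_nil, transformation]
      split_ifs <;> omega
    · rw [run_append, hwq, run_cons, h.step_right_d]
      simp only [run_nil, transformation]
      by_cases h0 : q = 0
      · simp [h0]
      · by_cases h1 : q = 1 <;> simp [h0, h1]

theorem run_right_d_ne (hq : q ≠ q') (k : ℕ) :
    run ρ n q (List.replicate k .d) ≠ run ρ n q' (List.replicate k .d) := by
  induction k generalizing q q' with
  | zero => exact hq
  | succ k ih =>
    rw [List.replicate_succ, run_cons, run_cons, h.step_right_d, h.step_right_d]
    refine ih ?_
    simp only [transformation]
    split_ifs <;> omega

theorem run_right_d_ne_last (hn : 4 ≤ n) (hq : q ≠ n - 1) (k : ℕ) :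
    run ρ n q (List.replicate k .d) ≠ n - 1 := by
  have := h.run_right_d_ne (n := n) hq k
  rwa [run_last hn] at this

theorem run_left_c_ne_last (hm : 4 ≤ m) (hp : p ≠ m - 1) (k : ℕ) :
    run π m p (List.replicate k .c) ≠ m - 1 := by
  induction k generalizing p with
  | zero => exact hp
  | succ k ih =>
    rw [List.replicate_succ, run_cons, h.step_left_c]
    refine ih ?_
    simp only [transformation]
    split_ifs <;> omega

/-- On the left `c` merges only 0 and 1, and a state above 1 stays where it is. -/
theorem run_left_c_ne (hp : p ≠ p') (h1 : 1 < p ∨ 1 < p') (k : ℕ) :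
    run π m p (List.replicate k .c) ≠ run π m p' (List.replicate k .c) := by
  induction k generalizing p p' with
  | zero => exact hp
  | succ k ih =>
    rw [List.replicate_succ, run_cons, run_cons, h.step_left_c, h.step_left_c]
    simp only [transformation]
    refine ih ?_ ?_ <;> split_ifs <;> omega

theorem run_left_d_last (hm : 4 ≤ m) (hp : p < m) :
    run π m p (List.replicate (m - 1) .d) = m - 1 := by
  rw [run_replicate h.inj_left h.left_d hm hp]
  omega

theorem run_right_c_last (hn : 4 ≤ n) (hq : q < n) :
    run ρ n q (List.replicate (n - 1) .c) = n - 1 := by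
  rw [run_replicate h.inj_right h.right_d hn hq]
  omega

/-- Powers of `d` drive every left state to the last one while only permuting the right states; a
power of `c` then separates these. -/
theorem exists_separating_right (hm : 4 ≤ m) (hn : 4 ≤ n) (hq : q < n) (hq' : q' < n)
    (hne : q ≠ q') : ∃ v ∈ words sharedLetters, (∀ p < m, run π m p v = m - 1) ∧
      ¬ (run ρ n q v = n - 1 ↔ run ρ n q' v = n - 1) := by
  obtain ⟨k, hk⟩ := exists_separating_power h.inj_right h.right_d hn
    (run_lt (π := ρ) hn hq (List.replicate (m - 1) .d)) (run_lt hn hq' _)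
    (h.run_right_d_ne hne (m - 1))
  refine ⟨List.replicate (m - 1) .d ++ List.replicate k .c, append_mem_words.2
    ⟨replicate_mem_words d_mem_shared _, replicate_mem_words c_mem_shared _⟩, fun p hp => ?_, ?_⟩
  · rw [run_append, h.run_left_d_last hm hp, run_last hm]
  · simpa only [run_append] using hk

theorem exists_separating_left (hm : 4 ≤ m) (hn : 4 ≤ n) (hp : p < m) (hp' : p' < m)
    (hne : p ≠ p') : ∃ v ∈ words sharedLetters, (∀ q < n, run ρ n q v = n - 1) ∧
      ¬ (run π m p v = m - 1 ↔ run π m p' v = m - 1) := by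
  -- The power of `c` used next would merge 0 and 1, so this pair is first lifted by `d`.
  obtain ⟨t, ht, hne', h1⟩ : ∃ t ∈ words sharedLetters, run π m p t ≠ run π m p' t ∧
      (1 < run π m p t ∨ 1 < run π m p' t) := by
    by_cases h1 : 1 < p ∨ 1 < p'
    · exact ⟨[], nil_mem_words, hne, h1⟩
    · refine ⟨[.d], by simp, ?_⟩
      simp only [run_cons, run_nil, h.step_left_d, transformation]
      split_ifs <;> omega
  obtain ⟨k, hk⟩ := exists_separating_power h.inj_left h.left_d hm
    (run_lt (π := π) hm (run_lt (π := π) hm hp t) (List.replicate (n - 1) .c))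
    (run_lt hm (run_lt hm hp' t) _) (h.run_left_c_ne hne' h1 (n - 1))
  refine ⟨t ++ List.replicate (n - 1) .c ++ List.replicate k .d, append_mem_words.2
    ⟨append_mem_words.2 ⟨ht, replicate_mem_words c_mem_shared _⟩,
      replicate_mem_words d_mem_shared _⟩, fun q hq => ?_, ?_⟩
  · rw [run_append, run_append, h.run_right_c_last hn (run_lt hn hq t), run_last hn]
  · simpa only [run_append] using hk

/-- For union and difference the right component must stay rejecting. The separating power of `d`
ensures this, as it permutes the right states and fixes the last one. -/
theorem exists_separating_left_of_ne_last (hm : 4 ≤ m) (hn : 4 ≤ n) (hp : p < m) (hp' : p' < m)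
    (hne : p ≠ p') : ∃ v ∈ words sharedLetters, (∀ q ≠ n - 1, run ρ n q v ≠ n - 1) ∧
      ¬ (run π m p v = m - 1 ↔ run π m p' v = m - 1) := by
  obtain ⟨k, hk⟩ := exists_separating_power h.inj_left h.left_d hm hp hp' hne
  exact ⟨_, replicate_mem_words d_mem_shared k, fun q hq => h.run_right_d_ne_last hn hq k, hk⟩

theorem exists_separating_right_of_ne_last (hm : 4 ≤ m) (hn : 4 ≤ n) (hq : q < n) (hq' : q' < n)
    (hne : q ≠ q') : ∃ v ∈ words sharedLetters, (∀ p ≠ m - 1, run π m p v ≠ m - 1) ∧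
      ¬ (run ρ n q v = n - 1 ↔ run ρ n q' v = n - 1) := by
  obtain ⟨k, hk⟩ := exists_separating_power h.inj_right h.right_d hn hq hq' hne
  exact ⟨_, replicate_mem_words c_mem_shared k, fun p hp => h.run_left_c_ne_last hm hp k, hk⟩

theorem apply_mem_quotients (hm : 4 ≤ m) (hn : 4 ≤ n) (hD : sharedLetters ⊆ D)
    (hop : op ≠ .product) (hp : p < m) (hq : q < n) :
    op.apply (stateLang π m p) (stateLang ρ n q) ∈
      quotients D (op.apply (stateLang π m 0) (stateLang ρ n 0)) := by
  obtain ⟨w, hw, rfl, rfl⟩ := h.exists_run_eq hm hn hp hq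
  exact ⟨w, words_mono hD hw, by rw [leftQuotient_apply hop,
    leftQuotient_stateLang (h.words_shared_left hw),
    leftQuotient_stateLang (h.words_shared_right hw)]⟩

theorem mem_left_iff (hv : v ∈ words sharedLetters) :
    v ∈ stateLang π m p ↔ run π m p v = m - 1 := by
  simp [mem_stateLang, h.words_shared_left hv]

theorem mem_right_iff (hv : v ∈ words sharedLetters) :
    v ∈ stateLang ρ n q ↔ run ρ n q v = n - 1 := by
  simp [mem_stateLang, h.words_shared_right hv]

/-- One component is separated by words that the other accepts from every state, so membership in
the intersection depends on the separated component alone. -/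
theorem mul_le_complexity_inter (hm : 4 ≤ m) (hn : 4 ≤ n) (hD : sharedLetters ⊆ D) :
    (m * n : ℕ) ≤ complexity D (BinOp.inter.apply (stateLang π m 0) (stateLang ρ n 0)) := by
  rw [← card_range_product m n]
  refine card_le_complexity
    (g := fun i : ℕ × ℕ => BinOp.inter.apply (stateLang π m i.1) (stateLang ρ n i.2))
    (fun i hi => ?_) ?_
  · simp only [Finset.mem_product, Finset.mem_range] at hi
    exact h.apply_mem_quotients hm hn hD (by simp) hi.1 hi.2
  · rintro ⟨p, q⟩ hi ⟨p', q'⟩ hi' heq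
    simp only [Finset.coe_product, Set.mem_prod, Finset.coe_range, Set.mem_Iio] at hi hi' heq
    have key : ∀ v, v ∈ BinOp.inter.apply (stateLang π m p) (stateLang ρ n q) ↔
        v ∈ BinOp.inter.apply (stateLang π m p') (stateLang ρ n q') := fun v => by rw [heq]
    refine Prod.ext ?_ ?_ <;> by_contra hne
    · obtain ⟨v, hv, hvq, hvp⟩ := h.exists_separating_left hm hn hi.1 hi'.1 hne
      have := key v
      simp only [mem_inter_apply, h.mem_left_iff hv, h.mem_right_iff hv, hvq _ hi.2, hvq _ hi'.2]
        at this
      tauto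
    · obtain ⟨v, hv, hvp, hvq⟩ := h.exists_separating_right hm hn hi.2 hi'.2 hne
      have := key v
      simp only [mem_inter_apply, h.mem_left_iff hv, h.mem_right_iff hv, hvp _ hi.1, hvp _ hi'.1]
        at this
      tauto

theorem mul_le_complexity_symmDiff (hm : 4 ≤ m) (hn : 4 ≤ n) (hD : sharedLetters ⊆ D) :
    (m * n : ℕ) ≤ complexity D (BinOp.symmDiff.apply (stateLang π m 0) (stateLang ρ n 0)) := by
  rw [← card_range_product m n]
  refine card_le_complexity
    (g := fun i : ℕ × ℕ => BinOp.symmDiff.apply (stateLang π m i.1) (stateLang ρ n i.2))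
    (fun i hi => ?_) ?_
  · simp only [Finset.mem_product, Finset.mem_range] at hi
    exact h.apply_mem_quotients hm hn hD (by simp) hi.1 hi.2
  · rintro ⟨p, q⟩ hi ⟨p', q'⟩ hi' heq
    simp only [Finset.coe_product, Set.mem_prod, Finset.coe_range, Set.mem_Iio] at hi hi' heq
    have key : ∀ v, v ∈ BinOp.symmDiff.apply (stateLang π m p) (stateLang ρ n q) ↔
        v ∈ BinOp.symmDiff.apply (stateLang π m p') (stateLang ρ n q') := fun v => by rw [heq]
    refine Prod.ext ?_ ?_ <;> by_contra hne
    · obtain ⟨v, hv, hvq, hvp⟩ := h.exists_separating_left hm hn hi.1 hi'.1 hne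
      have := key v
      simp only [mem_symmDiff_apply, h.mem_left_iff hv, h.mem_right_iff hv, hvq _ hi.2,
        hvq _ hi'.2] at this
      tauto
    · obtain ⟨v, hv, hvp, hvq⟩ := h.exists_separating_right hm hn hi.2 hi'.2 hne
      have := key v
      simp only [mem_symmDiff_apply, h.mem_left_iff hv, h.mem_right_iff hv, hvp _ hi.1,
        hvp _ hi'.1] at this
      tauto

theorem le_complexity_diff (hm : 4 ≤ m) (hn : 4 ≤ n) (hD : sharedLetters ⊆ D) :
    (m * n - (m - 1) : ℕ) ≤
      complexity D (BinOp.diff.apply (stateLang π m 0) (stateLang ρ n 0)) := by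
  -- The pair `(0, n - 1)` represents the `m` pairs with last second component, all of which give
  -- the empty difference.
  have hcard : (insert (0, n - 1) (Finset.range m ×ˢ Finset.range (n - 1))).card =
      m * n - (m - 1) := by
    rw [Finset.card_insert_of_notMem (by simp), Finset.card_product, Finset.card_range,
      Finset.card_range]
    obtain ⟨n, rfl⟩ := Nat.exists_eq_add_of_le' (show 1 ≤ n by omega)
    have : m * (n + 1) = m * n + m := Nat.mul_succ m n
    rw [Nat.add_sub_cancel]
    omega
  rw [← hcard]
  have hT : ∀ i ∈ insert (0, n - 1) (Finset.range m ×ˢ Finset.range (n - 1)),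
      i.1 < m ∧ i.2 < n ∧ (i.2 = n - 1 → i.1 = 0) := by
    intro i hi
    simp only [Finset.mem_insert, Finset.mem_product, Finset.mem_range] at hi
    rcases hi with rfl | hi
    · exact ⟨by simp only; omega, by simp only; omega, fun _ => rfl⟩
    · omega
  refine card_le_complexity
    (g := fun i : ℕ × ℕ => BinOp.diff.apply (stateLang π m i.1) (stateLang ρ n i.2))
    (fun i hi => h.apply_mem_quotients hm hn hD (by simp) (hT i hi).1 (hT i hi).2.1) ?_
  rintro ⟨p, q⟩ hi ⟨p', q'⟩ hi' heq
  have hi := hT _ hi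
  have hi' := hT _ hi'
  simp only at hi hi' heq
  have key : ∀ v, v ∈ BinOp.diff.apply (stateLang π m p) (stateLang ρ n q) ↔
      v ∈ BinOp.diff.apply (stateLang π m p') (stateLang ρ n q') := fun v => by rw [heq]
  have hqq : q = q' := by
    by_contra hne
    obtain ⟨v, hv, hvp, hvq⟩ := h.exists_separating_right hm hn hi.2.1 hi'.2.1 hne
    have := key v
    simp only [mem_diff_apply, h.mem_left_iff hv, h.mem_right_iff hv, hvp _ hi.1, hvp _ hi'.1]
      at this
    tauto
  subst hqq
  by_cases hq : q = n - 1
  · rw [hi.2.2 hq, hi'.2.2 hq]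
  · refine Prod.ext (not_not.1 fun hne => ?_) rfl
    obtain ⟨v, hv, hvq, hvp⟩ := h.exists_separating_left_of_ne_last hm hn hi.1 hi'.1 hne
    have := key v
    simp only [mem_diff_apply, h.mem_left_iff hv, h.mem_right_iff hv, hvq _ hq] at this
    tauto

theorem le_complexity_union (hm : 4 ≤ m) (hn : 4 ≤ n) (hD : sharedLetters ⊆ D) :
    (m * n - (m + n - 2) : ℕ) ≤
      complexity D (BinOp.union.apply (stateLang π m 0) (stateLang ρ n 0)) := by
  -- The pair `(m - 1, n - 1)` represents all pairs with a last component.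
  have hcard : (insert (m - 1, n - 1) (Finset.range (m - 1) ×ˢ Finset.range (n - 1))).card =
      m * n - (m + n - 2) := by
    rw [Finset.card_insert_of_notMem (by simp), Finset.card_product, Finset.card_range,
      Finset.card_range]
    obtain ⟨n, rfl⟩ := Nat.exists_eq_add_of_le' (show 1 ≤ n by omega)
    obtain ⟨m, rfl⟩ := Nat.exists_eq_add_of_le' (show 1 ≤ m by omega)
    have : (m + 1) * (n + 1) = m * n + m + n + 1 := by ring
    rw [Nat.add_sub_cancel, Nat.add_sub_cancel]
    omega
  rw [← hcard]
  have hT : ∀ i ∈ insert (m - 1, n - 1) (Finset.range (m - 1) ×ˢ Finset.range (n - 1)),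
      i.1 < m ∧ i.2 < n ∧ (i.1 = m - 1 ↔ i.2 = n - 1) := by
    intro i hi
    simp only [Finset.mem_insert, Finset.mem_product, Finset.mem_range] at hi
    rcases hi with rfl | hi
    · exact ⟨by simp only; omega, by simp only; omega, by simp⟩
    · omega
  refine card_le_complexity
    (g := fun i : ℕ × ℕ => BinOp.union.apply (stateLang π m i.1) (stateLang ρ n i.2))
    (fun i hi => h.apply_mem_quotients hm hn hD (by simp) (hT i hi).1 (hT i hi).2.1) ?_
  rintro ⟨p, q⟩ hi ⟨p', q'⟩ hi' heq
  have hi := hT _ hi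
  have hi' := hT _ hi'
  simp only at hi hi' heq
  have key : ∀ v, v ∈ BinOp.union.apply (stateLang π m p) (stateLang ρ n q) ↔
      v ∈ BinOp.union.apply (stateLang π m p') (stateLang ρ n q') := fun v => by rw [heq]
  have hfin : p = m - 1 ↔ p' = m - 1 := by
    have := key []
    simp only [mem_union_apply, mem_stateLang, nil_mem_words, run_nil, true_and] at this
    tauto
  by_cases hpm : p = m - 1
  · exact Prod.ext (hpm.trans (hfin.1 hpm).symm)
      ((hi.2.2.1 hpm).trans (hi'.2.2.1 (hfin.1 hpm)).symm)
  · have hpm' : p' ≠ m - 1 := fun hh => hpm (hfin.2 hh)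
    have hqn : q ≠ n - 1 := fun hh => hpm (hi.2.2.2 hh)
    have hqn' : q' ≠ n - 1 := fun hh => hpm' (hi'.2.2.2 hh)
    refine Prod.ext ?_ ?_ <;> by_contra hne
    · obtain ⟨v, hv, hvq, hvp⟩ := h.exists_separating_left_of_ne_last hm hn hi.1 hi'.1 hne
      have := key v
      simp only [mem_union_apply, h.mem_left_iff hv, h.mem_right_iff hv, hvq _ hqn, hvq _ hqn']
        at this
      tauto
    · obtain ⟨v, hv, hvp, hvq⟩ := h.exists_separating_right_of_ne_last hm hn hi.2.1 hi'.2.1 hne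
      have := key v
      simp only [mem_union_apply, h.mem_left_iff hv, h.mem_right_iff hv, hvp _ hpm, hvp _ hpm']
        at this
      tauto

end IsBooleanPair

/-- The languages of the states, followed by the empty language. -/
noncomputable def extendedLang (π : Letter → Option Letter) (n q : ℕ) : Language Letter :=
  if q < n then stateLang π n q else ⊥

theorem extendedLang_le : extendedLang π n q ≤ words (dialectAlphabet π) := by
  unfold extendedLang
  split_ifs
  · exact stateLang_le
  · exact bot_le

/-- Only words that start with `x` are tested: with `x` foreign to the other operand, that operand
rejects them. Since `x` acts injectively on states, nothing is lost, and the empty language is told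
apart because every state accepts `x` followed by enough counting letters. -/
theorem extendedLang_ext {x y l : Letter} (hn : 4 ≤ n) (hπ : IsPartialInj π) (hx : π l = some x)
    (hd : π .d = some y) (hl : Function.Injective (transformation n l)) (hq : q ≤ n)
    (hq' : q' ≤ n)
    (h : ∀ u, x :: u ∈ extendedLang π n q ↔ x :: u ∈ extendedLang π n q') : q = q' := by
  have hxA : x ∈ dialectAlphabet π := ⟨_, hx⟩
  have hyA : y ∈ dialectAlphabet π := ⟨_, hd⟩
  have key : ∀ k q, q < n → (x :: List.replicate k y ∈ extendedLang π n q ↔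
      run π n (transformation n l q) (List.replicate k y) = n - 1) := fun k q hq => by
    rw [extendedLang, if_pos hq, mem_stateLang, cons_mem_words, run_cons, letterStep_eq hπ hx]
    simp [hxA, replicate_mem_words hyA k]
  have hdead : ∀ u, x :: u ∉ extendedLang π n n := fun u hu => by
    rw [extendedLang, if_neg (lt_irrefl n)] at hu
    exact hu.elim
  have hlive : ∀ q < n, x :: List.replicate (n - 1) y ∈ extendedLang π n q := fun q hq => by
    rw [key _ q hq, run_replicate hπ hd hn (transformation_lt hn l hq)]
    omega
  by_contra hne
  rcases hq.lt_or_eq with hq | rfl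
  · rcases hq'.lt_or_eq with hq' | rfl
    · obtain ⟨k, hk⟩ := exists_separating_power hπ hd hn (transformation_lt hn l hq)
        (transformation_lt hn l hq') (fun hh => hne (hl hh))
      rw [← key k q hq, ← key k q' hq'] at hk
      exact hk (h _)
    · exact hdead _ ((h _).1 (hlive q hq))
  · exact hdead _ ((h _).2 (hlive q' (lt_of_le_of_ne hq' (Ne.symm hne))))

theorem transformation_b_injective : Function.Injective (transformation n .b) := fun p q h => by
  simp only [transformation] at h
  split_ifs at h <;> omega

theorem transformation_b_b : transformation n .b (transformation n .b q) = q := by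
  simp only [transformation]
  by_cases h0 : q = 0
  · simp [h0]
  · by_cases h1 : q = 1 <;> simp [h0, h1]

theorem transformation_a_injective : Function.Injective (transformation n .a) :=
  fun p q h => by
    simp only [transformation] at h
    split_ifs at h <;> omega

theorem exists_transformation_a (hn : 4 ≤ n) (hq : q < n) :
    ∃ q' < n, transformation n .a q' = q := by
  refine ⟨if q = 0 then n - 2 else if q = n - 1 then n - 1 else q - 1, ?_, ?_⟩
  · split_ifs <;> omega
  · simp only [transformation]
    split_ifs <;> omega

/-- In addition to the shared letters, `b` acts as `b` under `π` and does not occur in the dialect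
for `ρ`, and `a` acts as `a` under `ρ` and does not occur in the dialect for `π`. -/
structure IsUnrestrictedBooleanPair (π ρ : Letter → Option Letter) : Prop
    extends IsBooleanPair π ρ where
  left_b : π .b = some .b
  right_a : ρ .a = some .a
  a_notMem : .a ∉ dialectAlphabet π
  b_notMem : .b ∉ dialectAlphabet ρ

/-! ### Unrestricted boolean operations: foreign letters empty one component -/

namespace IsUnrestrictedBooleanPair

variable (h : IsUnrestrictedBooleanPair π ρ)
include h

theorem step_left_b : letterStep π m p .b = transformation m .b p :=
  letterStep_eq h.inj_left h.left_b

theorem step_right_a : letterStep ρ n q .a = transformation n .a q :=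
  letterStep_eq h.inj_right h.right_a

theorem apply_extended_mem_quotients_left (hm : 4 ≤ m) (hn : 4 ≤ n) (hop : op ≠ .product)
    (hp : p < m) (hq : q ≤ n) (hD : dialectAlphabet π ⊆ D) :
    op.apply (extendedLang π m p) (extendedLang ρ n q) ∈
      quotients D (op.apply (stateLang π m 0) (stateLang ρ n 0)) := by
  rw [extendedLang, if_pos hp]
  rcases hq.lt_or_eq with hq | rfl
  · rw [extendedLang, if_pos hq]
    exact h.apply_mem_quotients hm hn (h.shared_subset_left.trans hD) hop hp hq
  · rw [extendedLang, if_neg (lt_irrefl q)]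
    -- The final letter `b` empties the second component and acts on the first as an involution, so
    -- the first is prepared at the image of `p` under `b`.
    obtain ⟨w, hw, hwp, -⟩ := h.exists_run_eq hm hn (transformation_lt hm .b hp)
      (show 0 < q by omega)
    have hwb : w ++ [.b] ∈ words (dialectAlphabet π) :=
      append_mem_words.2 ⟨h.words_shared_left hw, cons_mem_words.2 ⟨⟨_, h.left_b⟩, nil_mem_words⟩⟩
    refine ⟨w ++ [.b], words_mono hD hwb, ?_⟩
    rw [leftQuotient_apply hop, leftQuotient_stateLang hwb, run_append, hwp, run_cons,
      h.step_left_b, transformation_b_b, run_nil, leftQuotient_eq_bot stateLang_le]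
    simp [h.b_notMem]

theorem apply_extended_mem_quotients (hm : 4 ≤ m) (hn : 4 ≤ n) (hop : op ≠ .product)
    (hp : p ≤ m) (hq : q ≤ n) :
    op.apply (extendedLang π m p) (extendedLang ρ n q) ∈
      quotients (dialectAlphabet π ∪ dialectAlphabet ρ)
        (op.apply (stateLang π m 0) (stateLang ρ n 0)) := by
  rcases hp.lt_or_eq with hp | rfl
  · exact h.apply_extended_mem_quotients_left hm hn hop hp hq Set.subset_union_left
  rw [extendedLang, if_neg (lt_irrefl p)]
  rcases hq.lt_or_eq with hq | rfl
  · rw [extendedLang, if_pos hq]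
    obtain ⟨q', hq', rfl⟩ := exists_transformation_a hn hq
    obtain ⟨w, hw, -, hwq⟩ := h.exists_run_eq hm hn (show 0 < p by omega) hq'
    have hwa : w ++ [.a] ∈ words (dialectAlphabet ρ) :=
      append_mem_words.2 ⟨h.words_shared_right hw,
        cons_mem_words.2 ⟨⟨_, h.right_a⟩, nil_mem_words⟩⟩
    refine ⟨w ++ [.a], words_mono Set.subset_union_right hwa, ?_⟩
    rw [leftQuotient_apply hop, leftQuotient_stateLang hwa, run_append, hwq, run_cons,
      h.step_right_a, run_nil, leftQuotient_eq_bot stateLang_le]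
    simp [h.a_notMem]
  · rw [extendedLang, if_neg (lt_irrefl q)]
    refine ⟨[.b, .a], ?_, ?_⟩
    · simp only [cons_mem_words, nil_mem_words, and_true]
      exact ⟨.inl ⟨_, h.left_b⟩, .inr ⟨_, h.right_a⟩⟩
    · rw [leftQuotient_apply hop, leftQuotient_eq_bot stateLang_le,
        leftQuotient_eq_bot stateLang_le] <;> simp [h.a_notMem, h.b_notMem]

theorem left_eq (hm : 4 ≤ m) (hp : p ≤ m) (hp' : p' ≤ m)
    (heq : ∀ u, Letter.b :: u ∈ extendedLang π m p ↔ .b :: u ∈ extendedLang π m p') : p = p' :=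
  extendedLang_ext hm h.inj_left h.left_b h.left_d transformation_b_injective hp hp' heq

theorem right_eq (hn : 4 ≤ n) (hq : q ≤ n) (hq' : q' ≤ n)
    (heq : ∀ u, Letter.a :: u ∈ extendedLang ρ n q ↔ .a :: u ∈ extendedLang ρ n q') : q = q' :=
  extendedLang_ext hn h.inj_right h.right_a h.right_d (transformation_a_injective) hq hq' heq

theorem b_cons_notMem : Letter.b :: v ∉ extendedLang ρ n q := fun hv =>
  h.b_notMem (cons_mem_words.1 (extendedLang_le hv)).1

theorem a_cons_notMem : Letter.a :: v ∉ extendedLang π m p := fun hv =>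
  h.a_notMem (cons_mem_words.1 (extendedLang_le hv)).1

/-- Words starting with `b` lie in no right language and words starting with `a` in no left one. On
words lying in at most one operand, union and symmetric difference agree, so each coordinate is read
separately. -/
theorem le_complexity_union_or_symmDiff (hm : 4 ≤ m) (hn : 4 ≤ n)
    (hop : op = .union ∨ op = .symmDiff) :
    ((m + 1) * (n + 1) : ℕ) ≤ complexity (dialectAlphabet π ∪ dialectAlphabet ρ)
      (op.apply (stateLang π m 0) (stateLang ρ n 0)) := by
  have hmem : ∀ (K L : Language Letter) v, (v ∉ L → (v ∈ op.apply K L ↔ v ∈ K)) ∧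
      (v ∉ K → (v ∈ op.apply K L ↔ v ∈ L)) := by
    intro K L v
    rcases hop with rfl | rfl
    · rw [mem_union_apply]
      tauto
    · rw [mem_symmDiff_apply]
      tauto
  have hop' : op ≠ .product := by rcases hop with rfl | rfl <;> simp
  rw [← card_range_product (m + 1) (n + 1)]
  refine card_le_complexity
    (g := fun i : ℕ × ℕ => op.apply (extendedLang π m i.1) (extendedLang ρ n i.2))
    (fun i hi => ?_) ?_
  · simp only [Finset.mem_product, Finset.mem_range, Nat.lt_succ_iff] at hi
    exact h.apply_extended_mem_quotients hm hn hop' hi.1 hi.2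
  · rintro ⟨p, q⟩ hi ⟨p', q'⟩ hi' heq
    simp only [Finset.coe_product, Set.mem_prod, Finset.coe_range, Set.mem_Iio, Nat.lt_succ_iff]
      at hi hi' heq
    refine Prod.ext (h.left_eq hm hi.1 hi'.1 fun u => ?_) (h.right_eq hn hi.2 hi'.2 fun u => ?_)
    · rw [← (hmem _ _ _).1 (h.b_cons_notMem (n := n) (q := q)), heq,
        (hmem _ _ _).1 h.b_cons_notMem]
    · rw [← (hmem _ _ _).2 (h.a_cons_notMem (m := m) (p := p)), heq,
        (hmem _ _ _).2 h.a_cons_notMem]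

theorem le_complexity_diff_unrestricted (hm : 4 ≤ m) (hn : 4 ≤ n) :
    (m * n + m : ℕ) ≤ complexity (dialectAlphabet π)
      (BinOp.diff.apply (stateLang π m 0) (stateLang ρ n 0)) := by
  rw [← Nat.mul_succ, ← card_range_product m n.succ]
  refine card_le_complexity
    (g := fun i : ℕ × ℕ => BinOp.diff.apply (extendedLang π m i.1) (extendedLang ρ n i.2))
    (fun i hi => ?_) ?_
  · simp only [Finset.mem_product, Finset.mem_range, Nat.lt_succ_iff] at hi
    exact h.apply_extended_mem_quotients_left hm hn (by simp) hi.1 hi.2 le_rfl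
  · rintro ⟨p, q⟩ hi ⟨p', q'⟩ hi' heq
    simp only [Finset.coe_product, Set.mem_prod, Finset.coe_range, Set.mem_Iio, Nat.lt_succ_iff]
      at hi hi' heq
    have key : ∀ v, v ∈ BinOp.diff.apply (extendedLang π m p) (extendedLang ρ n q) ↔
        v ∈ BinOp.diff.apply (extendedLang π m p') (extendedLang ρ n q') := fun v => by rw [heq]
    simp only [mem_diff_apply] at key
    refine Prod.ext (h.left_eq hm hi.1.le hi'.1.le fun u => ?_) ?_
    · simpa [h.b_cons_notMem] using key (.b :: u)
    · by_contra hne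
      -- This word is accepted from every live state on both sides, so it tells a live second
      -- component from the empty one.
      have hall : List.replicate (m - 1) Letter.d ++ List.replicate (n - 1) .c ∈
          words sharedLetters := append_mem_words.2
        ⟨replicate_mem_words d_mem_shared _, replicate_mem_words c_mem_shared _⟩
      have hleft : ∀ v ∈ words sharedLetters, ∀ p < m, run π m p v = m - 1 →
          v ∈ extendedLang π m p := fun v hv p hp hr => by
        rw [extendedLang, if_pos hp, h.mem_left_iff hv]
        exact hr
      have hright : ∀ v ∈ words sharedLetters, ∀ q < n, (v ∈ extendedLang ρ n q ↔
          run ρ n q v = n - 1) := fun v hv q hq => by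
        rw [extendedLang, if_pos hq, h.mem_right_iff hv]
      have hdead : ∀ v, v ∉ extendedLang ρ n n := fun v hv => by
        rw [extendedLang, if_neg (lt_irrefl n)] at hv
        exact hv.elim
      have hK : ∀ p < m, List.replicate (m - 1) Letter.d ++ List.replicate (n - 1) .c ∈
          extendedLang π m p := fun p hp => hleft _ hall p hp
        (by rw [run_append, h.run_left_d_last hm hp, run_last hm])
      have hL : ∀ q < n, List.replicate (m - 1) Letter.d ++ List.replicate (n - 1) .c ∈
          extendedLang ρ n q := fun q hq => (hright _ hall q hq).2
        (by rw [run_append, h.run_right_c_last hn (run_lt hn hq _)])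
      rcases hi.2.lt_or_eq with hq | rfl
      · rcases hi'.2.lt_or_eq with hq' | rfl
        · obtain ⟨v, hv, hvp, hvq⟩ := h.exists_separating_right hm hn hq hq' hne
          have := key v
          rw [hright v hv q hq, hright v hv q' hq'] at this
          have h1 := hleft v hv p hi.1 (hvp p hi.1)
          have h2 := hleft v hv p' hi'.1 (hvp p' hi'.1)
          tauto
        · exact ((key _).2 ⟨hK _ hi'.1, hdead _⟩).2 (hL q hq)
      · exact ((key _).1 ⟨hK _ hi.1, hdead _⟩).2 (hL q' (lt_of_le_of_ne hi'.2 (Ne.symm hne)))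

end IsUnrestrictedBooleanPair

end Boolean

/-! ### Products of dialects of the witnesses -/

section Product

variable {π ρ : Letter → Option Letter} {m n p p' q q' k : ℕ} {v w : List Letter}
  {D : Set Letter}

/-- Both `π` and `ρ` are injective, fix `c` and `d`, and `ρ` fixes `a`. -/
structure IsProductPair (π ρ : Letter → Option Letter) : Prop where
  inj_left : IsPartialInj π
  inj_right : IsPartialInj ρ
  left_c : π .c = some .c
  left_d : π .d = some .d
  right_a : ρ .a = some .a
  right_c : ρ .c = some .c
  right_d : ρ .d = some .d

/-- The recursion behind all computations with `A*N`: the first letter is either absorbed by `A*` or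
starts the word of `N`. -/
theorem cons_mem_words_mul {α : Type*} {A : Set α} {N : Language α} {x : α} {w : List α} :
    x :: w ∈ words A * N ↔ (x ∈ A ∧ w ∈ words A * N) ∨ x :: w ∈ N := by
  simp only [Language.mem_mul]
  constructor
  · rintro ⟨u, hu, v, hv, huv⟩
    rcases u with _ | ⟨y, u⟩
    · exact .inr (by simpa [← huv] using hv)
    · obtain ⟨rfl, rfl⟩ := List.cons.inj huv
      exact .inl ⟨(cons_mem_words.1 hu).1, u, (cons_mem_words.1 hu).2, v, hv, rfl⟩
  · rintro (⟨hx, u, hu, v, hv, rfl⟩ | h)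
    · exact ⟨x :: u, cons_mem_words.2 ⟨hx, hu⟩, v, hv, rfl⟩
    · exact ⟨[], nil_mem_words, _, h, rfl⟩

theorem leftQuotient_mul_of_nil_notMem {α : Type*} {M N : Language α} {x : α} (h : [] ∉ M) :
    (M * N).leftQuotient [x] = M.leftQuotient [x] * N := by
  refine Language.ext fun w => ?_
  change x :: w ∈ M * N ↔ _
  simp only [Language.mem_mul]
  constructor
  · rintro ⟨u, hu, v, hv, huv⟩
    rcases u with _ | ⟨y, u⟩
    · exact absurd hu h
    · obtain ⟨rfl, rfl⟩ := List.cons.inj huv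
      exact ⟨u, hu, v, hv, rfl⟩
  · rintro ⟨u, hu, v, hv, rfl⟩
    exact ⟨x :: u, hu, v, hv, rfl⟩

theorem cons_mem_stateLang {x : Letter} : x :: w ∈ stateLang π n q ↔
    x ∈ dialectAlphabet π ∧ w ∈ stateLang π n (letterStep π n q x) := by
  simp [mem_stateLang, and_assoc]

/-- The union of the languages of the states in `S`. -/
def statesLang (ρ : Letter → Option Letter) (n : ℕ) (S : Finset ℕ) : Language Letter :=
  {x | ∃ q ∈ S, x ∈ stateLang ρ n q}

theorem mem_statesLang {S : Finset ℕ} :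
    w ∈ statesLang ρ n S ↔ ∃ q ∈ S, w ∈ stateLang ρ n q := Iff.rfl

/-- The quotients of the product by words that belong to the first factor. -/
def finalLang (π ρ : Letter → Option Letter) (n : ℕ) (S : Finset ℕ) : Language Letter :=
  words (dialectAlphabet π) * stateLang ρ n 0 ⊔ statesLang ρ n S

theorem mem_finalLang {S : Finset ℕ} : w ∈ finalLang π ρ n S ↔
    w ∈ words (dialectAlphabet π) * stateLang ρ n 0 ∨ ∃ q ∈ S, w ∈ stateLang ρ n q := Iff.rfl

theorem mem_mul_of_mem_stateLang (hw : w ∈ stateLang ρ n 0) :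
    w ∈ words (dialectAlphabet π) * stateLang ρ n 0 :=
  Language.append_mem_mul (a := []) nil_mem_words hw

/-! ### Restricted product: reaching and separating the quotients -/

namespace IsProductPair

variable (h : IsProductPair π ρ)
include h

theorem mem_left : Letter.c ∈ dialectAlphabet π ∧ Letter.d ∈ dialectAlphabet π :=
  ⟨⟨_, h.left_c⟩, ⟨_, h.left_d⟩⟩

theorem mem_right : Letter.a ∈ dialectAlphabet ρ ∧ Letter.c ∈ dialectAlphabet ρ ∧
    Letter.d ∈ dialectAlphabet ρ :=
  ⟨⟨_, h.right_a⟩, ⟨_, h.right_c⟩, ⟨_, h.right_d⟩⟩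

theorem a_cons_mem : Letter.a :: w ∈ stateLang ρ n q ↔
    w ∈ stateLang ρ n (transformation n .a q) := by
  rw [cons_mem_stateLang, letterStep_eq h.inj_right h.right_a, and_iff_right h.mem_right.1]

theorem c_cons_mem : Letter.c :: w ∈ stateLang ρ n q ↔
    w ∈ stateLang ρ n (transformation n .c q) := by
  rw [cons_mem_stateLang, letterStep_eq h.inj_right h.right_c, and_iff_right h.mem_right.2.1]

theorem d_cons_mem : Letter.d :: w ∈ stateLang ρ n q ↔
    w ∈ stateLang ρ n (transformation n .d q) := by
  rw [cons_mem_stateLang, letterStep_eq h.inj_right h.right_d, and_iff_right h.mem_right.2.2]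

theorem replicate_mem_left (hm : 4 ≤ m) (hp : p < m) :
    List.replicate k .d ∈ stateLang π m p ↔ m - 1 ≤ p + k := by
  rw [mem_stateLang, run_replicate h.inj_left h.left_d hm hp,
    and_iff_right (replicate_mem_words h.mem_left.2 k)]
  omega

theorem replicate_mem_right (hn : 4 ≤ n) (hq : q < n) :
    List.replicate k .d ∈ stateLang ρ n q ↔ n - 1 ≤ q + k := by
  rw [mem_stateLang, run_replicate h.inj_right h.right_d hn hq,
    and_iff_right (replicate_mem_words h.mem_right.2.2 k)]
  omega

/-- The shortest power of `d` in the product spends `m - 1 - p` letters on the left factor and `n -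
1` on the right one, so its length determines `p`. -/
theorem replicate_mem_mul (hm : 4 ≤ m) (hn : 4 ≤ n) (hp : p < m) :
    List.replicate k .d ∈ stateLang π m p * stateLang ρ n 0 ↔ m - 1 - p + (n - 1) ≤ k := by
  rw [Language.mem_mul]
  constructor
  · rintro ⟨u, hu, v, hv, huv⟩
    obtain ⟨hk, hu', hv'⟩ := List.append_eq_replicate_iff.1 huv
    rw [hu', h.replicate_mem_left hm hp] at hu
    rw [hv', h.replicate_mem_right hn (by omega)] at hv
    omega
  · intro hk
    exact ⟨_, (h.replicate_mem_left (k := m - 1 - p) hm hp).2 (by omega), _,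
      (h.replicate_mem_right (k := k - (m - 1 - p)) hn (by omega)).2 (by omega),
      by rw [List.replicate_append_replicate]; congr 1; omega⟩

theorem leftQuotient_replicate (hm : 4 ≤ m) (hp : p < m) :
    (stateLang π m 0 * stateLang ρ n 0).leftQuotient (List.replicate p .d) =
      stateLang π m p * stateLang ρ n 0 := by
  induction p with
  | zero => rfl
  | succ p ih =>
    have hd : [Letter.d] ∈ words (dialectAlphabet π) :=
      cons_mem_words.2 ⟨h.mem_left.2, nil_mem_words⟩
    rw [List.replicate_succ', Language.leftQuotient_append, ih (by omega),
      leftQuotient_mul_of_nil_notMem, leftQuotient_stateLang hd, run_cons,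
      letterStep_eq h.inj_left h.left_d, run_nil]
    · congr 2
      simp only [transformation]
      split_ifs <;> omega
    · intro hnil
      have : p = m - 1 := hnil.2
      omega

theorem leftQuotient_replicate_last (hm : 4 ≤ m) :
    (stateLang π m 0 * stateLang ρ n 0).leftQuotient (List.replicate (m - 1) .d) =
      words (dialectAlphabet π) * stateLang ρ n 0 := by
  rw [h.leftQuotient_replicate hm (by omega), stateLang_last hm]

/-- The part `A*L` keeps state 0 permanently present. Thus `d` shifts the set of states up and
inserts 1. If 1 is not wanted, `c` sends it back to 0, where it is absorbed, and fixes the rest. -/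
theorem exists_leftQuotient_eq_finalLang (hk : k ≤ n - 2) (S : Finset ℕ)
    (hS : ∀ q ∈ S, q ≤ k) : ∃ w ∈ words sharedLetters,
      (words (dialectAlphabet π) * stateLang ρ n 0).leftQuotient w = finalLang π ρ n S := by
  induction k generalizing S with
  | zero =>
    refine ⟨[], nil_mem_words, Language.ext fun x => ?_⟩
    rw [Language.leftQuotient_nil, mem_finalLang]
    refine ⟨.inl, ?_⟩
    rintro (hx | ⟨q, hq, hx⟩)
    · exact hx
    · obtain rfl : q = 0 := by simpa using hS q hq
      exact mem_mul_of_mem_stateLang hx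
  | succ k ih =>
    obtain ⟨w, hw, hwS⟩ := ih (by omega) ((Finset.range (k + 1)).filter (· + 1 ∈ S))
      (fun q hq => by
        have := (Finset.mem_filter.1 hq).1
        rw [Finset.mem_range] at this
        omega)
    have hd0 : transformation n .d 0 = 1 := by simp [transformation]
    have hd : ∀ x, x ∈ (words (dialectAlphabet π) * stateLang ρ n 0).leftQuotient (w ++ [.d]) ↔
        x ∈ words (dialectAlphabet π) * stateLang ρ n 0 ∨ x ∈ stateLang ρ n 1 ∨
          ∃ q ∈ S, q ≠ 0 ∧ x ∈ stateLang ρ n q := by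
      intro x
      rw [Language.leftQuotient_append, hwS, Language.mem_leftQuotient, List.singleton_append,
        mem_finalLang, cons_mem_words_mul, and_iff_right h.mem_left.2, h.d_cons_mem, or_assoc, hd0]
      refine or_congr_right (or_congr_right ⟨?_, ?_⟩)
      · rintro ⟨q, hq, hx⟩
        obtain ⟨hq, hqS⟩ := Finset.mem_filter.1 hq
        refine ⟨q + 1, hqS, by omega, ?_⟩
        rw [Finset.mem_range] at hq
        rwa [h.d_cons_mem, transformation, if_pos (by omega)] at hx
      · rintro ⟨q, hq, hq0, hx⟩
        have := hS q hq
        refine ⟨q - 1, Finset.mem_filter.2 ⟨Finset.mem_range.2 (by omega),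
          by rwa [Nat.sub_add_cancel (by omega)]⟩, ?_⟩
        rwa [h.d_cons_mem, transformation, if_pos (by omega), Nat.sub_add_cancel (by omega)]
    have hzero : ∀ x, (∃ q ∈ S, x ∈ stateLang ρ n q) ↔
        (0 ∈ S ∧ x ∈ stateLang ρ n 0) ∨ ∃ q ∈ S, q ≠ 0 ∧ x ∈ stateLang ρ n q := by
      intro x
      constructor
      · rintro ⟨q, hq, hx⟩
        by_cases hq0 : q = 0
        · subst hq0
          exact .inl ⟨hq, hx⟩
        · exact .inr ⟨q, hq, hq0, hx⟩
      · rintro (⟨h0, hx⟩ | ⟨q, hq, -, hx⟩)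
        exacts [⟨0, h0, hx⟩, ⟨q, hq, hx⟩]
    have hcons := fun x => mem_mul_of_mem_stateLang (π := π) (ρ := ρ) (n := n) (w := x)
    by_cases h1 : 1 ∈ S
    · refine ⟨w ++ [.d], by simp [hw], Language.ext fun x => ?_⟩
      rw [hd, mem_finalLang, hzero]
      have key : ∀ P Q R T E : Prop, (Q → P) → (R → E) → (P ∨ R ∨ E ↔ P ∨ (T ∧ Q) ∨ E) := by
        tauto
      exact key _ _ _ _ _ (hcons x) fun hx => ⟨1, h1, one_ne_zero, hx⟩
    · refine ⟨w ++ [.d] ++ [.c], by simp [hw], Language.ext fun x => ?_⟩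
      have hc : ∀ q ∈ S, (Letter.c :: x ∈ stateLang ρ n q ↔ x ∈ stateLang ρ n q) := by
        intro q hq
        have : q ≠ 1 := fun hh => h1 (hh ▸ hq)
        rw [h.c_cons_mem, transformation, if_neg this]
      have hc0 : Letter.c :: x ∈ stateLang ρ n 0 ↔ x ∈ stateLang ρ n 0 := by
        rw [h.c_cons_mem, transformation, if_neg zero_ne_one]
      have hc1 : Letter.c :: x ∈ stateLang ρ n 1 ↔ x ∈ stateLang ρ n 0 := by
        rw [h.c_cons_mem, transformation, if_pos rfl]
      have hcS : (∃ q ∈ S, q ≠ 0 ∧ Letter.c :: x ∈ stateLang ρ n q) ↔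
          ∃ q ∈ S, q ≠ 0 ∧ x ∈ stateLang ρ n q :=
        exists_congr fun q => and_congr_right fun hq => by rw [hc q hq]
      rw [Language.leftQuotient_append, Language.mem_leftQuotient, List.singleton_append, hd,
        cons_mem_words_mul, hc0, hc1, hcS, mem_finalLang, hzero, and_iff_right h.mem_left.1]
      have key : ∀ P Q T E : Prop, (Q → P) → ((P ∨ Q) ∨ Q ∨ E ↔ P ∨ (T ∧ Q) ∨ E) := by
        tauto
      exact key _ _ _ _ (hcons x)

/-- The rotation brings exactly `q` to `n - 2`, the only non-final state from which `d` enters the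
final state. -/
theorem rotate_mem_iff (hn : 4 ≤ n) (hq : q ≤ n - 2) (hq' : q' ≤ n - 2) (hk : k + q = n - 2) :
    List.replicate k .a ++ [.d] ∈ stateLang ρ n q' ↔ q' = q := by
  induction k generalizing q q' with
  | zero =>
    rw [List.replicate_zero, List.nil_append, h.d_cons_mem, mem_stateLang,
      and_iff_right nil_mem_words, run_nil, transformation]
    split_ifs
    omega
  | succ k ih =>
    rw [List.replicate_succ, List.cons_append, h.a_cons_mem, ih (q := q + 1) (by omega) ?_ (by omega)]
    all_goals
      rw [transformation]
      by_cases h1 : q' < n - 2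
      · rw [if_pos h1]
        omega
      · rw [if_neg h1, if_pos (by omega)]
        omega

/-- The nonempty suffixes of `a^k d` have the form `a^j d` with `j ≤ k`. Such a word is accepted
from 0 only for `j = n - 2`, so the permanent state 0 does not spoil the test for the states `1, …,
n - 2`. -/
theorem rotate_notMem_mul (hn : 4 ≤ n) (hk : k < n - 2) :
    List.replicate k .a ++ [.d] ∉ words (dialectAlphabet π) * stateLang ρ n 0 := by
  induction k with
  | zero =>
    rw [List.replicate_zero, List.nil_append, cons_mem_words_mul]
    rintro (⟨-, hx⟩ | hx)
    · obtain ⟨u, -, v, hv, huv⟩ := Language.mem_mul.1 hx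
      obtain ⟨-, rfl⟩ := List.append_eq_nil_iff.1 huv
      have : 0 = n - 1 := hv.2
      omega
    · have := (h.rotate_mem_iff (k := 0) (q := n - 2) hn le_rfl (Nat.zero_le _) (by omega)).1 hx
      omega
  | succ k ih =>
    rw [List.replicate_succ, List.cons_append, cons_mem_words_mul]
    rintro (⟨-, hx⟩ | hx)
    · exact ih (by omega) hx
    · have := (h.rotate_mem_iff (k := k + 1) (q := n - 2 - (k + 1)) hn (by omega)
        (Nat.zero_le _) (by omega)).1 hx
      omega

theorem mem_of_statesLang_eq (hn : 4 ≤ n) {S T : Finset ℕ} (hS : S ⊆ Finset.range (n - 1))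
    (hT : T ⊆ Finset.range (n - 1)) (heq : statesLang ρ n S = statesLang ρ n T) : S ⊆ T := by
  intro q hq
  have hq' := Finset.mem_range.1 (hS hq)
  have hmem : List.replicate (n - 2 - q) .a ++ [.d] ∈ statesLang ρ n S :=
    ⟨q, hq, (h.rotate_mem_iff (q := q) hn (by omega) (by omega) (by omega)).2 rfl⟩
  rw [heq] at hmem
  obtain ⟨t, ht, hmem⟩ := hmem
  have ht' := Finset.mem_range.1 (hT ht)
  rw [h.rotate_mem_iff (q := q) hn (by omega) (by omega) (by omega)] at hmem
  exact hmem ▸ ht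

theorem mem_of_finalLang_eq (hn : 4 ≤ n) {S T : Finset ℕ} (hS : S ⊆ Finset.Icc 1 (n - 2))
    (hT : T ⊆ Finset.Icc 1 (n - 2)) (heq : finalLang π ρ n S = finalLang π ρ n T) : S ⊆ T := by
  intro q hq
  have hq' := Finset.mem_Icc.1 (hS hq)
  have hmem : List.replicate (n - 2 - q) .a ++ [.d] ∈ finalLang π ρ n S :=
    .inr ⟨q, hq, (h.rotate_mem_iff (q := q) hn (by omega) (by omega) (by omega)).2 rfl⟩
  rw [heq] at hmem
  obtain ⟨t, ht, hmem⟩ := hmem.resolve_left (h.rotate_notMem_mul hn (by omega))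
  have ht' := Finset.mem_Icc.1 (hT ht)
  rw [h.rotate_mem_iff (q := q) hn (by omega) (by omega) (by omega)] at hmem
  exact hmem ▸ ht

end IsProductPair

open Classical in
/-- Distinct quotients of the product by words over the shared letters. -/
noncomputable def sharedQuotients (π ρ : Letter → Option Letter) (m n : ℕ) :
    Finset (Language Letter) :=
  (Finset.range (m - 1)).image (fun p => stateLang π m p * stateLang ρ n 0) ∪
    ((Finset.Icc 1 (n - 2)).powerset.image (finalLang π ρ n) ∪
      {(words (dialectAlphabet π) * stateLang ρ n 0).leftQuotient (List.replicate (n - 1) .d)})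

theorem disjoint_of_word {α : Type*} {F G : Finset (Language α)} (w : List α)
    (hF : ∀ M ∈ F, w ∈ M) (hG : ∀ M ∈ G, w ∉ M) : Disjoint F G :=
  Finset.disjoint_left.2 fun M hM hM' => hG M hM' (hF M hM)

theorem le_complexity_of_subset {α : Type*} {A : Set α} {L : Language α} {F : Finset (Language α)}
    (hF : ∀ M ∈ F, M ∈ quotients A L) : (F.card : ℕ∞) ≤ complexity A L :=
  card_le_complexity (g := id) hF Function.injective_id.injOn

theorem nil_notMem_stateLang (hq : q ≠ n - 1) : [] ∉ stateLang ρ n q := fun hh => hq hh.2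

theorem nil_notMem_finalLang (hn : 4 ≤ n) {S : Finset ℕ} (hS : ∀ q ∈ S, q < n - 1) :
    [] ∉ finalLang π ρ n S := by
  rintro (hh | ⟨q, hq, hh⟩)
  · obtain ⟨u, -, v, hv, huv⟩ := Language.mem_mul.1 hh
    obtain ⟨-, rfl⟩ := List.append_eq_nil_iff.1 huv
    exact nil_notMem_stateLang (by omega) hv
  · exact nil_notMem_stateLang (hS q hq).ne hh

namespace IsProductPair

variable (h : IsProductPair π ρ)
include h

/-- Three families are separated by two words. The empty word lies in the quotient by `d^(n-1)` but
in no `finalLang` of non-final states; `d^(n-1)` lies in both of these families but is too short for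
any product with a proper quotient of the first factor. -/
theorem card_sharedQuotients (hm : 4 ≤ m) (hn : 4 ≤ n) :
    (sharedQuotients π ρ m n).card = m + 2 ^ (n - 2) := by
  classical
  have hinj1 : Set.InjOn (fun p => stateLang π m p * stateLang ρ n 0) (Finset.range (m - 1)) := by
    intro p hp p' hp' heq
    simp only [Finset.coe_range, Set.mem_Iio] at hp hp' heq
    have key : ∀ k, m - 1 - p + (n - 1) ≤ k ↔ m - 1 - p' + (n - 1) ≤ k := fun k => by
      rw [← h.replicate_mem_mul hm hn (by omega), heq, h.replicate_mem_mul hm hn (by omega)]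
    have h1 := (key _).1 le_rfl
    have h2 := (key _).2 le_rfl
    omega
  have hinj2 : Set.InjOn (finalLang π ρ n) ((Finset.Icc 1 (n - 2)).powerset) := by
    intro S hS T hT heq
    have hS := Finset.mem_powerset.1 hS
    have hT := Finset.mem_powerset.1 hT
    exact Finset.Subset.antisymm (h.mem_of_finalLang_eq hn hS hT heq)
      (h.mem_of_finalLang_eq hn hT hS heq.symm)
  have hdN : List.replicate (n - 1) Letter.d ∈ words (dialectAlphabet π) * stateLang ρ n 0 :=
    mem_mul_of_mem_stateLang ((h.replicate_mem_right hn (by omega)).2 (by omega))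
  rw [sharedQuotients, Finset.card_union_of_disjoint, Finset.card_union_of_disjoint,
    Finset.card_image_of_injOn hinj1, Finset.card_image_of_injOn hinj2, Finset.card_powerset,
    Nat.card_Icc, Finset.card_range, Finset.card_singleton]
  · have : n - 2 + 1 - 1 = n - 2 := by omega
    rw [this]
    omega
  · refine (disjoint_of_word [] ?_ ?_).symm
    · intro M hM
      rw [Finset.mem_singleton] at hM
      rw [hM, Language.mem_leftQuotient, List.append_nil]
      exact hdN
    · intro M hM
      obtain ⟨S, hS, rfl⟩ := Finset.mem_image.1 hM
      refine nil_notMem_finalLang hn fun q hq => ?_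
      have := Finset.mem_Icc.1 (Finset.mem_powerset.1 hS hq)
      omega
  · refine (disjoint_of_word (List.replicate (n - 1) .d) ?_ ?_).symm
    · intro M hM
      rcases Finset.mem_union.1 hM with hM | hM
      · obtain ⟨S, -, rfl⟩ := Finset.mem_image.1 hM
        exact .inl hdN
      · rw [Finset.mem_singleton] at hM
        rw [hM, Language.mem_leftQuotient]
        exact Language.append_mem_mul (replicate_mem_words h.mem_left.2 _)
          ((h.replicate_mem_right hn (by omega)).2 (by omega))
    · intro M hM
      obtain ⟨p, hp, rfl⟩ := Finset.mem_image.1 hM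
      have := Finset.mem_range.1 hp
      rw [h.replicate_mem_mul hm hn (by omega)]
      omega

theorem finalLang_mem_quotients (hm : 4 ≤ m) (hD : sharedLetters ⊆ D) {S : Finset ℕ}
    (hS : ∀ q ∈ S, q ≤ n - 2) :
    finalLang π ρ n S ∈ quotients D (stateLang π m 0 * stateLang ρ n 0) := by
  obtain ⟨w, hw, hwS⟩ := h.exists_leftQuotient_eq_finalLang le_rfl S hS
  rw [← hwS, ← h.leftQuotient_replicate_last hm]
  exact leftQuotient_mem_quotients ⟨_, replicate_mem_words (hD d_mem_shared) _, rfl⟩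
    (words_mono hD hw)

theorem mem_quotients_of_mem_sharedQuotients (hm : 4 ≤ m) (hD : sharedLetters ⊆ D)
    {M : Language Letter} (hM : M ∈ sharedQuotients π ρ m n) :
    M ∈ quotients D (stateLang π m 0 * stateLang ρ n 0) := by
  classical
  have hd : ∀ k, List.replicate k .d ∈ words D := replicate_mem_words (hD d_mem_shared)
  rcases Finset.mem_union.1 hM with hM | hM
  · obtain ⟨p, hp, rfl⟩ := Finset.mem_image.1 hM
    have := Finset.mem_range.1 hp
    exact ⟨_, hd p, (h.leftQuotient_replicate hm (by omega)).symm⟩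
  rcases Finset.mem_union.1 hM with hM | hM
  · obtain ⟨S, hS, rfl⟩ := Finset.mem_image.1 hM
    exact h.finalLang_mem_quotients hm hD fun q hq =>
      (Finset.mem_Icc.1 (Finset.mem_powerset.1 hS hq)).2
  · rw [Finset.mem_singleton.1 hM, ← h.leftQuotient_replicate_last hm]
    exact leftQuotient_mem_quotients ⟨_, hd _, rfl⟩ (hd _)

theorem le_complexity_mul (hm : 4 ≤ m) (hn : 4 ≤ n) (hD : sharedLetters ⊆ D) :
    (m + 2 ^ (n - 2) : ℕ) ≤ complexity D (stateLang π m 0 * stateLang ρ n 0) := by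
  rw [← h.card_sharedQuotients hm hn]
  exact le_complexity_of_subset fun M => h.mem_quotients_of_mem_sharedQuotients hm hD

end IsProductPair

/-- In addition, `b` acts as `b` under `π` and does not occur in the dialect for `ρ`, and `a` does
not occur in the dialect for `π`. -/
structure IsUnrestrictedProductPair (π ρ : Letter → Option Letter) : Prop
    extends IsProductPair π ρ where
  left_b : π .b = some .b
  a_notMem : .a ∉ dialectAlphabet π
  b_notMem : .b ∉ dialectAlphabet ρ

/-! ### Unrestricted product: quotients after the first factor is cut off -/

namespace IsUnrestrictedProductPair

variable (h : IsUnrestrictedProductPair π ρ)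
include h

theorem shared_subset : sharedLetters ⊆ dialectAlphabet π ∪ dialectAlphabet ρ := by
  rintro x (rfl | rfl)
  exacts [.inl h.mem_left.1, .inl h.mem_left.2]

theorem a_mem : Letter.a ∈ dialectAlphabet π ∪ dialectAlphabet ρ := .inr h.mem_right.1

/-- The letter `a` is foreign to the first operand, so the factor in `A*` must be empty. The
permanent state 0 thereby becomes an ordinary member of the set. -/
theorem leftQuotient_finalLang (S : Finset ℕ) : (finalLang π ρ n S).leftQuotient [.a] =
    statesLang ρ n ((insert 0 S).image (transformation n .a)) := by
  refine Language.ext fun x => ?_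
  rw [Language.mem_leftQuotient, List.singleton_append, mem_finalLang, cons_mem_words_mul,
    mem_statesLang, Finset.exists_mem_image, Finset.exists_mem_insert, h.a_cons_mem]
  simp only [h.a_notMem, false_and, false_or, h.a_cons_mem]

theorem leftQuotient_statesLang (S : Finset ℕ) : (statesLang ρ n S).leftQuotient [.a] =
    statesLang ρ n (S.image (transformation n .a)) := by
  refine Language.ext fun x => ?_
  rw [Language.mem_leftQuotient, List.singleton_append, mem_statesLang, mem_statesLang,
    Finset.exists_mem_image]
  simp only [h.a_cons_mem]

omit h in
theorem image_filter_rotate (hn : 4 ≤ n) {S : Finset ℕ} (hS : S ⊆ Finset.range (n - 1)) :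
    ((Finset.range (n - 1)).filter (transformation n .a · ∈ S)).image (transformation n .a) = S := by
  ext q
  simp only [Finset.mem_image, Finset.mem_filter, Finset.mem_range]
  constructor
  · rintro ⟨p, hp, rfl⟩
    exact hp.2
  · intro hq
    have := Finset.mem_range.1 (hS hq)
    obtain ⟨p, hp, rfl⟩ := exists_transformation_a hn (show q < n by omega)
    refine ⟨p, ⟨?_, hq⟩, rfl⟩
    rcases Nat.lt_or_ge p (n - 1) with h1 | h1
    · exact h1
    · obtain rfl : p = n - 1 := by omega
      rw [transformation_last hn] at this
      omega

/-- A set containing 1 is the image under `a` of a set containing 0, which the final quotients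
provide. Further rotations by `a` reach every nonempty set, and `b`, foreign to the second operand,
gives the empty one. -/
theorem statesLang_mem_quotients (hm : 4 ≤ m) (hn : 4 ≤ n) {S : Finset ℕ}
    (hS : S ⊆ Finset.range (n - 1)) : statesLang ρ n S ∈
      quotients (dialectAlphabet π ∪ dialectAlphabet ρ) (stateLang π m 0 * stateLang ρ n 0) := by
  have ha : [Letter.a] ∈ words (dialectAlphabet π ∪ dialectAlphabet ρ) :=
    cons_mem_words.2 ⟨h.a_mem, nil_mem_words⟩
  have hsub : ∀ S : Finset ℕ,
      (Finset.range (n - 1)).filter (transformation n .a · ∈ S) ⊆ Finset.range (n - 1) :=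
    fun S => Finset.filter_subset _ _
  have hpos : ∀ k, k + 1 ≤ n - 2 → ∀ S ⊆ Finset.range (n - 1), k + 1 ∈ S → statesLang ρ n S ∈
      quotients (dialectAlphabet π ∪ dialectAlphabet ρ)
        (stateLang π m 0 * stateLang ρ n 0) := by
    intro k hk
    induction k with
    | zero =>
      intro S hS h1
      have h0 : 0 ∈ (Finset.range (n - 1)).filter (transformation n .a · ∈ S) := by
        rw [Finset.mem_filter, Finset.mem_range, transformation, if_pos (by omega)]
        exact ⟨by omega, h1⟩
      rw [← image_filter_rotate hn hS, ← Finset.insert_eq_of_mem h0, ← h.leftQuotient_finalLang]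
      refine leftQuotient_mem_quotients (h.finalLang_mem_quotients hm h.shared_subset ?_) ha
      intro q hq
      have := Finset.mem_range.1 (hsub S hq)
      omega
    | succ k ih =>
      intro S hS hk'
      rw [← image_filter_rotate hn hS, ← h.leftQuotient_statesLang]
      refine leftQuotient_mem_quotients (ih (by omega) _ (hsub S) ?_) ha
      rw [Finset.mem_filter, Finset.mem_range, transformation, if_pos (by omega)]
      exact ⟨by omega, hk'⟩
  rcases S.eq_empty_or_nonempty with rfl | ⟨q, hq⟩
  · have hb : (statesLang ρ n {1}).leftQuotient [.b] = statesLang ρ n ∅ := by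
      refine Language.ext fun x => ?_
      rw [Language.mem_leftQuotient, List.singleton_append, mem_statesLang, mem_statesLang]
      simp [cons_mem_stateLang, h.b_notMem]
    rw [← hb]
    exact leftQuotient_mem_quotients (hpos 0 (by omega) {1} (by simp; omega) (by simp))
      (cons_mem_words.2 ⟨.inl ⟨_, h.left_b⟩, nil_mem_words⟩)
  · have hq' := Finset.mem_range.1 (hS hq)
    cases q with
    | zero =>
      rw [← image_filter_rotate hn hS, ← h.leftQuotient_statesLang]
      -- The predecessor of 0 under `a` is `n - 2 = (n - 3) + 1`.
      refine leftQuotient_mem_quotients (hpos (n - 3) (by omega) _ (hsub S) ?_) ha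
      rw [Finset.mem_filter, Finset.mem_range, transformation, if_neg (by omega),
        if_pos (by omega)]
      exact ⟨by omega, hq⟩
    | succ q => exact hpos q (by omega) S hS hq

theorem le_complexity_mul_unrestricted (hm : 4 ≤ m) (hn : 4 ≤ n) :
    (m + 2 ^ (n - 1) + 2 ^ (n - 2) + 1 : ℕ) ≤ complexity (dialectAlphabet π ∪ dialectAlphabet ρ)
      (stateLang π m 0 * stateLang ρ n 0) := by
  classical
  -- The letter `a` cuts off the first factor and the word `a d^(n-1)` already lies in the second
  -- language, so `z` consists of all words over the alphabet of `ρ`.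
  set z := (words (dialectAlphabet π) * stateLang ρ n 0).leftQuotient
    (.a :: List.replicate (n - 1) .d) with hz
  have hb : ∀ q x, Letter.b :: x ∉ stateLang ρ n q := fun q x hx =>
    h.b_notMem (cons_mem_stateLang.1 hx).1
  have hdL : List.replicate (n - 1) Letter.d ∈ stateLang ρ n 0 :=
    (h.replicate_mem_right hn (by omega)).2 (by omega)
  have hdK : ∀ p < m, List.replicate (m - 1) Letter.d ∈ stateLang π m p := fun p hp =>
    (h.replicate_mem_left hm hp).2 (by omega)
  have hbK : ∀ p < m, Letter.b :: List.replicate (m - 1) .d ∈ stateLang π m p := fun p hp =>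
    cons_mem_stateLang.2 ⟨⟨_, h.left_b⟩, hdK _ (letterStep_lt hm hp _)⟩
  have hbA : Letter.b :: List.replicate (m - 1) .d ∈ words (dialectAlphabet π) := (hbK 0 (by omega)).1
  have hinj : Set.InjOn (statesLang ρ n) ((Finset.range (n - 1)).powerset) := by
    intro S hS T hT heq
    have hS := Finset.mem_powerset.1 hS
    have hT := Finset.mem_powerset.1 hT
    exact Finset.Subset.antisymm (h.mem_of_statesLang_eq hn hS hT heq)
      (h.mem_of_statesLang_eq hn hT hS heq.symm)
  have hcard : (sharedQuotients π ρ m n ∪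
      ((Finset.range (n - 1)).powerset.image (statesLang ρ n) ∪ {z})).card =
      m + 2 ^ (n - 1) + 2 ^ (n - 2) + 1 := by
    rw [Finset.card_union_of_disjoint, Finset.card_union_of_disjoint, h.card_sharedQuotients hm hn,
      Finset.card_image_of_injOn hinj, Finset.card_powerset, Finset.card_range,
      Finset.card_singleton]
    · ring
    · refine (disjoint_of_word [] ?_ ?_).symm
      · intro M hM
        rw [Finset.mem_singleton.1 hM, hz, Language.mem_leftQuotient, List.append_nil]
        refine mem_mul_of_mem_stateLang (h.a_cons_mem.2 ?_)
        rw [transformation, if_pos (by omega), h.replicate_mem_right hn (by omega)]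
        omega
      · intro M hM
        obtain ⟨S, hS, rfl⟩ := Finset.mem_image.1 hM
        rintro ⟨q, hq, hnil⟩
        have := Finset.mem_range.1 (Finset.mem_powerset.1 hS hq)
        exact nil_notMem_stateLang (by omega) hnil
    -- This word lies in every quotient where the first factor is still open. It starts with `b`, so
    -- it lies in none of the quotients that involve the second operand only.
    · refine disjoint_of_word (.b :: List.replicate (m - 1) .d ++ List.replicate (n - 1) .d) ?_ ?_
      · intro M hM
        rcases Finset.mem_union.1 hM with hM | hM
        · obtain ⟨p, hp, rfl⟩ := Finset.mem_image.1 hM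
          have := Finset.mem_range.1 hp
          exact Language.append_mem_mul (hbK p (by omega)) hdL
        rcases Finset.mem_union.1 hM with hM | hM
        · obtain ⟨S, -, rfl⟩ := Finset.mem_image.1 hM
          exact .inl (Language.append_mem_mul hbA hdL)
        · rw [Finset.mem_singleton.1 hM, Language.mem_leftQuotient, ← List.append_assoc]
          exact Language.append_mem_mul
            (append_mem_words.2 ⟨replicate_mem_words h.mem_left.2 _, hbA⟩) hdL
      · intro M hM
        rcases Finset.mem_union.1 hM with hM | hM
        · obtain ⟨S, -, rfl⟩ := Finset.mem_image.1 hM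
          rintro ⟨q, -, hx⟩
          exact hb _ _ hx
        · rw [Finset.mem_singleton.1 hM, hz, Language.mem_leftQuotient, List.cons_append,
            cons_mem_words_mul]
          rintro (⟨ha, -⟩ | hx)
          · exact h.a_notMem ha
          · exact h.b_notMem (hx.1 .b (by simp))
  rw [← hcard]
  refine le_complexity_of_subset fun M hM => ?_
  rcases Finset.mem_union.1 hM with hM | hM
  · exact h.mem_quotients_of_mem_sharedQuotients hm h.shared_subset hM
  rcases Finset.mem_union.1 hM with hM | hM
  · obtain ⟨S, hS, rfl⟩ := Finset.mem_image.1 hM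
    exact h.statesLang_mem_quotients hm hn (Finset.mem_powerset.1 hS)
  · rw [Finset.mem_singleton.1 hM, hz, ← h.leftQuotient_replicate_last hm]
    have hd := h.shared_subset d_mem_shared
    exact leftQuotient_mem_quotients ⟨_, replicate_mem_words hd _, rfl⟩
      (cons_mem_words.2 ⟨h.a_mem, replicate_mem_words hd _⟩)

end IsUnrestrictedProductPair

end Product

/-! ### The partial maps -/

section Maps

variable {f : ℕ → ℕ → ℕ} {op : BinOp}

/-- The restricted boolean operations: the first map. -/
def booleanLeft : Letter → Option Letter
  | .c => some .c
  | .d => some .d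
  | _ => none

/-- The restricted boolean operations: the second map. -/
def booleanRight : Letter → Option Letter
  | .b => some .d
  | .d => some .c
  | _ => none

/-- The unrestricted boolean operations: the first map. -/
def unrestrictedBooleanLeft : Letter → Option Letter
  | .b => some .b
  | .c => some .c
  | .d => some .d
  | _ => none

/-- The unrestricted boolean operations: the second map. -/
def unrestrictedBooleanRight : Letter → Option Letter
  | .a => some .a
  | .b => some .d
  | .d => some .c
  | _ => none

/-- The unrestricted product: the second map. The first is `unrestrictedBooleanLeft`. -/
def unrestrictedProductRight : Letter → Option Letter
  | .a => some .a
  | .c => some .c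
  | .d => some .d
  | _ => none

theorem isBooleanPair : IsBooleanPair booleanLeft booleanRight where
  inj_left := by rintro (_ | _ | _ | _) (_ | _ | _ | _) (_ | _ | _ | _) <;> simp [booleanLeft]
  inj_right := by rintro (_ | _ | _ | _) (_ | _ | _ | _) (_ | _ | _ | _) <;> simp [booleanRight]
  left_c := rfl
  left_d := rfl
  right_b := rfl
  right_d := rfl

theorem isUnrestrictedBooleanPair :
    IsUnrestrictedBooleanPair unrestrictedBooleanLeft unrestrictedBooleanRight where
  inj_left := by
    rintro (_ | _ | _ | _) (_ | _ | _ | _) (_ | _ | _ | _) <;> simp [unrestrictedBooleanLeft]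
  inj_right := by
    rintro (_ | _ | _ | _) (_ | _ | _ | _) (_ | _ | _ | _) <;> simp [unrestrictedBooleanRight]
  left_b := rfl
  left_c := rfl
  left_d := rfl
  right_a := rfl
  right_b := rfl
  right_d := rfl
  a_notMem := by rintro ⟨_ | _ | _ | _, h⟩ <;> simp [unrestrictedBooleanLeft] at h
  b_notMem := by rintro ⟨_ | _ | _ | _, h⟩ <;> simp [unrestrictedBooleanRight] at h

theorem isProductPair_some : IsProductPair some some :=
  ⟨isPartialInj_some, isPartialInj_some, rfl, rfl, rfl, rfl, rfl⟩

theorem isUnrestrictedProductPair :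
    IsUnrestrictedProductPair unrestrictedBooleanLeft unrestrictedProductRight where
  inj_left := isUnrestrictedBooleanPair.inj_left
  inj_right := by
    rintro (_ | _ | _ | _) (_ | _ | _ | _) (_ | _ | _ | _) <;> simp [unrestrictedProductRight]
  left_b := rfl
  left_c := rfl
  left_d := rfl
  right_a := rfl
  right_c := rfl
  right_d := rfl
  a_notMem := isUnrestrictedBooleanPair.a_notMem
  b_notMem := by rintro ⟨_ | _ | _ | _, h⟩ <;> simp [unrestrictedProductRight] at h

theorem dialectAlphabet_booleanLeft : dialectAlphabet booleanLeft = sharedLetters := by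
  refine Set.Subset.antisymm ?_ isBooleanPair.shared_subset_left
  rintro y ⟨_ | _ | _ | _, h⟩ <;> simp_all [booleanLeft]

theorem dialectAlphabet_booleanRight : dialectAlphabet booleanRight = sharedLetters := by
  refine Set.Subset.antisymm ?_ isBooleanPair.shared_subset_right
  rintro y ⟨_ | _ | _ | _, h⟩ <;> simp_all [booleanRight]

/-- An upper bound together with a matching pair of dialects gives the restricted complexity. -/
theorem isRestrictedComplexity_of_le
    (hub : ∀ (α : Type u) (A : Set α) (K L : Language α) (m n : ℕ), 4 ≤ m → 4 ≤ n →
      IsRightIdealOfComplexity A m K → IsRightIdealOfComplexity A n L →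
      complexity A (op.apply K L) ≤ f m n)
    -- The bound is required a second time because `Letter` lives in the lowest universe and not in
    -- `u`.
    (hub' : ∀ (A : Set Letter) (K L : Language Letter) (m n : ℕ), 4 ≤ m → 4 ≤ n →
      IsRightIdealOfComplexity A m K → IsRightIdealOfComplexity A n L →
      complexity A (op.apply K L) ≤ f m n)
    {π ρ : Letter → Option Letter} {x y : Letter} (hπ : IsPartialInj π) (hρ : IsPartialInj ρ)
    (hπd : π .d = some x) (hρd : ρ .d = some y) (halph : dialectAlphabet π = dialectAlphabet ρ)
    (hlb : ∀ m n, 4 ≤ m → 4 ≤ n →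
      (f m n : ℕ∞) ≤ complexity (dialectAlphabet π) (op.apply (stateLang π m 0) (stateLang ρ n 0))) :
    IsRestrictedComplexity.{u} op f := by
  refine ⟨hub, π, ρ, halph, fun m n hm hn => ?_⟩
  have hK := isRightIdealOfComplexity_dialect hπ hπd hm
  have hL := isRightIdealOfComplexity_dialect hρ hρd hn
  refine ⟨hK, hL, le_antisymm (hub' _ _ _ m n hm hn hK (halph ▸ hL)) ?_⟩
  rw [dialect_witness hπ, dialect_witness hρ]
  exact hlb m n hm hn

/-- An upper bound together with a matching pair of dialects gives the unrestricted complexity. -/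
theorem isUnrestrictedComplexity_of_le
    (hub : ∀ (α : Type u) (A B : Set α) (K L : Language α) (m n : ℕ), 4 ≤ m → 4 ≤ n →
      IsRightIdealOfComplexity A m K → IsRightIdealOfComplexity B n L →
      complexity (op.alphabet A B) (op.apply K L) ≤ f m n)
    (hub' : ∀ (A B : Set Letter) (K L : Language Letter) (m n : ℕ), 4 ≤ m → 4 ≤ n →
      IsRightIdealOfComplexity A m K → IsRightIdealOfComplexity B n L →
      complexity (op.alphabet A B) (op.apply K L) ≤ f m n)
    {π ρ : Letter → Option Letter} {x y : Letter} (hπ : IsPartialInj π) (hρ : IsPartialInj ρ)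
    (hπd : π .d = some x) (hρd : ρ .d = some y)
    (hlb : ∀ m n, 4 ≤ m → 4 ≤ n →
      (f m n : ℕ∞) ≤ complexity (op.alphabet (dialectAlphabet π) (dialectAlphabet ρ))
        (op.apply (stateLang π m 0) (stateLang ρ n 0))) :
    IsUnrestrictedComplexity.{u} op f := by
  refine ⟨hub, π, ρ, fun m n hm hn => ?_⟩
  have hK := isRightIdealOfComplexity_dialect hπ hπd hm
  have hL := isRightIdealOfComplexity_dialect hρ hρd hn
  refine ⟨hK, hL, le_antisymm (hub' _ _ _ _ m n hm hn hK hL) ?_⟩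
  rw [dialect_witness hπ, dialect_witness hρ]
  exact hlb m n hm hn

theorem isRestrictedComplexity_boolean
    (hub : ∀ (α : Type u) (A : Set α) (K L : Language α) (m n : ℕ), 4 ≤ m → 4 ≤ n →
      IsRightIdealOfComplexity A m K → IsRightIdealOfComplexity A n L →
      complexity A (op.apply K L) ≤ f m n)
    (hub' : ∀ (A : Set Letter) (K L : Language Letter) (m n : ℕ), 4 ≤ m → 4 ≤ n →
      IsRightIdealOfComplexity A m K → IsRightIdealOfComplexity A n L →
      complexity A (op.apply K L) ≤ f m n)
    (hlb : ∀ m n, 4 ≤ m → 4 ≤ n → (f m n : ℕ∞) ≤ complexity (dialectAlphabet booleanLeft)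
      (op.apply (stateLang booleanLeft m 0) (stateLang booleanRight n 0))) :
    IsRestrictedComplexity.{u} op f :=
  isRestrictedComplexity_of_le hub hub' isBooleanPair.inj_left isBooleanPair.inj_right rfl rfl
    (dialectAlphabet_booleanLeft.trans dialectAlphabet_booleanRight.symm) hlb

theorem shared_subset_booleanLeft : sharedLetters ⊆ dialectAlphabet booleanLeft :=
  isBooleanPair.shared_subset_left

theorem restricted_product :
    IsRestrictedComplexity.{u} .product (fun m n => m + 2 ^ (n - 2)) := by
  refine isRestrictedComplexity_of_le
    (fun _ _ _ _ _ _ hm hn hK hL => hK.complexity_mul_le hL (by omega) (by omega))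
    (fun _ _ _ _ _ hm hn hK hL => hK.complexity_mul_le hL (by omega) (by omega))
    isPartialInj_some isPartialInj_some rfl rfl rfl fun m n hm hn => ?_
  exact isProductPair_some.le_complexity_mul hm hn (by simp [dialectAlphabet_some])

theorem restricted_inter : IsRestrictedComplexity.{u} .inter (fun m n => m * n) :=
  isRestrictedComplexity_boolean
    (fun _ _ _ _ _ _ _ _ hK hL => hK.complexity_apply_le hL (by simp))
    (fun _ _ _ _ _ _ _ hK hL => hK.complexity_apply_le hL (by simp))
    fun _ _ hm hn => isBooleanPair.mul_le_complexity_inter hm hn shared_subset_booleanLeft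

theorem restricted_symmDiff : IsRestrictedComplexity.{u} .symmDiff (fun m n => m * n) :=
  isRestrictedComplexity_boolean
    (fun _ _ _ _ _ _ _ _ hK hL => hK.complexity_apply_le hL (by simp))
    (fun _ _ _ _ _ _ _ hK hL => hK.complexity_apply_le hL (by simp))
    fun _ _ hm hn => isBooleanPair.mul_le_complexity_symmDiff hm hn shared_subset_booleanLeft

theorem restricted_diff : IsRestrictedComplexity.{u} .diff (fun m n => m * n - (m - 1)) :=
  isRestrictedComplexity_boolean
    (fun _ _ _ _ _ _ hm hn hK hL => hK.complexity_diff_le hL (by omega) (by omega))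
    (fun _ _ _ _ _ hm hn hK hL => hK.complexity_diff_le hL (by omega) (by omega))
    fun _ _ hm hn => isBooleanPair.le_complexity_diff hm hn shared_subset_booleanLeft

theorem restricted_union : IsRestrictedComplexity.{u} .union (fun m n => m * n - (m + n - 2)) :=
  isRestrictedComplexity_boolean
    (fun _ _ _ _ _ _ hm hn hK hL => hK.complexity_union_le hL (by omega) (by omega))
    (fun _ _ _ _ _ hm hn hK hL => hK.complexity_union_le hL (by omega) (by omega))
    fun _ _ hm hn => isBooleanPair.le_complexity_union hm hn shared_subset_booleanLeft

theorem unrestricted_product :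
    IsUnrestrictedComplexity.{u} .product (fun m n => m + 2 ^ (n - 1) + 2 ^ (n - 2) + 1) :=
  isUnrestrictedComplexity_of_le
    (fun _ _ _ _ _ _ _ hm hn hK hL =>
      hK.complexity_mul_le_unrestricted hL (by omega) (by omega) _)
    (fun _ _ _ _ _ _ hm hn hK hL =>
      hK.complexity_mul_le_unrestricted hL (by omega) (by omega) _)
    isUnrestrictedProductPair.inj_left isUnrestrictedProductPair.inj_right rfl rfl
    fun _ _ hm hn => isUnrestrictedProductPair.le_complexity_mul_unrestricted hm hn

theorem unrestricted_union :
    IsUnrestrictedComplexity.{u} .union (fun m n => (m + 1) * (n + 1)) :=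
  isUnrestrictedComplexity_of_le
    (fun _ _ _ _ _ _ _ _ _ hK hL => hK.complexity_apply_le_succ hL (by simp) _)
    (fun _ _ _ _ _ _ _ _ hK hL => hK.complexity_apply_le_succ hL (by simp) _)
    isUnrestrictedBooleanPair.inj_left isUnrestrictedBooleanPair.inj_right rfl rfl
    fun _ _ hm hn => isUnrestrictedBooleanPair.le_complexity_union_or_symmDiff hm hn (.inl rfl)

theorem unrestricted_symmDiff :
    IsUnrestrictedComplexity.{u} .symmDiff (fun m n => (m + 1) * (n + 1)) :=
  isUnrestrictedComplexity_of_le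
    (fun _ _ _ _ _ _ _ _ _ hK hL => hK.complexity_apply_le_succ hL (by simp) _)
    (fun _ _ _ _ _ _ _ _ hK hL => hK.complexity_apply_le_succ hL (by simp) _)
    isUnrestrictedBooleanPair.inj_left isUnrestrictedBooleanPair.inj_right rfl rfl
    fun _ _ hm hn => isUnrestrictedBooleanPair.le_complexity_union_or_symmDiff hm hn (.inr rfl)

theorem unrestricted_diff : IsUnrestrictedComplexity.{u} .diff (fun m n => m * n + m) :=
  isUnrestrictedComplexity_of_le
    (fun _ _ _ _ _ _ _ _ _ hK hL => hK.complexity_diff_le_unrestricted hL)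
    (fun _ _ _ _ _ _ _ _ hK hL => hK.complexity_diff_le_unrestricted hL)
    isUnrestrictedBooleanPair.inj_left isUnrestrictedBooleanPair.inj_right rfl rfl
    fun _ _ hm hn => isUnrestrictedBooleanPair.le_complexity_diff_unrestricted hm hn

/-- The restricted pair serves again: both alphabets contain the two shared letters, which suffice
for the lower bound. -/
theorem unrestricted_inter : IsUnrestrictedComplexity.{u} .inter (fun m n => m * n) :=
  isUnrestrictedComplexity_of_le
    (fun _ _ _ _ _ _ _ _ _ hK hL => hK.complexity_inter_le_unrestricted hL)
    (fun _ _ _ _ _ _ _ _ hK hL => hK.complexity_inter_le_unrestricted hL)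
    isBooleanPair.inj_left isBooleanPair.inj_right rfl rfl
    fun _ _ hm hn => isBooleanPair.mul_le_complexity_inter hm hn
      (Set.subset_inter isBooleanPair.shared_subset_left isBooleanPair.shared_subset_right)

end Maps

end StateComplexity
theorem theorem7 :
    -- the DFA is minimal, and its language is a right ideal of complexity n with these values
    (∀ (n : ℕ) (hn : 4 ≤ n),
      IsMinimalDFA (witnessDFA n hn) ∧
      IsRightIdealOfComplexity Set.univ n (witness n hn) ∧
      semigroupSize Set.univ (witness n hn) = (n ^ (n - 1) : ℕ) ∧
      words Set.univ ∈ quotients Set.univ (witness n hn) ∧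
      complexity Set.univ (words (Set.univ : Set Letter)) = 1 ∧
      (∀ K ∈ quotients Set.univ (witness n hn), K ≠ words Set.univ →
        complexity Set.univ K = n) ∧
      complexity Set.univ (witness n hn).reverse = (2 ^ (n - 1) : ℕ) ∧
      (atoms Set.univ (witness n hn)).encard = (2 ^ (n - 1) : ℕ) ∧
      (∀ S ∈ atomSets Set.univ (witness n hn), ∀ s : ℕ, S.encard = s →
        complexity Set.univ (atomicIntersection Set.univ (witness n hn) S) = atomBound n s) ∧
      complexity Set.univ ((witness n hn)∗) = (n + 1 : ℕ)) ∧
    -- these values are maximal among right ideals, and four letters are needed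
    (∀ (α : Type u) (A : Set α) (n : ℕ) (L : Language α), 4 ≤ n →
      IsRightIdealOfComplexity A n L →
      semigroupSize A L ≤ (n ^ (n - 1) : ℕ) ∧
      words A ∈ quotients A L ∧
      complexity A (words A) = 1 ∧
      (∀ K ∈ quotients A L, complexity A K ≤ n) ∧
      complexity A L.reverse ≤ (2 ^ (n - 1) : ℕ) ∧
      (atoms A L).encard ≤ (2 ^ (n - 1) : ℕ) ∧
      (∀ S ∈ atomSets A L, S.Nonempty ∧ ∀ s : ℕ, S.encard = s →
        complexity A (atomicIntersection A L S) ≤ atomBound n s) ∧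
      complexity A (L∗) ≤ (n + 1 : ℕ) ∧
      (semigroupSize A L = (n ^ (n - 1) : ℕ) → 4 ≤ A.encard)) ∧
    -- restricted product and boolean operations
    IsRestrictedComplexity.{u} .product (fun m n => m + 2 ^ (n - 2)) ∧
    IsRestrictedComplexity.{u} .inter (fun m n => m * n) ∧
    IsRestrictedComplexity.{u} .symmDiff (fun m n => m * n) ∧
    IsRestrictedComplexity.{u} .diff (fun m n => m * n - (m - 1)) ∧
    IsRestrictedComplexity.{u} .union (fun m n => m * n - (m + n - 2)) ∧
    -- unrestricted product and boolean operations
    IsUnrestrictedComplexity.{u} .product (fun m n => m + 2 ^ (n - 1) + 2 ^ (n - 2) + 1) ∧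
    IsUnrestrictedComplexity.{u} .union (fun m n => (m + 1) * (n + 1)) ∧
    IsUnrestrictedComplexity.{u} .symmDiff (fun m n => (m + 1) * (n + 1)) ∧
    IsUnrestrictedComplexity.{u} .diff (fun m n => m * n + m) ∧
    IsUnrestrictedComplexity.{u} .inter (fun m n => m * n) := by
  refine ⟨fun n hn => ?_, fun α A n L hn h => ?_, restricted_product, restricted_inter,
    restricted_symmDiff, restricted_diff, restricted_union, unrestricted_product,
    unrestricted_union, unrestricted_symmDiff, unrestricted_diff, unrestricted_inter⟩
  · have h := isRightIdealOfComplexity_witness hn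
    have hF := isFull_witness hn
    have h2 : 2 ≤ n := by omega
    exact ⟨isMinimalDFA_witnessDFA hn, h, h.semigroupSize_eq hF h2, h.words_mem_quotients h2,
      complexity_words, fun K hK hne => h.complexity_quotient_eq hF h2 hK hne,
      h.complexity_reverse_eq hF h2, h.encard_atoms_eq hF h2,
      fun S hS s hs => h.complexity_atom_eq hF h2 hS hs, complexity_kstar_witness hn⟩
  · have h2 : 2 ≤ n := by omega
    exact ⟨h.semigroupSize_le h2, h.words_mem_quotients h2, complexity_words,
      fun K hK => h.complexity_quotient_le hK, h.complexity_reverse_le h2, h.encard_atoms_le h2,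
      fun S hS => ⟨⟨_, h.words_mem_of_mem_atomSets h2 hS⟩,
        fun s hs => h.complexity_atom_le h2 hS hs⟩, h.complexity_kstar_le,
      fun hs => h.four_le_encard (h.isFull_of_semigroupSize h2 hs) hn⟩
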